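/- **Setting.** Let $S$ be a smooth manifold (Hausdorff, $\sigma$-compact, finite-dimensional), and let $NS,\mathcal A,\mathcal B$ and $C_i$ ($i$ in a finite set) be smooth real vector bundles of finite rank over $S$. Fix $k_0<0$ and degrees $k_i<0$ with $k_i\neq k_0$. Let $M$ be the total space of $NS$, and let $\mathcal E$ be the graded vector bundle over $M$ whose part $\mathcal E_{k_0}$ is the pull-back of $\mathcal A\oplus\mathcal B$ along $NS\to S$ and whose part $\mathcal E_k$, $k\ne k_0$, is the pull-back of $\bigoplus_{k_i=k}C_i$. Put $C^\infty(\mathcal E)=\Gamma(S(\mathcal E^*))$, where $S(\cdot)$ is the graded symmetric algebra; similarly $C^\infty(\mathcal E_{k_0})$, $C^\infty(\mathcal A)=\Gamma(S(\mathcal A^*))$. Local coordinates are $x$ on $S$, and linear fibre coordinates $y$ on $NS$, $\xi$ on $\mathcal A$, $\eta$ on $\mathcal B$ (both of degree $-k_0$), $\gamma$ on the $C_i$. Let $\mathfrak X(\mathcal E)$ be the multi-vector fields on $\mathcal E$ with the Schouten–Nijenhuis bracket, graded by $\|Z\|=|Z|+l-1$ for $Z$ of multiplicity $l$ and inner degree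 $|Z|$. Let $Q=Q^++Q^-$ be a blended homological vector field: $\|Q^\pm\|=\pm1$ and $[Q^+,Q^+]=[Q^-,Q^-]=[Q^+,Q^-]=0$. *Coisotropic type.* A subbundle $\mathcal K$ of $\mathcal E_{k_0}$ over a submanifold of $M$ is of coisotropic type if $Q|_{\mathcal E_{k_0}}(N^\perp\mathcal K)=0$, that is, if for all $l\ge0$ and all $f_1,\dots,f_l\in C^\infty(\mathcal E_{k_0})$ vanishing on $\mathcal K$ the function $Q(df_1,\dots,df_l)$ vanishes on $\mathcal K$ (for $l=0$: the component of $Q$ of multiplicity $0$ vanishes on $\mathcal K$). *Analyticity.* A function on $\mathcal E_{k_0}$ is polynomial along $p^!NS$ if it is a polynomial in $y$, $\xi$, $\eta$ with coefficients in $C^\infty(S)$; it is analytic along $p^!NS$ if on each fibre of $NS$ every coefficient of it (as an element of the symmetric algebra in $\xi,\eta$) is everywhere the sum of its Maclaurin series in $y$. $Q$ is analytic along $p^!NS$ if $Q|_{\mathcal E_{k_0}}(F_1,\dots,F_l)$ is analytic along $p^!NS$ for all $l$ and all $F_1,\dots,F_l\in C^\infty(\mathcal E_{k_0})$ that are polynomial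 along $p^!NS$. *The $L_\infty$-algebra.* Let $p:\mathcal A\to S$ be the projection and $\mathfrak a=\Gamma\big(S(p^!NS[-1]\oplus p^!\mathcal B[-1])[1]\big)$, the multi-sections over $\mathcal A$ of $p^!(NS\oplus\mathcal B)$. Let $I:\mathfrak a\to\mathfrak X(\mathcal E)$ be the algebra morphism with $F(x,\xi)\mapsto F(x,\xi)$, $\sigma\mapsto\sigma^j\partial/\partial y^j$, $w_q\mapsto\partial/\partial\eta^q$ (where $(w_q)$ is the frame of $\mathcal B$ dual to $(\eta^q)$), and let $P:\mathfrak X(\mathcal E)\to\mathfrak a$ be the projection that restricts coefficients to $y=0,\eta=0,\gamma=0$ and sends $\partial/\partial x,\partial/\partial\xi,\partial/\partial\gamma$ to $0$. The blended $L_\infty$-algebra $\mathfrak a_Q^P$ is $\mathfrak a$ with the structure maps $m_k(a_1,\dots,a_k)=P[\cdots[[Q^+,I(a_1)],I(a_2)],\cdots,I(a_k)]$ and $n_k(a_1,\dots,a_k)=P[\cdots[[Q^-,I(a_1)],I(a_2)],\cdots,I(a_k)]$, $k\ge0$. An element $v\in\mathfrak a_0$ is Maurer–Cartan if $\sum_{k\ge0}\frac1{k!}(m_k+n_k)(v,\dots,v)$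 converges to $0$, coefficient by coefficient at each point of $S$. **Theorem.** Suppose that $Q$ is analytic along $p^!NS$. Let $(\sigma,\phi)\in\mathfrak a'_0=\Gamma(NS)\oplus\Gamma(\mathcal A^*\otimes\mathcal B)\subset\mathfrak a_0$, and let $\mathcal A_{\sigma,\phi}$ be the graph of (the pull-back of) $\phi$ over the graph of $\sigma$ in $M=NS$. Then $\mathcal A_{\sigma,\phi}$ is of coisotropic type if and only if $-(\sigma,\phi)$ is a Maurer–Cartan element of $\mathfrak a_Q^P$. -/

import Mathlib

open scoped Manifold ContDiff Bundle

noncomputable section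

universe u v

namespace BlendedQ

/-! ## The sign `(-1)^z` and free graded commutative algebras -/

/-- The sign `(-1)^z`. -/
def sgn (z : ℤ) : ℝ := ((z.negOnePow : ℤ) : ℝ)

/-- The relations that turn the free algebra on `⊔ j, W j` into the graded symmetric algebra of the
graded vector space `⨁ j, W j`, the summand `W j` being placed in degree `wt j`. -/
inductive GSym.Rel {J : Type*} (wt : J → ℕ) (W : J → Type*)
    [∀ j, AddCommGroup (W j)] [∀ j, Module ℝ (W j)] :
    FreeAlgebra ℝ (Σ j, W j) → FreeAlgebra ℝ (Σ j, W j) → Prop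
  | add (j : J) (v w : W j) : GSym.Rel wt W (FreeAlgebra.ι ℝ ⟨j, v + w⟩)
      (FreeAlgebra.ι ℝ ⟨j, v⟩ + FreeAlgebra.ι ℝ ⟨j, w⟩)
  | smul (j : J) (c : ℝ) (v : W j) : GSym.Rel wt W (FreeAlgebra.ι ℝ ⟨j, c • v⟩)
      (c • FreeAlgebra.ι ℝ ⟨j, v⟩)
  | comm (i j : J) (v : W i) (w : W j) : GSym.Rel wt W
      (FreeAlgebra.ι ℝ ⟨i, v⟩ * FreeAlgebra.ι ℝ ⟨j, w⟩)
      (((-1 : ℝ) ^ (wt i * wt j)) • (FreeAlgebra.ι ℝ ⟨j, w⟩ * FreeAlgebra.ι ℝ ⟨i, v⟩))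

/-- The graded symmetric algebra `S(⨁ j, W j)`, with `W j` in degree `wt j`. -/
def GSym {J : Type*} (wt : J → ℕ) (W : J → Type*)
    [∀ j, AddCommGroup (W j)] [∀ j, Module ℝ (W j)] : Type _ :=
  RingQuot (GSym.Rel wt W)

namespace GSym

section

variable {J : Type*} (wt : J → ℕ) (W : J → Type*)
  [∀ j, AddCommGroup (W j)] [∀ j, Module ℝ (W j)]

instance instRing : Ring (GSym wt W) := inferInstanceAs (Ring (RingQuot (GSym.Rel wt W)))

instance instAlgebra : Algebra ℝ (GSym wt W) :=
  inferInstanceAs (Algebra ℝ (RingQuot (GSym.Rel wt W)))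

variable {W}

/-- The generator of `S(⨁ j, W j)` given by `v ∈ W j`. -/
def gen (j : J) (v : W j) : GSym wt W :=
  RingQuot.mkAlgHom ℝ (GSym.Rel wt W) (FreeAlgebra.ι ℝ ⟨j, v⟩)

theorem gen_comm (i j : J) (v : W i) (w : W j) :
    gen wt i v * gen wt j w = ((-1 : ℝ) ^ (wt i * wt j)) • (gen wt j w * gen wt i v) := by
  have h := RingQuot.mkAlgHom_rel ℝ (GSym.Rel.comm (wt := wt) (W := W) i j v w)
  rw [map_mul, map_smul, map_mul] at h
  exact h

theorem gen_add (j : J) (v w : W j) : gen wt j (v + w) = gen wt j v + gen wt j w := by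
  have h := RingQuot.mkAlgHom_rel ℝ (GSym.Rel.add (wt := wt) (W := W) j v w)
  rw [map_add] at h
  exact h

theorem gen_smul (j : J) (c : ℝ) (v : W j) : gen wt j (c • v) = c • gen wt j v := by
  have h := RingQuot.mkAlgHom_rel ℝ (GSym.Rel.smul (wt := wt) (W := W) j c v)
  rw [map_smul] at h
  exact h

/-- The inclusion of `W j` as a linear map. -/
def genL (j : J) : W j →ₗ[ℝ] GSym wt W where
  toFun := gen wt j
  map_add' := gen_add wt j
  map_smul' := gen_smul wt j

/-- The universal property of the graded symmetric algebra. -/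
def lift {A : Type*} [Ring A] [Algebra ℝ A] (T : ∀ j, W j →ₗ[ℝ] A)
    (hT : ∀ i j (v : W i) (w : W j),
      T i v * T j w = ((-1 : ℝ) ^ (wt i * wt j)) • (T j w * T i v)) :
    GSym wt W →ₐ[ℝ] A :=
  RingQuot.liftAlgHom ℝ ⟨FreeAlgebra.lift ℝ (fun s : Σ j, W j => T s.1 s.2), by
    intro x y h
    cases h with
    | add j v w => simp
    | smul j c v => simp
    | comm i j v w => simpa using hT i j v w⟩

theorem lift_gen {A : Type*} [Ring A] [Algebra ℝ A] (T : ∀ j, W j →ₗ[ℝ] A)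
    (hT : ∀ i j (v : W i) (w : W j),
      T i v * T j w = ((-1 : ℝ) ^ (wt i * wt j)) • (T j w * T i v)) (j : J) (v : W j) :
    lift wt T hT (gen wt j v) = T j v := by
  unfold lift gen
  erw [RingQuot.liftAlgHom_mkAlgHom_apply]
  simp

/-- The matrix `(τ(v), c(v); 0, v)` of a generator `v`, with `τ(v) = (-1)^(w |v|) v`. -/
def dMat (w : ℕ) (c : ∀ j, W j →ₗ[ℝ] ℝ) (j : J) :
    W j →ₗ[ℝ] Matrix (Fin 2) (Fin 2) (GSym wt W) where
  toFun v := !![((-1 : ℝ) ^ (w * wt j)) • gen wt j v, algebraMap ℝ _ (c j v); 0, gen wt j v]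
  map_add' v v' := by
    ext a b; fin_cases a <;> fin_cases b <;> simp [gen_add]
  map_smul' r v := by
    ext a b
    fin_cases a <;> fin_cases b <;> simp [gen_smul, Algebra.smul_def]
    rw [← mul_assoc, ← mul_assoc, ← map_one (algebraMap ℝ (GSym wt W)), ← map_neg, ← map_pow,
      ← map_mul, ← map_mul, mul_comm]

/-- The left derivation `∂` of degree `-w` of the graded symmetric algebra that takes the value
`c j v` on the generator `v ∈ W j`: `∂(s t) = ∂(s) t + (-1)^(w |s|) s ∂(t)`. It is read off the
upper right corner of the algebra morphism `s ↦ (τ(s), ∂(s); 0, s)`. -/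
def leftDeriv (w : ℕ) (c : ∀ j, W j →ₗ[ℝ] ℝ) (hc : ∀ j, c j ≠ 0 → wt j = w)
    (s : GSym wt W) : GSym wt W :=
  lift wt (dMat wt w c) (by
    intro i j v v'
    have key : ((-1 : ℝ) ^ (w * wt i)) * c j v' = ((-1 : ℝ) ^ (wt i * wt j)) * c j v' := by
      by_cases h : c j = 0
      · simp [h]
      · rw [hc j h, mul_comm w]
    have key2 : c i v = ((-1 : ℝ) ^ (wt i * wt j)) * ((-1 : ℝ) ^ (w * wt j)) * c i v := by
      by_cases h : c i = 0
      · simp [h]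
      · rw [hc i h, ← mul_pow]; simp
    ext a b
    fin_cases a <;> fin_cases b
    · simp only [dMat]
      simp [gen_comm wt i j v v', smul_smul]
      congr 1
      ring
    · simp only [dMat]
      simp
      rw [← Algebra.commutes (c j v'), ← Algebra.commutes (c i v), ← Algebra.smul_def,
        ← Algebra.smul_def]
      simp only [smul_smul, ← mul_assoc]
      rw [key, ← key2, add_comm]
    · simp [dMat]
    · simp [dMat, gen_comm wt i j v v']) s 0 1

end

end GSym

/-! ## Smooth vector bundles and their sections -/

/-- A smooth real vector bundle of finite rank over `S`. -/
structure SmoothVB (m : ℕ) (S : Type u) [TopologicalSpace S]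
    [ChartedSpace (EuclideanSpace ℝ (Fin m)) S] where
  /-- the model fibre -/
  F : Type v
  /-- the fibres -/
  Fib : S → Type v
  [normedF : NormedAddCommGroup F]
  [spaceF : NormedSpace ℝ F]
  [finF : FiniteDimensional ℝ F]
  [topFib : ∀ x, TopologicalSpace (Fib x)]
  [groupFib : ∀ x, AddCommGroup (Fib x)]
  [moduleFib : ∀ x, Module ℝ (Fib x)]
  [topTot : TopologicalSpace (Bundle.TotalSpace F Fib)]
  [fibreBundle : FiberBundle F Fib]
  [vectorBundle : VectorBundle ℝ F Fib]
  [smoothBundle : ContMDiffVectorBundle ∞ F Fib (𝓡 m)]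

attribute [instance] SmoothVB.normedF SmoothVB.spaceF SmoothVB.finF SmoothVB.topFib
  SmoothVB.groupFib SmoothVB.moduleFib SmoothVB.topTot SmoothVB.fibreBundle
  SmoothVB.vectorBundle SmoothVB.smoothBundle

section Bundles

variable {m : ℕ} {S : Type u} [TopologicalSpace S] [ChartedSpace (EuclideanSpace ℝ (Fin m)) S]

/-- The total space of a vector bundle. -/
abbrev SmoothVB.Tot (W : SmoothVB.{u, v} m S) : Type (max u v) := Bundle.TotalSpace W.F W.Fib

instance instFiniteFib (W : SmoothVB.{u, v} m S) (x : S) : FiniteDimensional ℝ (W.Fib x) :=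
  ((trivializationAt W.F W.Fib x).continuousLinearEquivAt ℝ x
    (mem_baseSet_trivializationAt W.F W.Fib x)).toLinearEquiv.symm.finiteDimensional

/-- Smooth functions on the total space. -/
def SmoothVB.IsSmoothFun (W : SmoothVB.{u, v} m S) (f : W.Tot → ℝ) : Prop :=
  ContMDiff ((𝓡 m).prod 𝓘(ℝ, W.F)) 𝓘(ℝ, ℝ) ∞ f

/-- Smooth sections of `W`. -/
abbrev SmoothVB.Sec (W : SmoothVB.{u, v} m S) := ContMDiffSection (𝓡 m) W.F ∞ W.Fib

/-- Smooth sections of the dual bundle `W*`, i.e. fibrewise linear smooth functions on `W`. -/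
structure DualSec (W : SmoothVB.{u, v} m S) where
  /-- the value at a point -/
  val : ∀ x, Module.Dual ℝ (W.Fib x)
  smooth : W.IsSmoothFun (fun p => val p.1 p.2)

/-- Smooth sections of `A* ⊗ B`, i.e. smooth bundle morphisms `A → B` over the identity. -/
structure BundleHom (A B : SmoothVB.{u, v} m S) where
  /-- the value at a point -/
  val : ∀ x, A.Fib x →ₗ[ℝ] B.Fib x
  smooth : ContMDiff ((𝓡 m).prod 𝓘(ℝ, A.F)) ((𝓡 m).prod 𝓘(ℝ, B.F)) ∞
    (fun p : A.Tot => (⟨p.1, val p.1 p.2⟩ : B.Tot))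

/-- The pull-back `φ*β` of a section `β` of `B*`. -/
def BundleHom.pull {A B : SmoothVB.{u, v} m S} (φ : BundleHom A B) (β : DualSec B) : DualSec A where
  val x := (β.val x).comp (φ.val x)
  smooth := by
    have h := β.smooth
    unfold SmoothVB.IsSmoothFun at h ⊢
    exact h.comp φ.smooth

instance instInhabitedDualSec (W : SmoothVB.{u, v} m S) : Inhabited (DualSec W) :=
  ⟨⟨fun _ => 0, by unfold SmoothVB.IsSmoothFun; simpa using contMDiff_const⟩⟩

/-- A smooth section of `W*` that takes the value `c` at `x`. -/
def DualSec.through (W : SmoothVB.{u, v} m S) (x : S) (c : Module.Dual ℝ (W.Fib x)) : DualSec W :=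
  Classical.epsilon (fun s : DualSec W => s.val x = c)

end Bundles

/-! ## The graded manifold near the subbundle `𝒜` -/

/-- Labels of the bundles that make up the graded vector bundle. -/
inductive Idx (ι : Type) : Type
  | A : Idx ι
  | B : Idx ι
  | C (i : ι) : Idx ι

/-- The graded manifold `ℰ` over the tubular neighbourhood `M = NS` of `S`, with a subbundle `𝒜`
over `S` concentrated in degree `k₀ = -k`, and with a complement `ℬ` of it:
`ℰ_{k₀}` is the pull-back of `𝒜 ⊕ ℬ` along `NS → S`, and, for `j ≠ k`,
`ℰ_{-j}` is the pull-back of the direct sum of the `C i` with `wtC i = j`. -/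
structure GradedMfd (m : ℕ) (S : Type u) [TopologicalSpace S]
    [ChartedSpace (EuclideanSpace ℝ (Fin m)) S] where
  /-- the normal bundle `NS` -/
  N : SmoothVB.{u, v} m S
  /-- the subbundle `𝒜` -/
  A : SmoothVB.{u, v} m S
  /-- the complement `ℬ` -/
  B : SmoothVB.{u, v} m S
  /-- labels of the bundles in degrees other than `k₀` -/
  ι : Type
  [finι : Finite ι]
  /-- the bundles in degrees other than `k₀` -/
  C : ι → SmoothVB.{u, v} m S
  /-- `k = -k₀`, the degree of the linear coordinates on `𝒜` and `ℬ` -/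
  k : ℕ
  k_pos : 0 < k
  /-- the degree of the linear coordinates on `C i` -/
  wtC : ι → ℕ
  wtC_pos : ∀ i, 0 < wtC i
  wtC_ne : ∀ i, wtC i ≠ k

section Graded

variable {m : ℕ} {S : Type u} [TopologicalSpace S] [ChartedSpace (EuclideanSpace ℝ (Fin m)) S]

namespace GradedMfd

/-- The bundle with a given label. -/
def bdl (D : GradedMfd.{u, v} m S) : Idx D.ι → SmoothVB.{u, v} m S
  | .A => D.A
  | .B => D.B
  | .C i => D.C i

/-- The degree of the linear coordinates on the bundle with a given label. -/
def wt (D : GradedMfd.{u, v} m S) : Idx D.ι → ℕ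
  | .A => D.k
  | .B => D.k
  | .C i => D.wtC i

/-- The base manifold `M = NS`. -/
abbrev Base (D : GradedMfd.{u, v} m S) : Type (max u v) := D.N.Tot

/-- The fibre of `S(ℰ*)` at the points of `NS` over `x`. As `ℰ` is pulled back from `S`, it is the
same for all these points. -/
abbrev Sym (D : GradedMfd.{u, v} m S) (x : S) : Type v :=
  GSym D.wt (fun j => Module.Dual ℝ ((D.bdl j).Fib x))

/-- The graded symmetric algebra of the dual of one vector space, placed in degree `k`. -/
abbrev Sym1 (k : ℕ) (K : Type v) [AddCommGroup K] [Module ℝ K] : Type v :=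
  GSym (fun _ : Unit => k) (fun _ : Unit => Module.Dual ℝ K)

/-- The fibre of `S(𝒜*)` at `x`. -/
abbrev SymA (D : GradedMfd.{u, v} m S) (x : S) : Type v := Sym1 D.k (D.A.Fib x)

/-- All (not necessarily smooth) sections of `S(ℰ*)` over `NS`, with the pointwise product. -/
abbrev Amb (D : GradedMfd.{u, v} m S) : Type (max u v) := ∀ p : D.Base, D.Sym p.1

/-- A section together with a degree. -/
abbrev GFun (D : GradedMfd.{u, v} m S) : Type (max u v) := ℤ × D.Amb

/-- The span of the products `c · α₁ ⋯ αᵣ` of total degree `d`, where `c` is a coefficient function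
from a given class and the `αᵢ` are pulled back from smooth sections of the duals of bundles with
labels in a given set. -/
def funSpan (D : GradedMfd.{u, v} m S) (coef : Set (D.Base → ℝ)) (lab : Set (Idx D.ι)) (d : ℤ) :
    Submodule ℝ D.Amb :=
  Submodule.span ℝ {f | ∃ c ∈ coef, ∃ L : List (Σ j : Idx D.ι, DualSec (D.bdl j)),
    (∀ s ∈ L, s.1 ∈ lab) ∧ (L.map (fun s => (D.wt s.1 : ℤ))).sum = d ∧
    f = fun p => c p • (L.map (fun s => GSym.gen D.wt s.1 (s.2.val p.1))).prod}

/-- The degree `d` part of `C^∞(ℰ) = Γ(S(ℰ*))`. Sections of the pulled-back bundles over `NS` are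
combinations, with coefficients in `C^∞(NS)`, of sections over `S`, so the span of products is
the space of all smooth sections of degree `d`. -/
def smoothFun (D : GradedMfd.{u, v} m S) (d : ℤ) : Submodule ℝ D.Amb :=
  D.funSpan {c | D.N.IsSmoothFun c} Set.univ d

/-- The degree `d` part of `C^∞(ℰ_{k₀})`, regarded as functions on `ℰ` by pull-back along
`ℰ → ℰ_{k₀}`. -/
def smoothFun₀ (D : GradedMfd.{u, v} m S) (d : ℤ) : Submodule ℝ D.Amb :=
  D.funSpan {c | D.N.IsSmoothFun c} {.A, .B} d

/-- The degree `d` functions on `ℰ_{k₀}` that are polynomial along `p^!NS`: the coefficients are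
sums of functions `g(x) ℓ₁(y) ⋯ ℓᵣ(y)`, with `g` smooth on `S` and the `ℓᵢ` sections of `(NS)*`. -/
def polyFun₀ (D : GradedMfd.{u, v} m S) (d : ℤ) : Submodule ℝ D.Amb :=
  D.funSpan {c | ∃ g : S → ℝ, ContMDiff (𝓡 m) 𝓘(ℝ, ℝ) ∞ g ∧ ∃ M : List (DualSec D.N),
    c = fun p => g p.1 * (M.map (fun l => l.val p.1 p.2)).prod} {.A, .B} d

/-- A list of homogeneous smooth functions on `ℰ`. -/
def SmoothList (D : GradedMfd.{u, v} m S) (L : List D.GFun) : Prop :=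
  ∀ f ∈ L, f.2 ∈ D.smoothFun f.1

/-- The sum of the shifted degrees `‖f‖ = |f| - 1`. -/
def shSum (D : GradedMfd.{u, v} m S) (L : List D.GFun) : ℤ := (L.map (fun f => f.1 - 1)).sum

/-! ## Multi-vector fields and the Schouten-Nijenhuis bracket -/

/-- Operations on lists of sections. A multi-vector field `Z`, with components of any multiplicity,
is identified with the operation `Z(f₁, …, f_l) = [⋯[[Z, f₁], f₂], ⋯, f_l]`
on functions, which on lists of length `l` depends on the component of multiplicity `l` only. -/
abbrev Op (D : GradedMfd.{u, v} m S) : Type (max u v) := List D.GFun → D.Amb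

end GradedMfd

/-- Multi-vector fields on `ℰ` of shifted total degree `‖Z‖ = d`: multiderivations of `C^∞(ℰ)` that
are graded symmetric for the shifted degrees `‖f‖ = |f| - 1`. Only the values on lists of
homogeneous smooth functions matter. -/
structure MultiVF (D : GradedMfd.{u, v} m S) (d : ℤ) where
  /-- the underlying operation -/
  op : D.Op
  mem : ∀ L, D.SmoothList L → op L ∈ D.smoothFun (d + 1 + D.shSum L)
  add : ∀ L, D.SmoothList L → ∀ e, ∀ f ∈ D.smoothFun e, ∀ g ∈ D.smoothFun e,
    op ((e, f + g) :: L) = op ((e, f) :: L) + op ((e, g) :: L)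
  smul : ∀ L, D.SmoothList L → ∀ e, ∀ f ∈ D.smoothFun e, ∀ c : ℝ,
    op ((e, c • f) :: L) = c • op ((e, f) :: L)
  symm : ∀ L₁ L₂ f g, D.SmoothList (L₁ ++ f :: g :: L₂) →
    op (L₁ ++ f :: g :: L₂) = sgn ((f.1 - 1) * (g.1 - 1)) • op (L₁ ++ g :: f :: L₂)
  leibniz : ∀ L, D.SmoothList L → ∀ e e', ∀ f ∈ D.smoothFun e, ∀ g ∈ D.smoothFun e',
    op (L ++ [(e + e', f * g)]) =
      op (L ++ [(e, f)]) * g + sgn ((d + D.shSum L) * e) • (f * op (L ++ [(e', g)]))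
  bounded : ∃ n, ∀ L, D.SmoothList L → n < L.length → op L = 0

/-- The Schouten-Nijenhuis bracket `[Z, W]` of multi-vector fields with `‖Z‖ = d` and `‖W‖ = e`.
Its component of multiplicity `0` is `Z₁(W₀) - (-1)^(d e) W₁(Z₀)`, and the components of positive
multiplicity are determined by the Jacobi identity
`[[Z, W], f] = [Z, [W, f]] + (-1)^(e ‖f‖) [[Z, f], W]`. -/
def snAux (D : GradedMfd.{u, v} m S) : List D.GFun → ℤ → ℤ → D.Op → D.Op → D.Amb
  | [], d, e, Z, W => Z [(e + 1, W [])] - sgn (d * e) • W [(d + 1, Z [])]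
  | f :: L, d, e, Z, W =>
      snAux D L d (e + (f.1 - 1)) Z (fun L' => W (f :: L')) +
        sgn (e * (f.1 - 1)) • snAux D L (d + (f.1 - 1)) e (fun L' => Z (f :: L')) W

/-- The Schouten-Nijenhuis bracket of multi-vector fields of shifted degrees `d` and `e`. -/
def sn (D : GradedMfd.{u, v} m S) (d e : ℤ) (Z W : D.Op) : D.Op := fun L => snAux D L d e Z W

/-- A blended homological vector field `Q = Q⁺ + Q⁻`. -/
structure BlendedHVF (D : GradedMfd.{u, v} m S) where
  /-- the component of shifted degree `1` -/
  pos : MultiVF D 1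
  /-- the component of shifted degree `-1` -/
  neg : MultiVF D (-1)
  pos_pos : ∀ L, D.SmoothList L → sn D 1 1 pos.op pos.op L = 0
  neg_neg : ∀ L, D.SmoothList L → sn D (-1) (-1) neg.op neg.op L = 0
  pos_neg : ∀ L, D.SmoothList L → sn D 1 (-1) pos.op neg.op L = 0

/-- The operation of `Q = Q⁺ + Q⁻`. -/
def BlendedHVF.op {D : GradedMfd.{u, v} m S} (Q : BlendedHVF D) : D.Op :=
  fun L => Q.pos.op L + Q.neg.op L

namespace GradedMfd

/-! ## Restrictions -/

/-- The inclusion of the dual of the fibre of a bundle into `S(ℰ*)_x`. -/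
def genE (D : GradedMfd.{u, v} m S) (x : S) (j : Idx D.ι) :
    Module.Dual ℝ ((D.bdl j).Fib x) →ₗ[ℝ] D.Sym x :=
  GSym.genL (W := fun j => Module.Dual ℝ ((D.bdl j).Fib x)) D.wt j

/-- The inclusion of `K*` into `S(K*)`. -/
def gen1 (k : ℕ) (K : Type v) [AddCommGroup K] [Module ℝ K] : Module.Dual ℝ K →ₗ[ℝ] Sym1 k K :=
  GSym.genL (W := fun _ : Unit => Module.Dual ℝ K) (fun _ : Unit => k) ()

theorem genE_comm (D : GradedMfd.{u, v} m S) (x : S) (i j : Idx D.ι)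
    (a : Module.Dual ℝ ((D.bdl i).Fib x)) (b : Module.Dual ℝ ((D.bdl j).Fib x)) :
    D.genE x i a * D.genE x j b =
      ((-1 : ℝ) ^ (D.wt i * D.wt j)) • (D.genE x j b * D.genE x i a) :=
  GSym.gen_comm (W := fun j => Module.Dual ℝ ((D.bdl j).Fib x)) D.wt i j a b

theorem gen1_comm (k : ℕ) (K : Type v) [AddCommGroup K] [Module ℝ K] (a b : Module.Dual ℝ K) :
    gen1 k K a * gen1 k K b = ((-1 : ℝ) ^ (k * k)) • (gen1 k K b * gen1 k K a) :=
  GSym.gen_comm (W := fun _ : Unit => Module.Dual ℝ K) (fun _ : Unit => k) () () a b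

/-- The restriction of functions to `ℰ_{k₀}` at a point: the coordinates of all other degrees are
set to zero. (The result is again regarded as a function on `ℰ`.) -/
def toE₀ (D : GradedMfd.{u, v} m S) (x : S) : D.Sym x →ₐ[ℝ] D.Sym x :=
  GSym.lift D.wt (fun j => match j with
    | .A => D.genE x .A
    | .B => D.genE x .B
    | .C _ => 0) (by
    intro i j v w
    cases i <;> cases j <;> simp <;> exact D.genE_comm x _ _ v w)

/-- The restriction, at a point over `x`, of functions on `ℰ` to a linear subspace `K` of the fibre
`𝒜_x ⊕ ℬ_x` of `ℰ_{k₀}`. -/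
def toSub (D : GradedMfd.{u, v} m S) (x : S) (K : Submodule ℝ (D.A.Fib x × D.B.Fib x)) :
    D.Sym x →ₐ[ℝ] Sym1 D.k K :=
  GSym.lift D.wt (fun j => match j with
    | .A => (gen1 D.k K).comp
        (Module.Dual.transpose (R := ℝ) ((LinearMap.fst ℝ _ _).comp K.subtype))
    | .B => (gen1 D.k K).comp
        (Module.Dual.transpose (R := ℝ) ((LinearMap.snd ℝ _ _).comp K.subtype))
    | .C _ => 0) (by
    intro i j v w
    cases i <;> cases j <;> simp <;> exact gen1_comm D.k K _ _)

/-- The restriction, at a point of `S`, of functions on `ℰ` to `𝒜`. -/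
def toA (D : GradedMfd.{u, v} m S) (x : S) : D.Sym x →ₐ[ℝ] D.SymA x :=
  GSym.lift D.wt (fun j => match j with
    | .A => gen1 D.k (D.A.Fib x)
    | .B => 0
    | .C _ => 0) (by
    intro i j v w
    cases i <;> cases j <;> simp <;> exact gen1_comm D.k (D.A.Fib x) v w)

/-- The pull-back of functions along the projection `ℰ → 𝒜`, at a point. -/
def fromA (D : GradedMfd.{u, v} m S) (x : S) : D.SymA x →ₐ[ℝ] D.Sym x :=
  GSym.lift (fun _ : Unit => D.k) (fun _ => D.genE x .A) (by
    intro i j v w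
    exact D.genE_comm x .A .A v w)

/-! ## Submanifolds of coisotropic type -/

/-- A family of linear subspaces of the fibres of `ℰ_{k₀}` over a subset of `NS`. -/
structure SubFamily (D : GradedMfd.{u, v} m S) where
  /-- the base -/
  base : Set D.Base
  /-- the fibres (only those over the base matter) -/
  fib : ∀ p : D.Base, Submodule ℝ (D.A.Fib p.1 × D.B.Fib p.1)

/-- The section `f` vanishes on the graded submanifold `K`. -/
def SubFamily.Vanishes {D : GradedMfd.{u, v} m S} (K : D.SubFamily) (f : D.Amb) : Prop :=
  ∀ p ∈ K.base, D.toSub p.1 (K.fib p) (f p) = 0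

/-- `K` is of coisotropic type: `Q|_{ℰ_{k₀}}(N^⊥ K) = 0`. The conormal bundle `N^⊥ K` of `K` in
`ℰ_{k₀}` is generated by the differentials of the functions on `ℰ_{k₀}` that vanish on `K`. -/
def SubFamily.IsCoisotropicType {D : GradedMfd.{u, v} m S} (K : D.SubFamily) (Q : BlendedHVF D) :
    Prop :=
  ∀ L : List D.GFun, (∀ f ∈ L, f.2 ∈ D.smoothFun₀ f.1 ∧ K.Vanishes f.2) → K.Vanishes (Q.op L)

/-- The deformed subbundle `𝒜_{σ,φ}`: the graph of `φ` over the graph of `σ`. -/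
def graph (D : GradedMfd.{u, v} m S) (σ : D.N.Sec) (φ : BundleHom D.A D.B) : D.SubFamily where
  base := Set.range (fun x => (⟨x, σ x⟩ : D.Base))
  fib p := (φ.val p.1).graph

/-! ## Analyticity along `p^!NS` -/

/-- `f|_{ℰ_{k₀}}` is analytic along `p^!NS`: on each fibre of `NS`, every coefficient of it is the sum
of its Maclaurin series in the linear coordinates `y` of the fibre. The term of degree `n` of
the series at `y` is `(1/n!) (d/dt)^n|_{t=0}` of the coefficient at `t y`. -/
def IsAnalyticFun (D : GradedMfd.{u, v} m S) (f : D.Amb) : Prop :=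
  ∀ (x : S) (y : D.N.Fib x) (c : D.Sym x →ₗ[ℝ] ℝ),
    HasSum (fun n : ℕ =>
        iteratedDeriv n (fun t : ℝ => c (D.toE₀ x (f ⟨x, t • y⟩))) 0 / (n.factorial : ℝ))
      (c (D.toE₀ x (f ⟨x, y⟩)))

/-- A multi-vector field is analytic along `p^!NS` if its restriction to `ℰ_{k₀}` takes functions
that are polynomial along `p^!NS` to functions that are analytic along `p^!NS`. -/
def IsAnalytic (D : GradedMfd.{u, v} m S) (Z : D.Op) : Prop :=
  ∀ L : List D.GFun, (∀ f ∈ L, f.2 ∈ D.polyFun₀ f.1) → D.IsAnalyticFun (Z L)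

/-! ## The space `𝔞` and the maps `P` and `I` -/

/-- Sections of `(NS)*` and of `ℬ*`. -/
abbrev Lin (D : GradedMfd.{u, v} m S) : Type (max u v) := DualSec D.N ⊕ DualSec D.B

/-- The degree of a section of `(NS)*` or `ℬ*` as a function on `ℰ`. -/
def linDeg (D : GradedMfd.{u, v} m S) : D.Lin → ℤ
  | .inl _ => 0
  | .inr _ => D.k

/-- A section of `(NS)*` or `ℬ*`, viewed as a function on `ℰ` that is linear on the fibres. -/
def linFun (D : GradedMfd.{u, v} m S) : D.Lin → D.GFun
  | .inl l => (0, fun p => algebraMap ℝ _ (l.val p.1 p.2))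
  | .inr β => ((D.k : ℤ), fun p => GSym.gen D.wt Idx.B (β.val p.1))

/-- The degree `d` part of `C^∞(𝒜) = Γ(S(𝒜*))`, as a space of families of elements of `S(𝒜_x*)`. -/
def smoothFunA (D : GradedMfd.{u, v} m S) (d : ℤ) : Submodule ℝ (∀ x : S, D.SymA x) :=
  Submodule.span ℝ {f | ∃ g : S → ℝ, ContMDiff (𝓡 m) 𝓘(ℝ, ℝ) ∞ g ∧ ∃ L : List (DualSec D.A),
    (L.length : ℤ) * D.k = d ∧
    f = fun x => g x • (L.map (fun s => GSym.gen (fun _ : Unit => D.k) () (s.val x))).prod}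

/-- Operations on lists of sections of `(NS)*` and `ℬ*` with values in sections of `S(𝒜*)`. -/
abbrev MOp (D : GradedMfd.{u, v} m S) : Type (max u v) := List D.Lin → ∀ x : S, D.SymA x

end GradedMfd

/-- The degree `d` part of `𝔞 = Γ(S(p^!NS[-1] ⊕ p^!ℬ[-1])[1])`: multi-sections, given as
`C^∞(S)`-multilinear operations on sections of `(NS)*` and `ℬ*` with values in `C^∞(𝒜)`, graded
symmetric for the shifted degrees. The component of multiplicity `l` is the one that acts on lists
of length `l`. -/
structure MultiSec (D : GradedMfd.{u, v} m S) (d : ℤ) where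
  /-- the underlying operation -/
  op : D.MOp
  mem : ∀ L : List D.Lin, op L ∈ D.smoothFunA (d + 1 + (L.map (fun l => D.linDeg l - 1)).sum)
  add_inl : ∀ L (l l' l'' : DualSec D.N), (∀ x, l''.val x = l.val x + l'.val x) →
    op (.inl l'' :: L) = op (.inl l :: L) + op (.inl l' :: L)
  add_inr : ∀ L (l l' l'' : DualSec D.B), (∀ x, l''.val x = l.val x + l'.val x) →
    op (.inr l'' :: L) = op (.inr l :: L) + op (.inr l' :: L)
  smul_inl : ∀ L (g : S → ℝ) (l l' : DualSec D.N), (∀ x, l'.val x = g x • l.val x) →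
    op (.inl l' :: L) = fun x => g x • op (.inl l :: L) x
  smul_inr : ∀ L (g : S → ℝ) (l l' : DualSec D.B), (∀ x, l'.val x = g x • l.val x) →
    op (.inr l' :: L) = fun x => g x • op (.inr l :: L) x
  symm : ∀ L₁ L₂ (l l' : D.Lin), op (L₁ ++ l :: l' :: L₂) =
    sgn ((D.linDeg l - 1) * (D.linDeg l' - 1)) • op (L₁ ++ l' :: l :: L₂)
  bounded : ∃ n, ∀ L : List D.Lin, n < L.length → op L = 0

instance instNegMultiSec (D : GradedMfd.{u, v} m S) (d : ℤ) : Neg (MultiSec D d) where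
  neg a :=
    { op := fun L => -a.op L
      mem := fun L => (D.smoothFunA _).neg_mem (a.mem L)
      add_inl := fun L l l' l'' h => by rw [a.add_inl L l l' l'' h, neg_add]
      add_inr := fun L l l' l'' h => by rw [a.add_inr L l l' l'' h, neg_add]
      smul_inl := fun L g l l' h => by rw [a.smul_inl L g l l' h]; funext x; simp
      smul_inr := fun L g l l' h => by rw [a.smul_inr L g l l' h]; funext x; simp
      symm := fun L₁ L₂ l l' => by rw [a.symm L₁ L₂ l l', smul_neg]
      bounded := by
        obtain ⟨n, hn⟩ := a.bounded
        exact ⟨n, fun L hL => by rw [hn L hL, neg_zero]⟩ }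

namespace GradedMfd

/-- The operation of the element `(σ, φ)` of `𝔞'₀ = Γ(NS) ⊕ Γ(𝒜* ⊗ ℬ)`. -/
def deformOp (D : GradedMfd.{u, v} m S) (σ : D.N.Sec) (φ : BundleHom D.A D.B) : D.MOp
  | [.inl l] => fun x => algebraMap ℝ _ (l.val x (σ x))
  | [.inr β] => fun x => GSym.gen (fun _ : Unit => D.k) () ((φ.pull β).val x)
  | _ => 0

/-- The element `(σ, φ)` of `𝔞'₀ = Γ(NS) ⊕ Γ(𝒜* ⊗ ℬ)` as an element of `𝔞₀`. -/
def deform (D : GradedMfd.{u, v} m S) (σ : D.N.Sec) (φ : BundleHom D.A D.B) : MultiSec D 0 where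
  op := D.deformOp σ φ
  mem L := by
    rcases L with _ | ⟨l | β, _ | ⟨l', L⟩⟩
    · exact zero_mem _
    · refine Submodule.subset_span ⟨fun x => l.val x (σ x), ?_, [], ?_, ?_⟩
      · have h := l.smooth
        unfold SmoothVB.IsSmoothFun at h
        exact h.comp σ.contMDiff
      · simp [linDeg]
      · funext x
        simp [deformOp, Algebra.algebraMap_eq_smul_one]
    · exact zero_mem _
    · refine Submodule.subset_span ⟨fun _ => 1, contMDiff_const, [φ.pull β], ?_, ?_⟩
      · simp [linDeg]
      · funext x
        simp [deformOp]
    · exact zero_mem _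
  add_inl L l l' l'' h := by
    rcases L with _ | ⟨l₀, L⟩
    · funext x; simp [deformOp, h]
    · simp [deformOp]
  add_inr L l l' l'' h := by
    rcases L with _ | ⟨l₀, L⟩
    · funext x; simp [deformOp, BundleHom.pull, h, LinearMap.add_comp, GSym.gen_add]
    · simp [deformOp]
  smul_inl L g l l' h := by
    rcases L with _ | ⟨l₀, L⟩
    · funext x; simp [deformOp, h, Algebra.smul_def]
    · funext x; simp [deformOp]
  smul_inr L g l l' h := by
    rcases L with _ | ⟨l₀, L⟩
    · funext x; simp [deformOp, BundleHom.pull, h, LinearMap.smul_comp, GSym.gen_smul]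
    · funext x; simp [deformOp]
  symm L₁ L₂ l l' := by
    rcases L₁ with _ | ⟨l₁, _ | ⟨l₂, L₁⟩⟩ <;> simp [deformOp]
  bounded := ⟨1, fun L hL => by
    rcases L with _ | ⟨l₁, _ | ⟨l₂, L⟩⟩
    · simp at hL
    · simp at hL
    · simp [deformOp]⟩

/-- The projection `P : 𝔛(ℰ) → 𝔞`: evaluate on fibrewise linear functions `y` and `η` (this discards
the directions `∂/∂x`, `∂/∂ξ`, `∂/∂γ`) and restrict to `𝒜`, i.e. to `y = 0`, `η = 0`, `γ = 0`. -/
def P (D : GradedMfd.{u, v} m S) (Z : D.Op) : D.MOp :=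
  fun L x => D.toA x (Z (L.map D.linFun) ⟨x, 0⟩)

/-- The derivative at `(x, y)` of a section along the vertical vector `n ∈ N_x`, computed
coefficientwise. -/
def vertDeriv (D : GradedMfd.{u, v} m S) (f : D.Amb) (x : S) (y n : D.N.Fib x) : D.Sym x :=
  Classical.epsilon (fun s : D.Sym x => ∀ c : D.Sym x →ₗ[ℝ] ℝ,
    HasDerivAt (fun t : ℝ => c (f ⟨x, y + t • n⟩)) (c s) 0)

/-- The left derivation `∂/∂η` of `S(ℰ*)_x` in the direction `e ∈ ℬ_x`. -/
def etaDeriv (D : GradedMfd.{u, v} m S) (x : S) (e : D.B.Fib x) : D.Sym x → D.Sym x :=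
  GSym.leftDeriv D.wt D.k (fun j => match j with
    | .A => 0
    | .B => Module.Dual.eval ℝ (D.B.Fib x) e
    | .C _ => 0) (by
    intro j hj
    cases j with
    | A => rfl
    | B => rfl
    | C i => exact absurd rfl hj)

/-- Labels of a basis of `N_x ⊕ ℬ_x`. -/
abbrev Frame (D : GradedMfd.{u, v} m S) (x : S) : Type :=
  Fin (Module.finrank ℝ (D.N.Fib x)) ⊕ Fin (Module.finrank ℝ (D.B.Fib x))

/-- Global sections of `(NS)*` and `ℬ*` that restrict to the dual basis at `x`. -/
def coframe (D : GradedMfd.{u, v} m S) (x : S) : D.Frame x → D.Lin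
  | .inl r => .inl (DualSec.through D.N x ((Module.finBasis ℝ (D.N.Fib x)).coord r))
  | .inr r => .inr (DualSec.through D.B x ((Module.finBasis ℝ (D.B.Fib x)).coord r))

/-- The partial derivatives `∂f/∂y^j` and `∂f/∂η^q` at `(x, y)`, with respect to the basis. -/
def partialDeriv (D : GradedMfd.{u, v} m S) (x : S) (y : D.N.Fib x) (f : D.Amb) :
    D.Frame x → D.Sym x
  | .inl r => D.vertDeriv f x y (Module.finBasis ℝ (D.N.Fib x) r)
  | .inr r => D.etaDeriv x (Module.finBasis ℝ (D.B.Fib x) r) (f ⟨x, y⟩)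

/-- The value at `(x, y)` of the multi-vector field with coefficients `c`, by the chain rule
`[Z, f] = ∑ j, [Z, z^j] ∂f/∂z^j` with `z^j` running over the coordinates `y`, `η`. The sign comes from
`[⋯[Y ∂f/∂z^j, f₂], ⋯, f_l] = ± [⋯[Y, f₂], ⋯, f_l] ∂f/∂z^j`. -/
def injAux (D : GradedMfd.{u, v} m S) (x : S) (y : D.N.Fib x) :
    List D.GFun → (List D.Lin → D.SymA x) → D.Sym x
  | [], c => D.fromA x (c [])
  | f :: L, c => ∑ j : D.Frame x,
      sgn ((f.1 - D.linDeg (D.coframe x j)) * D.shSum L) •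
        (injAux D x y L (fun L' => c (D.coframe x j :: L')) * D.partialDeriv x y f.2 j)

/-- The injection `I : 𝔞 → 𝔛(ℰ)`, i.e. `F(x, ξ) ↦ F(x, ξ)`, `σ ↦ σ^j ∂/∂y^j`, `w_q ↦ ∂/∂η^q`. -/
def inj {D : GradedMfd.{u, v} m S} {d : ℤ} (a : MultiSec D d) : D.Op :=
  fun L p => injAux D p.1 p.2 L (fun L' => a.op L' p.1)

/-! ## The blended `L_∞`-algebra `𝔞_Q^P` -/

/-- The iterated bracket `[⋯[[Z, I(a₁)], I(a₂)], ⋯, I(a_k)]` for `‖Z‖ = d`. -/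
def iterBracket (D : GradedMfd.{u, v} m S) : ℤ → D.Op → List (Σ e : ℤ, MultiSec D e) → D.Op
  | _, Z, [] => Z
  | d, Z, a :: l => iterBracket D (d + a.1) (sn D d a.1 Z (inj a.2)) l

end GradedMfd

/-- The structure map `P[⋯[[Q⁺, I(a₁)], I(a₂)], ⋯, I(a_k)]` of degree `1` of `𝔞_Q^P`. -/
def BlendedHVF.mPos {D : GradedMfd.{u, v} m S} (Q : BlendedHVF D)
    (l : List (Σ e : ℤ, MultiSec D e)) : D.MOp :=
  D.P (D.iterBracket 1 Q.pos.op l)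

/-- The structure map `P[⋯[[Q⁻, I(a₁)], I(a₂)], ⋯, I(a_k)]` of degree `-1` of `𝔞_Q^P`. -/
def BlendedHVF.mNeg {D : GradedMfd.{u, v} m S} (Q : BlendedHVF D)
    (l : List (Σ e : ℤ, MultiSec D e)) : D.MOp :=
  D.P (D.iterBracket (-1) Q.neg.op l)

/-- `a ∈ 𝔞₀` is a Maurer-Cartan element of `𝔞_Q^P`: the series
`∑ k, (1/k!) (m_k + n_k)(a, …, a)` converges to `0`, coefficient by coefficient at each point of
`S`. -/
def BlendedHVF.IsMaurerCartan {D : GradedMfd.{u, v} m S} (Q : BlendedHVF D) (a : MultiSec D 0) :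
    Prop :=
  ∀ (L : List D.Lin) (x : S) (c : D.SymA x →ₗ[ℝ] ℝ),
    HasSum (fun k : ℕ => c (Q.mPos (List.replicate k ⟨0, a⟩) L x +
      Q.mNeg (List.replicate k ⟨0, a⟩) L x) / (k.factorial : ℝ)) 0

end Graded

end BlendedQ

end

/-! Write `X = σ^j ∂/∂y^j + φ^q ∂/∂η^q`. This is the vector field `I(σ, φ)`; its shifted degree is
`0`, and its flow at time `t` carries `𝒜` to the graph of `t(σ, φ)`. Bracketing with `I(-(σ, φ)) =
-X` is the Lie derivative along `X`, so the Maurer-Cartan series is formally `P(exp(L_X) Q)`: it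
pulls `Q` back along the time-one flow and then restricts to `𝒜`, which amounts to restricting `Q`
to `𝒜_{σ,φ}`. On the linear coordinates the flow is a translation, so the sum of the series is the
restriction to `𝒜_{σ,φ}` of the values of `Q` on the functions `y - σ` and `η - φ*η`.

To make this rigorous, restrict the value of `Q` on the coordinates `y - tσ`, `η - tφ*η` to the
graph of `t(σ, φ)`. This is a curve in `t` whose `k`-th derivative is given by the `k`-fold bracket
(`hasDerivAt_rest_shift`, `snAux_inj_neg_deform`). Analyticity of `Q` makes every coefficient of the
curve the sum of an everywhere convergent power series (`isEntire_rest_shift`). The Maurer-Cartan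
series is its Taylor series at `0`, evaluated at `t = 1` (`hasSum_maurerCartan`).

Hence `-(σ, φ)` is Maurer-Cartan if and only if all values of `Q` on the coordinates `y - σ`, `η -
φ*η` vanish on `𝒜_{σ,φ}`. These coordinates vanish there, so coisotropic type implies this
condition. Conversely, in each argument `Q` followed by restriction to the graph is a graded
derivation. If it kills these coordinates it factors through the retraction onto the graph, by
Hadamard's lemma for the coefficients and the Leibniz rule for products
(`IsGraphDerivation.retract_eq`), and so it kills every function on `ℰ_{k₀}` that vanishes on the
graph. The arguments are replaced one at a time (`graphRest_op_eq_zero`). -/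

noncomputable section

universe u v

namespace BlendedQ

/-! ## The graded symmetric algebra -/

namespace GSym

variable {J : Type*} (wt : J → ℕ) {W : J → Type*}
  [∀ j, AddCommGroup (W j)] [∀ j, Module ℝ (W j)]

theorem induction {p : GSym wt W → Prop} (algebraMap : ∀ r : ℝ, p (algebraMap ℝ _ r))
    (gen : ∀ j v, p (gen wt j v)) (mul : ∀ a b, p a → p b → p (a * b))
    (add : ∀ a b, p a → p b → p (a + b)) (s : GSym wt W) : p s := by
  obtain ⟨y, rfl⟩ := RingQuot.mkAlgHom_surjective ℝ (GSym.Rel wt W) s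
  induction y using FreeAlgebra.induction with
  | grade0 r =>
    have := algebraMap r
    exact ((RingQuot.mkAlgHom ℝ (GSym.Rel wt W)).commutes r).symm ▸ this
  | grade1 x => exact gen x.1 x.2
  | mul a b ha hb => rw [map_mul]; exact mul _ _ ha hb
  | add a b ha hb => rw [map_add]; exact add _ _ ha hb

theorem algHom_ext {A : Type*} [Ring A] [Algebra ℝ A] {f g : GSym wt W →ₐ[ℝ] A}
    (h : ∀ j v, f (gen wt j v) = g (gen wt j v)) : f = g := by
  ext s
  induction s using GSym.induction wt with
  | algebraMap r => simp
  | gen j v => exact h j v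
  | mul a b ha hb => simp [ha, hb]
  | add a b ha hb => simp [ha, hb]

section leftDeriv

variable (w : ℕ) (c : ∀ j, W j →ₗ[ℝ] ℝ) (hc : ∀ j, c j ≠ 0 → wt j = w)

/-- The algebra morphism `s ↦ (τ(s), ∂(s); 0, s)` behind `leftDeriv`. -/
theorem exists_leftDeriv_matrix : ∃ T : GSym wt W →ₐ[ℝ] Matrix (Fin 2) (Fin 2) (GSym wt W),
    (∀ j v, T (gen wt j v) = dMat wt w c j v) ∧ ∀ s, leftDeriv wt w c hc s = T s 0 1 :=
  ⟨_, lift_gen wt _ _, fun _ => rfl⟩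

theorem leftDeriv_add (s t : GSym wt W) :
    leftDeriv wt w c hc (s + t) = leftDeriv wt w c hc s + leftDeriv wt w c hc t := by
  obtain ⟨T, -, hT⟩ := exists_leftDeriv_matrix wt w c hc
  simp [hT]

theorem leftDeriv_smul (r : ℝ) (s : GSym wt W) :
    leftDeriv wt w c hc (r • s) = r • leftDeriv wt w c hc s := by
  obtain ⟨T, -, hT⟩ := exists_leftDeriv_matrix wt w c hc
  simp [hT]

theorem leftDeriv_algebraMap (r : ℝ) :
    leftDeriv wt w c hc (algebraMap ℝ _ r) = 0 := by
  obtain ⟨T, -, hT⟩ := exists_leftDeriv_matrix wt w c hc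
  rw [hT, AlgHom.commutes, Matrix.algebraMap_matrix_apply]
  simp

theorem leftDeriv_gen (j : J) (v : W j) :
    leftDeriv wt w c hc (gen wt j v) = algebraMap ℝ _ (c j v) := by
  obtain ⟨T, hT', hT⟩ := exists_leftDeriv_matrix wt w c hc
  simp [hT, hT', dMat]

/-- The Leibniz rule for `ζ ∂`, where the degree of `ζ` is opposite to that of `∂`. -/
theorem mul_leftDeriv_mul (i : J) (hi : wt i = w) (z : W i) (s t : GSym wt W) :
    gen wt i z * leftDeriv wt w c hc (s * t) =
      gen wt i z * leftDeriv wt w c hc s * t + s * (gen wt i z * leftDeriv wt w c hc t) := by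
  obtain ⟨T, hT', hT⟩ := exists_leftDeriv_matrix wt w c hc
  -- The matrices are upper triangular with diagonal `(τ(s), s)`. The sign in `τ(s)` is exactly the
  -- cost of moving `z`, of degree `w`, past `s`, so multiplication by `z` removes the sign from the
  -- Leibniz rule.
  have key : ∀ s, T s 1 0 = 0 ∧ T s 1 1 = s ∧ gen wt i z * T s 0 0 = s * gen wt i z := by
    intro s
    induction s using GSym.induction wt with
    | algebraMap r =>
      rw [AlgHom.commutes]
      simp [Matrix.algebraMap_matrix_apply, Algebra.commutes]
    | gen j v =>
      simp [hT', dMat]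
      rw [gen_comm, smul_smul, hi, ← mul_pow]; simp
    | mul a b ha hb =>
      obtain ⟨ha0, ha1, ha2⟩ := ha
      obtain ⟨hb0, hb1, hb2⟩ := hb
      simp only [map_mul, Matrix.mul_apply, Fin.sum_univ_two, ha0, ha1, hb0, hb1, mul_zero,
        zero_mul, add_zero, zero_add, true_and]
      rw [← mul_assoc, ha2, mul_assoc, hb2, mul_assoc]
    | add a b ha hb =>
      simp [ha.1, ha.2.1, hb.1, hb.2.1, mul_add, add_mul, ha.2.2, hb.2.2]
  simp only [hT, map_mul, Matrix.mul_apply, Fin.sum_univ_two, (key t).2.1, mul_add]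
  rw [← mul_assoc, (key s).2.2, ← mul_assoc, add_comm, mul_assoc, mul_assoc]

end leftDeriv

end GSym

/-! ## Polynomial curves -/

section PolynomialCurve

variable {A : Type*} [Ring A] [Algebra ℝ A]

/-- The evaluation of polynomials at a real number, as an algebra morphism. -/
def evalReal (A : Type*) [Ring A] [Algebra ℝ A] (t : ℝ) : Polynomial A →ₐ[ℝ] A :=
  { Polynomial.eval₂RingHom' (RingHom.id A) (algebraMap ℝ A t)
      (fun a => (Algebra.commutes t a).symm) with
    commutes' := fun r => by
      change Polynomial.eval₂ (RingHom.id A) (algebraMap ℝ A t) (algebraMap ℝ (Polynomial A) r) = _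
      rw [Polynomial.algebraMap_apply, Polynomial.eval₂_C, RingHom.id_apply] }

theorem evalReal_C (t : ℝ) (a : A) : evalReal A t (Polynomial.C a) = a :=
  Polynomial.eval₂_C _ _

theorem evalReal_X (t : ℝ) : evalReal A t Polynomial.X = algebraMap ℝ A t :=
  Polynomial.eval₂_X _ _

theorem evalReal_eq_sum (t : ℝ) (p : Polynomial A) {n : ℕ} (hn : p.natDegree < n) :
    evalReal A t p = ∑ i ∈ Finset.range n, t ^ i • p.coeff i := by
  have : evalReal A t p = Polynomial.eval₂ (RingHom.id A) (algebraMap ℝ A t) p := rfl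
  rw [this, Polynomial.eval₂_eq_sum_range' _ hn]
  refine Finset.sum_congr rfl fun i _ => ?_
  rw [← map_pow, ← Algebra.commutes, ← Algebra.smul_def, RingHom.id_apply]

/-- The algebra carries no topology, so derivatives of curves in it are tested on linear
functionals; polynomial curves are then differentiated formally. -/
theorem hasDerivAt_evalReal (c : A →ₗ[ℝ] ℝ) (p : Polynomial A) (t : ℝ) :
    HasDerivAt (fun t => c (evalReal A t p)) (c (evalReal A t (Polynomial.derivative p))) t := by
  induction p using Polynomial.induction_on' with
  | add p q hp hq =>
    simp only [map_add]
    exact hp.add hq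
  | monomial n a =>
    have h : ∀ (t : ℝ) (n : ℕ) (a : A), evalReal A t (Polynomial.monomial n a) = t ^ n • a := by
      intro t n a
      rw [← Polynomial.C_mul_X_pow_eq_monomial, map_mul, map_pow, evalReal_C, evalReal_X,
        ← map_pow, ← Algebra.commutes, ← Algebra.smul_def]
    simp only [Polynomial.derivative_monomial, h, map_smul, smul_eq_mul]
    have := (hasDerivAt_pow n t).mul_const (c a)
    have e : t ^ (n - 1) * c (a * (n : A)) = (n : ℝ) * t ^ (n - 1) * c a := by
      rw [← nsmul_eq_mul', map_nsmul, nsmul_eq_mul]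
      ring
    rw [e]
    exact this

end PolynomialCurve

/-! ## Restriction to the graphs of the multiples of `φ` -/

section Graded

variable {m : ℕ} {S : Type u} [TopologicalSpace S] [ChartedSpace (EuclideanSpace ℝ (Fin m)) S]

namespace GradedMfd

variable (D : GradedMfd.{u, v} m S) (x : S)

/-- The linear coordinates on `𝒜`. -/
def xi : Module.Dual ℝ (D.A.Fib x) →ₗ[ℝ] D.Sym x := D.genE x .A

/-- The linear coordinates on `ℬ`. -/
def eta : Module.Dual ℝ (D.B.Fib x) →ₗ[ℝ] D.Sym x := D.genE x .B

/-- The linear coordinates on `C i`. -/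
def gam (i : D.ι) : Module.Dual ℝ ((D.C i).Fib x) →ₗ[ℝ] D.Sym x := D.genE x (.C i)

theorem sym_induction {p : D.Sym x → Prop} (algebraMap : ∀ r : ℝ, p (algebraMap ℝ _ r))
    (xi : ∀ α, p (D.xi x α)) (eta : ∀ β, p (D.eta x β)) (gam : ∀ i γ, p (D.gam x i γ))
    (mul : ∀ a b, p a → p b → p (a * b))
    (add : ∀ a b, p a → p b → p (a + b)) (s : D.Sym x) : p s :=
  GSym.induction D.wt algebraMap (fun j v => match j with
    | .A => xi v
    | .B => eta v
    | .C i => gam i v) mul add s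

variable {D x} in
theorem sym_ext {A : Type*} [Ring A] [Algebra ℝ A] {f g : D.Sym x →ₐ[ℝ] A}
    (hA : ∀ α, f (D.xi x α) = g (D.xi x α)) (hB : ∀ β, f (D.eta x β) = g (D.eta x β))
    (hC : ∀ i γ, f (D.gam x i γ) = g (D.gam x i γ)) : f = g :=
  GSym.algHom_ext _ fun j v => match j with
    | .A => hA v
    | .B => hB v
    | .C i => hC i v

theorem toA_xi (α : Module.Dual ℝ (D.A.Fib x)) : D.toA x (D.xi x α) = gen1 D.k _ α :=
  GSym.lift_gen _ _ _ _ _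

theorem toA_eta (β : Module.Dual ℝ (D.B.Fib x)) : D.toA x (D.eta x β) = 0 :=
  GSym.lift_gen _ _ _ _ _

theorem toA_gam (i : D.ι) (γ : Module.Dual ℝ ((D.C i).Fib x)) : D.toA x (D.gam x i γ) = 0 :=
  GSym.lift_gen _ _ _ _ _

theorem toE₀_xi (α : Module.Dual ℝ (D.A.Fib x)) : D.toE₀ x (D.xi x α) = D.xi x α :=
  GSym.lift_gen _ _ _ _ _

theorem toE₀_eta (β : Module.Dual ℝ (D.B.Fib x)) : D.toE₀ x (D.eta x β) = D.eta x β :=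
  GSym.lift_gen _ _ _ _ _

theorem toE₀_gam (i : D.ι) (γ : Module.Dual ℝ ((D.C i).Fib x)) : D.toE₀ x (D.gam x i γ) = 0 :=
  GSym.lift_gen _ _ _ _ _

theorem fromA_gen1 (α : Module.Dual ℝ (D.A.Fib x)) : D.fromA x (gen1 D.k _ α) = D.xi x α :=
  GSym.lift_gen _ _ _ _ _

theorem toSub_xi (K : Submodule ℝ (D.A.Fib x × D.B.Fib x)) (α : Module.Dual ℝ (D.A.Fib x)) :
    D.toSub x K (D.xi x α) = gen1 D.k K (α.comp ((LinearMap.fst ℝ _ _).comp K.subtype)) :=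
  GSym.lift_gen _ _ _ _ _

theorem toSub_eta (K : Submodule ℝ (D.A.Fib x × D.B.Fib x)) (β : Module.Dual ℝ (D.B.Fib x)) :
    D.toSub x K (D.eta x β) = gen1 D.k K (β.comp ((LinearMap.snd ℝ _ _).comp K.subtype)) :=
  GSym.lift_gen _ _ _ _ _

theorem toSub_gam (K : Submodule ℝ (D.A.Fib x × D.B.Fib x)) (i : D.ι)
    (γ : Module.Dual ℝ ((D.C i).Fib x)) : D.toSub x K (D.gam x i γ) = 0 :=
  GSym.lift_gen _ _ _ _ _

theorem etaDeriv_add (e : D.B.Fib x) (s t : D.Sym x) :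
    D.etaDeriv x e (s + t) = D.etaDeriv x e s + D.etaDeriv x e t :=
  GSym.leftDeriv_add _ _ _ _ _ _

theorem etaDeriv_smul (e : D.B.Fib x) (r : ℝ) (s : D.Sym x) :
    D.etaDeriv x e (r • s) = r • D.etaDeriv x e s :=
  GSym.leftDeriv_smul _ _ _ _ _ _

theorem etaDeriv_algebraMap (e : D.B.Fib x) (r : ℝ) :
    D.etaDeriv x e (algebraMap ℝ _ r) = 0 :=
  GSym.leftDeriv_algebraMap _ _ _ _ _

theorem etaDeriv_xi (e : D.B.Fib x) (α : Module.Dual ℝ (D.A.Fib x)) :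
    D.etaDeriv x e (D.xi x α) = 0 :=
  (GSym.leftDeriv_gen _ _ _ _ _ _).trans (map_zero _)

theorem etaDeriv_gam (e : D.B.Fib x) (i : D.ι) (γ : Module.Dual ℝ ((D.C i).Fib x)) :
    D.etaDeriv x e (D.gam x i γ) = 0 :=
  (GSym.leftDeriv_gen _ _ _ _ _ _).trans (map_zero _)

theorem etaDeriv_eta (e : D.B.Fib x) (β : Module.Dual ℝ (D.B.Fib x)) :
    D.etaDeriv x e (D.eta x β) = algebraMap ℝ _ (β e) :=
  GSym.leftDeriv_gen _ _ _ _ _ _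

theorem xi_mul_etaDeriv_mul (α : Module.Dual ℝ (D.A.Fib x)) (e : D.B.Fib x) (s t : D.Sym x) :
    D.xi x α * D.etaDeriv x e (s * t) =
      D.xi x α * D.etaDeriv x e s * t + s * (D.xi x α * D.etaDeriv x e t) :=
  GSym.mul_leftDeriv_mul D.wt D.k _ _ Idx.A rfl _ s t

variable (φ : D.A.Fib x →ₗ[ℝ] D.B.Fib x)

/-- The restriction to the graph of `t φ`, as a polynomial in `t`: `η ↦ t φ*η`, `γ ↦ 0`. -/
def restPoly : D.Sym x →ₐ[ℝ] Polynomial (D.SymA x) :=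
  GSym.lift D.wt (fun j => match j with
    | .A => (Polynomial.CAlgHom (R := ℝ)).toLinearMap.comp (gen1 D.k (D.A.Fib x))
    | .B => (LinearMap.mulLeft ℝ Polynomial.X).comp
        ((Polynomial.CAlgHom (R := ℝ)).toLinearMap.comp
          ((gen1 D.k (D.A.Fib x)).comp (Module.Dual.transpose (R := ℝ) φ)))
    | .C _ => 0) (by
    -- All cases reduce to the commutation rule in `S(𝒜_x*)`: the indeterminate is central even
    -- where the coefficients are not, so it can be pulled out by `hX`.
    have h : ∀ a b : Module.Dual ℝ (D.A.Fib x),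
        (Polynomial.C (gen1 D.k (D.A.Fib x) a) * Polynomial.C (gen1 D.k (D.A.Fib x) b) :
          Polynomial (D.SymA x)) = ((-1 : ℝ) ^ (D.k * D.k)) •
          (Polynomial.C (gen1 D.k (D.A.Fib x) b) * Polynomial.C (gen1 D.k (D.A.Fib x) a)) := by
      intro a b
      rw [← Polynomial.C_mul, gen1_comm, ← Polynomial.smul_C, Polynomial.C_mul]
    have hX : ∀ p q : Polynomial (D.SymA x),
        p * (Polynomial.X * q) = Polynomial.X * (p * q) := by
      intro p q
      rw [← mul_assoc, ← Polynomial.X_mul, mul_assoc]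
    intro i j v w
    cases i <;> cases j
    · exact h v w
    · have := h v (Module.Dual.transpose (R := ℝ) φ w)
      refine Eq.trans (hX _ _) ((congrArg (Polynomial.X * ·) this).trans ?_)
      exact (mul_smul_comm _ _ _).trans (congrArg _ (mul_assoc _ _ _).symm)
    · simp
    · have := h (Module.Dual.transpose (R := ℝ) φ v) w
      refine Eq.trans (mul_assoc _ _ _) ((congrArg (Polynomial.X * ·) this).trans ?_)
      exact (mul_smul_comm _ _ _).trans (congrArg _ (hX _ _).symm)
    · have := h (Module.Dual.transpose (R := ℝ) φ v) (Module.Dual.transpose (R := ℝ) φ w)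
      refine Eq.trans (mul_assoc _ _ _) (Eq.trans (congrArg (Polynomial.X * ·) (hX _ _))
        ((congrArg (fun p => Polynomial.X * (Polynomial.X * p)) this).trans ?_))
      refine (congrArg (Polynomial.X * ·) (mul_smul_comm _ _ _)).trans
        ((mul_smul_comm _ _ _).trans (congrArg _ ?_))
      exact (congrArg (Polynomial.X * ·) (hX _ _).symm).trans (mul_assoc _ _ _).symm
    all_goals simp)

theorem restPoly_xi (α : Module.Dual ℝ (D.A.Fib x)) :
    D.restPoly x φ (D.xi x α) = Polynomial.C (gen1 D.k (D.A.Fib x) α) :=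
  GSym.lift_gen _ _ _ _ _

theorem restPoly_eta (β : Module.Dual ℝ (D.B.Fib x)) :
    D.restPoly x φ (D.eta x β) =
      Polynomial.X * Polynomial.C (gen1 D.k (D.A.Fib x) (β.comp φ)) :=
  GSym.lift_gen _ _ _ _ _

theorem restPoly_gam (i : D.ι) (γ : Module.Dual ℝ ((D.C i).Fib x)) :
    D.restPoly x φ (D.gam x i γ) = 0 :=
  GSym.lift_gen _ _ _ _ _

/-- The restriction to the graph of `t φ`. -/
def rest (t : ℝ) : D.Sym x →ₐ[ℝ] D.SymA x := (evalReal (D.SymA x) t).comp (D.restPoly x φ)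

theorem rest_xi (t : ℝ) (α : Module.Dual ℝ (D.A.Fib x)) :
    D.rest x φ t (D.xi x α) = gen1 D.k (D.A.Fib x) α := by
  rw [rest, AlgHom.comp_apply, restPoly_xi, evalReal_C]

theorem rest_eta (t : ℝ) (β : Module.Dual ℝ (D.B.Fib x)) :
    D.rest x φ t (D.eta x β) = t • gen1 D.k (D.A.Fib x) (β.comp φ) := by
  rw [rest, AlgHom.comp_apply, restPoly_eta, map_mul, evalReal_C, evalReal_X, Algebra.smul_def]

theorem rest_gam (t : ℝ) (i : D.ι) (γ : Module.Dual ℝ ((D.C i).Fib x)) :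
    D.rest x φ t (D.gam x i γ) = 0 := by
  rw [rest, AlgHom.comp_apply, restPoly_gam, map_zero]

/-- The graph of `0 · φ` is `𝒜`, so at `t = 0` one recovers the restriction that enters `P`. -/
theorem rest_zero : D.rest x φ 0 = D.toA x :=
  sym_ext (fun α => by rw [rest_xi, toA_xi]) (fun β => by rw [rest_eta, toA_eta, zero_smul])
    (fun i γ => by rw [rest_gam, toA_gam])

/-- `restPoly` already sends `γ` to `0`. This lets the analyticity assumption, which only sees
restrictions to `ℰ_{k₀}`, apply to it. -/
theorem restPoly_toE₀ (s : D.Sym x) : D.restPoly x φ (D.toE₀ x s) = D.restPoly x φ s := by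
  have : (D.restPoly x φ).comp (D.toE₀ x) = D.restPoly x φ :=
    sym_ext (fun α => by rw [AlgHom.comp_apply, toE₀_xi])
      (fun β => by rw [AlgHom.comp_apply, toE₀_eta])
      (fun i γ => by rw [AlgHom.comp_apply, toE₀_gam, restPoly_gam, map_zero])
  exact DFunLike.congr_fun this s

/-- A function vanishes on the graph of `φ` if and only if its pull-back along `a ↦ (a, φ a)`
vanishes. -/
theorem toSub_graph_eq_zero_iff (s : D.Sym x) :
    D.toSub x φ.graph s = 0 ↔ D.rest x φ 1 s = 0 := by
  -- `e` is `a ↦ (a, φ a)` and `r` is the first projection. They induce `E` and `E'` on symmetric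
  -- algebras, and `e ∘ r = id` makes `E` injective, which gives the converse direction.
  let e : D.A.Fib x →ₗ[ℝ] φ.graph :=
    (LinearMap.prod LinearMap.id φ).codRestrict φ.graph (fun a => by simp)
  let r : φ.graph →ₗ[ℝ] D.A.Fib x := (LinearMap.fst ℝ _ _).comp φ.graph.subtype
  have her : ∀ z, e (r z) = z := by
    rintro ⟨⟨a, b⟩, h⟩
    have h' : b = φ a := h
    subst h'
    rfl
  let E : Sym1 D.k φ.graph →ₐ[ℝ] D.SymA x := GSym.lift (fun _ : Unit => D.k)
    (fun _ => (gen1 D.k (D.A.Fib x)).comp (Module.Dual.transpose (R := ℝ) e))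
    (fun _ _ v w => gen1_comm D.k _ _ _)
  let E' : D.SymA x →ₐ[ℝ] Sym1 D.k φ.graph := GSym.lift (fun _ : Unit => D.k)
    (fun _ => (gen1 D.k φ.graph).comp (Module.Dual.transpose (R := ℝ) r))
    (fun _ _ v w => gen1_comm D.k _ _ _)
  have hE : ∀ α, E (gen1 D.k φ.graph α) = gen1 D.k (D.A.Fib x) (α.comp e) :=
    fun α => GSym.lift_gen _ _ _ _ _
  have hE' : ∀ α, E' (gen1 D.k (D.A.Fib x) α) = gen1 D.k φ.graph (α.comp r) :=
    fun α => GSym.lift_gen _ _ _ _ _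
  have h1 : E.comp (D.toSub x φ.graph) = D.rest x φ 1 := by
    refine sym_ext (fun α => ?_) (fun β => ?_) (fun i γ => ?_)
    · rw [rest_xi, AlgHom.comp_apply, toSub_xi, hE]
      rfl
    · rw [rest_eta, AlgHom.comp_apply, toSub_eta, hE, one_smul]
      rfl
    · rw [rest_gam, AlgHom.comp_apply, toSub_gam, map_zero]
  have h2 : E'.comp E = AlgHom.id ℝ _ := by
    refine GSym.algHom_ext _ fun j v => ?_
    change E' (E (gen1 D.k φ.graph v)) = gen1 D.k φ.graph v
    rw [hE, hE']
    congr 1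
    ext z
    exact congrArg v (her z)
  constructor
  · intro h
    rw [← h1, AlgHom.comp_apply, h, map_zero]
  · intro h
    rw [← h1, AlgHom.comp_apply] at h
    have := congrArg E' h
    rwa [map_zero, ← AlgHom.comp_apply, h2] at this

/-- The derivation `∑ q, (φ*η^q) ∂/∂η^q`. -/
def phiDeriv (s : D.Sym x) : D.Sym x :=
  ∑ r, D.xi x (((Module.finBasis ℝ (D.B.Fib x)).coord r).comp φ) *
    D.etaDeriv x (Module.finBasis ℝ (D.B.Fib x) r) s

theorem phiDeriv_add (s t : D.Sym x) :
    D.phiDeriv x φ (s + t) = D.phiDeriv x φ s + D.phiDeriv x φ t := by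
  simp only [phiDeriv, etaDeriv_add, mul_add, Finset.sum_add_distrib]

theorem phiDeriv_smul (r : ℝ) (s : D.Sym x) :
    D.phiDeriv x φ (r • s) = r • D.phiDeriv x φ s := by
  simp only [phiDeriv, etaDeriv_smul, mul_smul_comm, Finset.smul_sum]

/-- The coefficients `φ*η^q` have degree `k` and the `∂/∂η^q` have degree `-k`, so the sum has
degree zero and its Leibniz rule has no sign. -/
theorem phiDeriv_mul (s t : D.Sym x) :
    D.phiDeriv x φ (s * t) = D.phiDeriv x φ s * t + s * D.phiDeriv x φ t := by
  simp only [phiDeriv, Finset.sum_mul, Finset.mul_sum, ← Finset.sum_add_distrib,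
    xi_mul_etaDeriv_mul]

theorem phiDeriv_algebraMap (r : ℝ) : D.phiDeriv x φ (algebraMap ℝ _ r) = 0 := by
  simp [phiDeriv, etaDeriv_algebraMap]

theorem phiDeriv_xi (α : Module.Dual ℝ (D.A.Fib x)) : D.phiDeriv x φ (D.xi x α) = 0 := by
  simp [phiDeriv, etaDeriv_xi]

theorem phiDeriv_gam (i : D.ι) (γ : Module.Dual ℝ ((D.C i).Fib x)) :
    D.phiDeriv x φ (D.gam x i γ) = 0 := by
  simp [phiDeriv, etaDeriv_gam]

theorem phiDeriv_eta (β : Module.Dual ℝ (D.B.Fib x)) :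
    D.phiDeriv x φ (D.eta x β) = D.xi x (β.comp φ) := by
  simp only [phiDeriv, etaDeriv_eta, ← Algebra.commutes, ← Algebra.smul_def, ← map_smul,
    ← map_sum]
  congr 1
  ext a
  simp only [LinearMap.sum_apply, LinearMap.smul_apply, LinearMap.comp_apply, smul_eq_mul]
  conv_rhs => rw [← (Module.finBasis ℝ (D.B.Fib x)).sum_repr (φ a), map_sum]
  simp [mul_comm]

/-- The flow of `phiDeriv` moves `𝒜` to the graphs of the multiples of `φ`. Both sides are
derivations along `restPoly`, so comparing them on generators suffices; the only nonzero case is `η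
↦ t φ*η`, with derivative `φ*η`. -/
theorem derivative_restPoly (s : D.Sym x) :
    Polynomial.derivative (D.restPoly x φ s) = D.restPoly x φ (D.phiDeriv x φ s) := by
  induction s using D.sym_induction x with
  | algebraMap r =>
    rw [phiDeriv_algebraMap, AlgHom.commutes, Polynomial.algebraMap_apply]
    simp
  | xi α => rw [phiDeriv_xi, restPoly_xi]; simp
  | eta β => rw [phiDeriv_eta, restPoly_eta, restPoly_xi]; simp
  | gam i γ => rw [phiDeriv_gam, restPoly_gam]; simp
  | mul a b ha hb =>
    rw [phiDeriv_mul, map_mul, Polynomial.derivative_mul, ha, hb]; simp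
  | add a b ha hb => rw [phiDeriv_add, map_add, map_add, map_add, ha, hb]

theorem hasDerivAt_rest (c : D.SymA x →ₗ[ℝ] ℝ) (s : D.Sym x) (t : ℝ) :
    HasDerivAt (fun t => c (D.rest x φ t s)) (c (D.rest x φ t (D.phiDeriv x φ s))) t := by
  have := hasDerivAt_evalReal c (D.restPoly x φ s) t
  rwa [derivative_restPoly] at this

end GradedMfd

end Graded

/-! ## Functions that are everywhere the sum of a power series -/

/-- The function `h` is the sum of a power series that converges everywhere. -/
def IsEntire (h : ℝ → ℝ) : Prop := ∃ a : ℕ → ℝ, ∀ t, HasSum (fun n => a n * t ^ n) (h t)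

namespace IsEntire

theorem zero : IsEntire (fun _ => 0) := ⟨fun _ => 0, fun t => by simp⟩

theorem add {h h' : ℝ → ℝ} (hh : IsEntire h) (hh' : IsEntire h') :
    IsEntire (fun t => h t + h' t) := by
  obtain ⟨a, ha⟩ := hh
  obtain ⟨b, hb⟩ := hh'
  exact ⟨fun n => a n + b n, fun t => by simpa only [add_mul] using (ha t).add (hb t)⟩

theorem id_mul {h : ℝ → ℝ} (hh : IsEntire h) : IsEntire (fun t => t * h t) := by
  obtain ⟨a, ha⟩ := hh
  refine ⟨fun n => match n with | 0 => 0 | n + 1 => a n, fun t => ?_⟩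
  rw [← hasSum_nat_add_iff' 1]
  have := (ha t).mul_left t
  simp only [Finset.sum_range_one, zero_mul, sub_zero]
  refine this.congr_fun ?_
  intro n
  ring

theorem pow_mul {h : ℝ → ℝ} (hh : IsEntire h) (n : ℕ) : IsEntire (fun t => t ^ n * h t) := by
  induction n with
  | zero => simpa using hh
  | succ n ih => simpa only [pow_succ', mul_assoc] using ih.id_mul

theorem sum {ι : Type*} {s : Finset ι} {h : ι → ℝ → ℝ} (hh : ∀ i ∈ s, IsEntire (h i)) :
    IsEntire (fun t => ∑ i ∈ s, h i t) := by
  classical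
  induction s using Finset.induction_on with
  | empty => simpa using zero
  | insert i s hi ih =>
    simp only [Finset.sum_insert hi]
    exact (hh i (by simp)).add (ih fun j hj => hh j (by simp [hj]))

/-- Power series expansions are unique, so the unspecified coefficients in `IsEntire` must be the
Maclaurin coefficients. Until this point they need not be tracked through sums and products. -/
theorem hasSum_iteratedDeriv {h : ℝ → ℝ} (hh : IsEntire h) (t : ℝ) :
    HasSum (fun n : ℕ => iteratedDeriv n h 0 / (n.factorial : ℝ) * t ^ n) (h t) := by
  obtain ⟨a, ha⟩ := hh
  have hp : HasFPowerSeriesOnBall h (FormalMultilinearSeries.ofScalars ℝ a) 0 ⊤ := by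
    refine ⟨?_, by simp, ?_⟩
    · refine le_of_eq (Eq.symm ?_)
      -- Summable real families are absolutely summable, so convergence at every `r` gives infinite
      -- radius.
      refine FormalMultilinearSeries.radius_eq_top_of_summable_norm _ fun r => ?_
      have := (ha r).summable.norm
      refine this.congr fun n => ?_
      simp
    · intro y _
      simpa [FormalMultilinearSeries.ofScalars_apply_eq, mul_comm] using ha y
  have hc : ∀ n, iteratedDeriv n h 0 / (n.factorial : ℝ) = a n := by
    intro n
    have h1 := hp.hasFPowerSeriesAt.eq_formalMultilinearSeries
      (hp.analyticAt.hasFPowerSeriesAt)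
    have h2 := congrArg (fun p => FormalMultilinearSeries.coeff p n) h1
    simp only [FormalMultilinearSeries.coeff_ofScalars] at h2
    rw [h2]
  simpa only [hc] using ha t

/-- A function on the line whose Maclaurin series along all its rescalings converges to it is
entire. -/
theorem of_hasSum_comp_mul {h : ℝ → ℝ}
    (hh : ∀ t : ℝ, HasSum (fun n : ℕ => iteratedDeriv n (fun s : ℝ => h (s * t)) 0 /
      (n.factorial : ℝ)) (h t)) (hd : ContDiff ℝ ∞ h) : IsEntire h := by
  refine ⟨fun n => iteratedDeriv n h 0 / (n.factorial : ℝ), fun t => ?_⟩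
  refine (hh t).congr_fun fun n => ?_
  have : (fun s : ℝ => h (s * t)) = fun s => h (t * s) := by ext s; rw [mul_comm]
  rw [this, iteratedDeriv_comp_const_mul (hd.of_le (by exact_mod_cast le_top))]
  simp
  ring

end IsEntire

/-- Applied with `g n` built from the `n`-fold brackets, this turns the Maurer-Cartan terms into
Taylor coefficients. -/
theorem iteratedDeriv_eq_of_hasDerivAt {g : ℕ → ℝ → ℝ}
    (hg : ∀ n t, HasDerivAt (g n) (g (n + 1) t) t) (n : ℕ) : iteratedDeriv n (g 0) = g n := by
  induction n with
  | zero => simp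
  | succ n ih =>
    rw [iteratedDeriv_succ, ih]
    ext t
    exact (hg n t).deriv

/-! ## Hadamard's lemma -/

open MeasureTheory in
-- The integral is the value at `0` of the convolution of the indicator of `(0, 1]` with the
-- compactly supported `t ↦ b(t) G(p, -t)`, and such convolutions depend smoothly on parameters.
theorem contDiffOn_integral_Icc {P : Type*} [NormedAddCommGroup P] [NormedSpace ℝ P]
    {s : Set P} (hs : IsOpen s) {G : P × ℝ → ℝ} (hG : ContDiffOn ℝ ∞ G (s ×ˢ Set.univ)) :
    ContDiffOn ℝ ∞ (fun p => ∫ t in (0 : ℝ)..1, G (p, t)) s := by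
  -- The bump is `1` on `[-2, 2]`, which contains the points `-t` with `t ∈ (0, 1]` at which the
  -- convolution samples it.
  let b : ContDiffBump (0 : ℝ) := ⟨2, 3, by norm_num, by norm_num⟩
  let g : P → ℝ → ℝ := fun p t => b t * G (p, -t)
  let f : ℝ → ℝ := Set.indicator (Set.Ioc 0 1) (fun _ => 1)
  have hg : ContDiffOn ℝ ∞ (Function.uncurry g) (s ×ˢ Set.univ) := by
    refine ContDiffOn.mul ?_ ?_
    · exact (b.contDiff.comp contDiff_snd).contDiffOn
    · refine hG.comp (by fun_prop) ?_
      rintro ⟨p, t⟩ hp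
      simpa using hp
  have hf : LocallyIntegrable f volume := by
    have : IntegrableOn (fun _ : ℝ => (1 : ℝ)) (Set.Ioc 0 1) := by
      simp
    exact ((integrable_indicator_iff measurableSet_Ioc).2 this).locallyIntegrable
  have key := contDiffOn_convolution_right_with_param_comp (n := ⊤) (μ := volume)
    (ContinuousLinearMap.mul ℝ ℝ) (v := fun _ : P => (0 : ℝ)) contDiffOn_const (f := f) (g := g)
    (k := tsupport b) hs b.hasCompactSupport (by
      intro p t _ ht
      simp [g, image_eq_zero_of_notMem_tsupport ht]) hf hg
  refine ContDiffOn.congr key fun p hp => ?_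
  rw [convolution, intervalIntegral.integral_of_le zero_le_one,
    ← integral_indicator measurableSet_Ioc]
  refine integral_congr_ae (Filter.Eventually.of_forall fun t => ?_)
  by_cases ht : t ∈ Set.Ioc (0 : ℝ) 1
  · have hb : b (-t) = 1 := b.one_of_mem_closedBall (by
      simp [b, abs_of_pos ht.1]; linarith [ht.2])
    simp [f, g, ht, hb]
  · simp [f, ht]

/-- Hadamard's lemma along the fibres of a product. -/
theorem exists_hadamard {E F ι : Type*} [NormedAddCommGroup E] [NormedSpace ℝ E]
    [NormedAddCommGroup F] [NormedSpace ℝ F] [Fintype ι] (b : Module.Basis ι ℝ F)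
    {V : Set E} (hV : IsOpen V) {H : E × F → ℝ} (hH : ContDiffOn ℝ ∞ H (V ×ˢ Set.univ))
    {s : E → F} (hs : ContDiffOn ℝ ∞ s V) :
    ∃ G : ι → E × F → ℝ, (∀ j, ContDiffOn ℝ ∞ (G j) (V ×ˢ Set.univ)) ∧
      ∀ w ∈ V, ∀ v, H (w, v) - H (w, s w) = ∑ j, G j (w, v) * b.coord j (v - s w) := by
  have hO : IsOpen (V ×ˢ (Set.univ : Set F)) := hV.prod isOpen_univ
  -- The segment from `s w` to `v` in the fibre over `w`. The functions `G j` are the partial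
  -- derivatives of `H` integrated along it, and the identity is the fundamental theorem of
  -- calculus.
  let c : (E × F) × ℝ → E × F := fun q => (q.1.1, s q.1.1 + q.2 • (q.1.2 - s q.1.1))
  have hc : ContDiffOn ℝ ∞ c ((V ×ˢ Set.univ) ×ˢ Set.univ) := by
    have h1 : ContDiffOn ℝ ∞ (fun q : (E × F) × ℝ => s q.1.1) ((V ×ˢ Set.univ) ×ˢ Set.univ) :=
      hs.comp (by fun_prop) (fun q hq => hq.1.1)
    refine ContDiffOn.prodMk (by fun_prop) (h1.add (ContDiffOn.smul (by fun_prop) ?_))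
    exact ContDiffOn.sub (by fun_prop) h1
  have hcm : Set.MapsTo c ((V ×ˢ Set.univ) ×ˢ Set.univ) (V ×ˢ Set.univ) :=
    fun q hq => ⟨hq.1.1, trivial⟩
  have hD : ContDiffOn ℝ ∞ (fderiv ℝ H) (V ×ˢ Set.univ) :=
    hH.fderiv_of_isOpen hO (by simp)
  let K : ι → (E × F) × ℝ → ℝ := fun j q => fderiv ℝ H (c q) (0, b j)
  have hK : ∀ j, ContDiffOn ℝ ∞ (K j) ((V ×ˢ Set.univ) ×ˢ Set.univ) := fun j =>
    (hD.comp hc hcm).clm_apply contDiffOn_const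
  refine ⟨fun j p => ∫ t in (0 : ℝ)..1, K j (p, t),
    fun j => contDiffOn_integral_Icc hO (hK j), fun w hw v => ?_⟩
  have hKc : ∀ j, Continuous (fun t : ℝ => K j ((w, v), t)) := fun j =>
    (hK j).continuousOn.comp_continuous (by fun_prop) (fun t => ⟨⟨hw, trivial⟩, trivial⟩)
  have hderiv : ∀ t : ℝ, HasDerivAt (fun t : ℝ => H (c ((w, v), t)))
      (∑ j, K j ((w, v), t) * b.coord j (v - s w)) t := by
    intro t
    have h1 : HasFDerivAt H (fderiv ℝ H (c ((w, v), t))) (c ((w, v), t)) :=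
      ((hH.contDiffAt (hO.mem_nhds ⟨hw, trivial⟩)).differentiableAt (by simp)).hasFDerivAt
    have h2 : HasDerivAt (fun t : ℝ => c ((w, v), t)) (0, v - s w) t := by
      refine (hasDerivAt_const t w).prodMk ?_
      simpa using ((hasDerivAt_id t).smul_const (v - s w)).const_add (s w)
    have h3 := h1.comp_hasDerivAt t h2
    have h4 : ((0 : E), v - s w) = ∑ j, b.coord j (v - s w) • ((0 : E), b j) := by
      conv_lhs => rw [← b.sum_repr (v - s w)]
      ext <;> simp [Prod.fst_sum, Prod.snd_sum]
    rw [h4, map_sum] at h3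
    simp only [map_smul, smul_eq_mul] at h3
    refine h3.congr_deriv (Finset.sum_congr rfl fun j _ => mul_comm _ _)
  have h_int := intervalIntegral.integral_eq_sub_of_hasDerivAt (a := 0) (b := 1)
    (fun t _ => hderiv t) (Continuous.intervalIntegrable (by
      exact continuous_finsetSum _ fun j _ => (hKc j).mul continuous_const) _ _)
  have e1 : c ((w, v), 1) = (w, v) := by simp [c]
  have e0 : c ((w, v), 0) = (w, s w) := by simp [c]
  rw [e1, e0, intervalIntegral.integral_finsetSum
    (f := fun j t => K j ((w, v), t) * b.coord j (v - s w))
    (fun j _ => Continuous.intervalIntegrable ((hKc j).mul continuous_const) _ _)] at h_int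
  rw [← h_int]
  exact Finset.sum_congr rfl fun j _ => intervalIntegral.integral_mul_const _ _

/-! ## Cut-off functions and sections -/

section Bundles

variable {m : ℕ} {S : Type u} [TopologicalSpace S] [ChartedSpace (EuclideanSpace ℝ (Fin m)) S]

theorem SmoothVB.isSmoothFun_mul_of_tsupport_subset (W : SmoothVB.{u, v} m S) {U : Set S}
    (hU : IsOpen U) {ψ : S → ℝ} (hψ : ContMDiff (𝓡 m) 𝓘(ℝ, ℝ) ∞ ψ) (hs : tsupport ψ ⊆ U)
    {h : W.Tot → ℝ}
    (hh : ContMDiffOn ((𝓡 m).prod 𝓘(ℝ, W.F)) 𝓘(ℝ, ℝ) ∞ h (Bundle.TotalSpace.proj ⁻¹' U)) :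
    W.IsSmoothFun (fun p => ψ p.1 * h p) := by
  have hπ : Continuous (Bundle.TotalSpace.proj : W.Tot → S) := FiberBundle.continuous_proj _ _
  have hp : ContMDiff ((𝓡 m).prod 𝓘(ℝ, W.F)) (𝓡 m) ∞ (Bundle.TotalSpace.proj : W.Tot → S) :=
    Bundle.contMDiff_proj W.Fib
  intro p
  by_cases hx : p.1 ∈ tsupport ψ
  · have hn : Bundle.TotalSpace.proj ⁻¹' U ∈ nhds p := (hU.preimage hπ).mem_nhds (hs hx)
    exact ((hψ.comp hp).contMDiffAt).mul (hh.contMDiffAt hn)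
  · have hn : Bundle.TotalSpace.proj ⁻¹' (tsupport ψ)ᶜ ∈ nhds p :=
      ((isClosed_tsupport ψ).isOpen_compl.preimage hπ).mem_nhds hx
    refine (contMDiffAt_const (c := (0 : ℝ))).congr_of_eventuallyEq ?_
    filter_upwards [hn] with q hq
    rw [image_eq_zero_of_notMem_tsupport hq, zero_mul]

theorem SmoothVB.isSmoothFun_comp_proj (W : SmoothVB.{u, v} m S) {g : S → ℝ}
    (hg : ContMDiff (𝓡 m) 𝓘(ℝ, ℝ) ∞ g) : W.IsSmoothFun (fun p => g p.1) :=
  hg.comp (Bundle.contMDiff_proj W.Fib)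

theorem SmoothVB.isSmoothFun_comp_sec (W : SmoothVB.{u, v} m S) {c : W.Tot → ℝ}
    (hc : W.IsSmoothFun c) (σ : W.Sec) :
    ContMDiff (𝓡 m) 𝓘(ℝ, ℝ) ∞ (fun x => c ⟨x, σ x⟩) := by
  unfold SmoothVB.IsSmoothFun at hc
  exact hc.comp σ.contMDiff

theorem exists_bump [T2Space S] [IsManifold (𝓡 m) ∞ S] (x : S) {U : Set S} (hU : IsOpen U)
    (hx : x ∈ U) : ∃ ψ : S → ℝ, ContMDiff (𝓡 m) 𝓘(ℝ, ℝ) ∞ ψ ∧ ψ x = 1 ∧ tsupport ψ ⊆ U := by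
  obtain ⟨f, -, hf⟩ := (SmoothBumpFunction.nhds_basis_tsupport (I := 𝓡 m) x).mem_iff.1
    (hU.mem_nhds hx)
  exact ⟨f, f.contMDiff, f.eq_one, hf⟩

/-- A constant covector in a trivialization, cut off by a function. -/
theorem exists_dualSec_cutoff (W : SmoothVB.{u, v} m S) (x : S) {ψ : S → ℝ}
    (hψ : ContMDiff (𝓡 m) 𝓘(ℝ, ℝ) ∞ ψ)
    (hs : tsupport ψ ⊆ (trivializationAt W.F W.Fib x).baseSet) (c : W.F →ₗ[ℝ] ℝ) :
    ∃ l : DualSec W, ∀ p : W.Tot, l.val p.1 p.2 = ψ p.1 * c (trivializationAt W.F W.Fib x p).2 := by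
  let e := trivializationAt W.F W.Fib x
  have hval : ∀ p : W.Tot, (ψ p.1 • (c.comp (e.linearMapAt ℝ p.1))) p.2 = ψ p.1 * c (e p).2 := by
    intro p
    by_cases hp : p.1 ∈ e.baseSet
    · simp only [LinearMap.smul_apply, LinearMap.comp_apply, smul_eq_mul]
      rw [e.coe_linearMapAt_of_mem hp]
    · have : ψ p.1 = 0 := image_eq_zero_of_notMem_tsupport fun h => hp (hs h)
      simp [this]
  refine ⟨⟨fun y => ψ y • (c.comp (e.linearMapAt ℝ y)), ?_⟩, hval⟩
  simp only [hval]
  refine W.isSmoothFun_mul_of_tsupport_subset e.open_baseSet hψ hs ?_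
  have h1 := e.contMDiffOn (IB := 𝓡 m) (n := ∞)
  rw [e.source_eq] at h1
  have h2 : ContMDiff 𝓘(ℝ, W.F) 𝓘(ℝ, ℝ) ∞ c :=
    (LinearMap.toContinuousLinearMap c).contMDiff
  exact h2.comp_contMDiffOn (contMDiff_snd.comp_contMDiffOn h1)

variable [T2Space S] [IsManifold (𝓡 m) ∞ S]

/-- Existence is what gives the `epsilon` in `DualSec.through` its intended value, so that `coframe`
really restricts to the dual basis. -/
theorem exists_dualSec_through (W : SmoothVB.{u, v} m S) (x : S) (c : Module.Dual ℝ (W.Fib x)) :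
    ∃ l : DualSec W, l.val x = c := by
  let e := trivializationAt W.F W.Fib x
  have hx : x ∈ e.baseSet := mem_baseSet_trivializationAt W.F W.Fib x
  obtain ⟨ψ, hψ, h1, hs⟩ := exists_bump (m := m) x e.open_baseSet hx
  obtain ⟨l, hl⟩ := exists_dualSec_cutoff W x hψ hs
    (c.comp (e.continuousLinearEquivAt ℝ x hx).symm.toLinearEquiv.toLinearMap)
  refine ⟨l, ?_⟩
  ext y
  have := hl ⟨x, y⟩
  simp only [h1, one_mul] at this
  rw [this]
  exact congrArg c ((e.continuousLinearEquivAt ℝ x hx).symm_apply_apply y)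

theorem DualSec.through_val (W : SmoothVB.{u, v} m S) (x : S) (c : Module.Dual ℝ (W.Fib x)) :
    (DualSec.through W x c).val x = c :=
  Classical.epsilon_spec (p := fun s : DualSec W => s.val x = c) (exists_dualSec_through W x c)

/-- Hadamard's lemma along the fibres of a vector bundle, near a point of the graph of a section. -/
theorem SmoothVB.exists_hadamard (W : SmoothVB.{u, v} m S) {c : W.Tot → ℝ} (hc : W.IsSmoothFun c)
    (σ : W.Sec) (x : S) : ∃ χ : S → ℝ, ContMDiff (𝓡 m) 𝓘(ℝ, ℝ) ∞ χ ∧ χ x = 1 ∧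
      ∃ (n : ℕ) (g : Fin n → W.Tot → ℝ) (l : Fin n → DualSec W), (∀ j, W.IsSmoothFun (g j)) ∧
        ∀ p : W.Tot, χ p.1 * (c p - c ⟨p.1, σ p.1⟩) =
          ∑ j, g j p * ((l j).val p.1 p.2 - (l j).val p.1 (σ p.1)) := by
  let e := trivializationAt W.F W.Fib x
  let f := extChartAt (𝓡 m) x
  have hx : x ∈ e.baseSet := mem_baseSet_trivializationAt W.F W.Fib x
  let U : Set S := f.source ∩ e.baseSet
  have hU : IsOpen U := (isOpen_extChartAt_source x).inter e.open_baseSet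
  obtain ⟨ψ, hψ, h1, hs⟩ := exists_bump (m := m) x hU ⟨mem_extChartAt_source x, hx⟩
  let V : Set (EuclideanSpace ℝ (Fin m)) := f.target ∩ f.symm ⁻¹' e.baseSet
  have hV : IsOpen V := (continuousOn_extChartAt_symm x).isOpen_inter_preimage
    (isOpen_extChartAt_target x) e.open_baseSet
  have hf : ContMDiffOn 𝓘(ℝ, EuclideanSpace ℝ (Fin m)) (𝓡 m) ∞ f.symm V :=
    (contMDiffOn_extChartAt_symm x).mono Set.inter_subset_left
  unfold SmoothVB.IsSmoothFun at hc
  -- `H` and `s` are `c` and `σ` in the chart `f` and the trivialization `e`; only their behaviour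
  -- over `V` matters.
  let H : EuclideanSpace ℝ (Fin m) × W.F → ℝ :=
    fun q => c (e.toOpenPartialHomeomorph.symm (f.symm q.1, q.2))
  have hH : ContDiffOn ℝ ∞ H (V ×ˢ Set.univ) := by
    refine contMDiffOn_iff_contDiffOn.1 ?_
    have h2 : ContMDiffOn 𝓘(ℝ, EuclideanSpace ℝ (Fin m) × W.F) ((𝓡 m).prod 𝓘(ℝ, W.F)) ∞
        (fun q : EuclideanSpace ℝ (Fin m) × W.F => (f.symm q.1, q.2)) (V ×ˢ Set.univ) :=
      (hf.comp contDiff_fst.contMDiff.contMDiffOn (fun q hq => hq.1)).prodMk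
        contDiff_snd.contMDiff.contMDiffOn
    have h3 := e.contMDiffOn_symm (IB := 𝓡 m) (n := ∞)
    refine hc.comp_contMDiffOn (h3.comp h2 ?_)
    intro q hq
    rw [e.target_eq]
    exact ⟨hq.1.2, trivial⟩
  let s : EuclideanSpace ℝ (Fin m) → W.F := fun w => (e ⟨f.symm w, σ (f.symm w)⟩).2
  have he := e.contMDiffOn (IB := 𝓡 m) (n := ∞)
  have hs' : ContDiffOn ℝ ∞ s V := by
    rw [← contMDiffOn_iff_contDiffOn]
    refine contMDiff_snd.comp_contMDiffOn (he.comp (σ.contMDiff.comp_contMDiffOn hf) ?_)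
    intro w hw
    rw [e.source_eq]
    exact hw.2
  let b := Module.finBasis ℝ W.F
  obtain ⟨G, hG, hG'⟩ := BlendedQ.exists_hadamard b hV hH hs'
  have hsb : tsupport ψ ⊆ e.baseSet := fun y hy => (hs hy).2
  choose l hl using fun j => exists_dualSec_cutoff W x hψ hsb (b.coord j)
  let κ : W.Tot → EuclideanSpace ℝ (Fin m) × W.F := fun p => (f p.1, (e p).2)
  have hκm : ∀ p : W.Tot, p.1 ∈ U → κ p ∈ V ×ˢ (Set.univ : Set W.F) := by
    intro p hp
    refine ⟨⟨f.map_source hp.1, ?_⟩, trivial⟩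
    change f.symm (f p.1) ∈ e.baseSet
    rw [f.left_inv hp.1]
    exact hp.2
  have hκ : ContMDiffOn ((𝓡 m).prod 𝓘(ℝ, W.F)) 𝓘(ℝ, EuclideanSpace ℝ (Fin m) × W.F) ∞ κ
      (Bundle.TotalSpace.proj ⁻¹' U) := by
    rw [modelWithCornersSelf_prod, ← chartedSpaceSelf_prod]
    refine ContMDiffOn.prodMk ?_ ?_
    · refine ContMDiffOn.comp (contMDiffOn_extChartAt (I := 𝓡 m) (n := ∞) (x := x))
        (Bundle.contMDiff_proj W.Fib).contMDiffOn ?_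
      intro p hp
      simpa [f] using hp.1
    · refine contMDiff_snd.comp_contMDiffOn (he.mono ?_)
      intro p hp
      rw [e.source_eq]
      exact hp.2
  -- The cut-off is `ψ²`: one factor extends the coefficients `G j` by zero, the other the covectors
  -- `l j`.
  refine ⟨fun y => ψ y * ψ y, hψ.mul hψ, by simp [h1], _, fun j p => ψ p.1 * G j (κ p), l,
    fun j => W.isSmoothFun_mul_of_tsupport_subset hU hψ hs
      ((contMDiffOn_iff_contDiffOn.2 (hG j)).comp hκ hκm), fun p => ?_⟩
  by_cases hp : p.1 ∈ U
  · have h4 := hG' (f p.1) (hκm p hp).1 (e p).2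
    have h5 : f.symm (f p.1) = p.1 := f.left_inv hp.1
    have h6 : H (f p.1, (e p).2) = c p := by
      refine congrArg c ?_
      have h7 : p ∈ e.source := by rw [e.source_eq]; exact hp.2
      have h8 : (f.symm (f p.1), (e p).2) = e p := by
        rw [h5, ← e.coe_fst h7]
      change e.toOpenPartialHomeomorph.symm (f.symm (f p.1), (e p).2) = p
      rw [h8]
      exact e.left_inv h7
    have h9 : s (f p.1) = (e ⟨p.1, σ p.1⟩).2 :=
      congrArg (fun y => (e ⟨y, σ y⟩).2) h5
    have h10 : H (f p.1, s (f p.1)) = c ⟨p.1, σ p.1⟩ := by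
      refine congrArg c ?_
      have h7 : (⟨p.1, σ p.1⟩ : W.Tot) ∈ e.source := by rw [e.source_eq]; exact hp.2
      have h8 : (f.symm (f p.1), s (f p.1)) = e ⟨p.1, σ p.1⟩ := by
        rw [h9, h5]
        exact Prod.ext (e.coe_fst h7).symm rfl
      change e.toOpenPartialHomeomorph.symm (f.symm (f p.1), s (f p.1)) = _
      rw [h8]
      exact e.left_inv h7
    rw [h6, h10] at h4
    rw [h4, Finset.mul_sum]
    refine Finset.sum_congr rfl fun j _ => ?_
    have h11 := hl j ⟨p.1, σ p.1⟩
    have h12 := hl j p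
    simp only at h11 h12
    rw [h11, h12, h9, map_sub]
    simp only [κ, e]
    ring
  · have : ψ p.1 = 0 := image_eq_zero_of_notMem_tsupport fun h => hp (hs h)
    simp [this]

end Bundles

section Graded

variable {m : ℕ} {S : Type u} [TopologicalSpace S] [ChartedSpace (EuclideanSpace ℝ (Fin m)) S]

/-! ## Smoothness along the fibres of `NS` -/

/-- Smooth functions on a fibre. -/
def SmoothVB.IsFibreSmooth (W : SmoothVB.{u, v} m S) (x : S) (c : W.Fib x → ℝ) : Prop :=
  ContDiff ℝ ∞ (fun v => c ((Module.finBasis ℝ (W.Fib x)).equivFun.symm v))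

theorem SmoothVB.IsSmoothFun.isFibreSmooth {W : SmoothVB.{u, v} m S} {c : W.Tot → ℝ}
    (hc : W.IsSmoothFun c) (x : S) : W.IsFibreSmooth x (fun y => c ⟨x, y⟩) := by
  unfold SmoothVB.IsSmoothFun at hc
  let e := trivializationAt W.F W.Fib x
  have hx : x ∈ e.baseSet := mem_baseSet_trivializationAt W.F W.Fib x
  let b := Module.finBasis ℝ (W.Fib x)
  let L : (Fin (Module.finrank ℝ (W.Fib x)) → ℝ) →ₗ[ℝ] W.F :=
    (e.continuousLinearEquivAt ℝ x hx).toLinearEquiv.toLinearMap.comp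
      b.equivFun.symm.toLinearMap
  have hL : ContMDiff 𝓘(ℝ, Fin (Module.finrank ℝ (W.Fib x)) → ℝ) 𝓘(ℝ, W.F) ∞ L :=
    (LinearMap.toContinuousLinearMap L).contMDiff
  refine contMDiff_iff_contDiff.1 (hc.comp ((e.contMDiff_iff ?_).2 ⟨contMDiff_const, ?_⟩))
  · intro v
    rw [e.source_eq]
    exact hx
  · exact hL

theorem SmoothVB.IsFibreSmooth.contDiff_line {W : SmoothVB.{u, v} m S} {x : S} {c : W.Fib x → ℝ}
    (hc : W.IsFibreSmooth x c) (n : W.Fib x) : ContDiff ℝ ∞ (fun t : ℝ => c (t • n)) := by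
  let L := (Module.finBasis ℝ (W.Fib x)).equivFun
  have h1 : ContDiff ℝ ∞ (fun t : ℝ => t • L n) := by fun_prop
  have e : (fun t : ℝ => c (t • n)) = fun t => c (L.symm (t • L n)) := by
    funext t
    rw [← map_smul, L.symm_apply_apply]
  have h2 : ContDiff ℝ ∞ (fun v => c (L.symm v)) := hc
  rw [e]
  exact h2.comp h1

namespace GradedMfd

variable (D : GradedMfd.{u, v} m S)

/-- Functions on a fibre of `NS` with values in `S(ℰ*)_x` that are smooth and take values in a
finite-dimensional subspace. -/
def fibreSmooth (x : S) : Submodule ℝ (D.N.Fib x → D.Sym x) :=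
  Submodule.span ℝ {h | ∃ (c : D.N.Fib x → ℝ) (s : D.Sym x), D.N.IsFibreSmooth x c ∧
    h = fun y => c y • s}

/-- The sections of `S(ℰ*)` that are smooth along the fibres of `NS`. -/
def vertSmooth : Submodule ℝ D.Amb where
  carrier := {f | ∀ x, (fun y => f ⟨x, y⟩) ∈ D.fibreSmooth x}
  add_mem' hf hg x := (D.fibreSmooth x).add_mem (hf x) (hg x)
  zero_mem' x := (D.fibreSmooth x).zero_mem
  smul_mem' c _ hf x := (D.fibreSmooth x).smul_mem c (hf x)

/-- As `ℰ` is pulled back from `S`, only the coefficient of a generator varies along a fibre of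
`NS`. The larger space `vertSmooth` is stable under `graphVF` by an argument on single fibres
(`graphVF_mem`), so iterating there needs no smoothness transversally to the fibres. -/
theorem funSpan_le_vertSmooth {coef : Set (D.Base → ℝ)}
    (hcoef : ∀ c ∈ coef, D.N.IsSmoothFun c) (lab : Set (Idx D.ι)) (d : ℤ) :
    D.funSpan coef lab d ≤ D.vertSmooth := by
  refine Submodule.span_le.2 ?_
  rintro f ⟨c, hc, L, -, -, rfl⟩ x
  exact Submodule.subset_span ⟨fun y => c ⟨x, y⟩,
    (L.map (fun s => GSym.gen D.wt s.1 (s.2.val x))).prod, (hcoef c hc).isFibreSmooth x, rfl⟩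

theorem smoothFun_le_vertSmooth (d : ℤ) : D.smoothFun d ≤ D.vertSmooth :=
  D.funSpan_le_vertSmooth (fun _ h => h) _ _

/-- The derivative at `y` along `n` of a function on a fibre is `s`, coefficient by coefficient. -/
def HasFibreDeriv {x : S} (h : D.N.Fib x → D.Sym x) (y n : D.N.Fib x) (s : D.Sym x) : Prop :=
  ∀ c : D.Sym x →ₗ[ℝ] ℝ, HasDerivAt (fun t : ℝ => c (h (y + t • n))) (c s) 0

variable {D}

theorem eq_of_forall_functional {V : Type*} [AddCommGroup V] [Module ℝ V] {a b : V}
    (h : ∀ c : V →ₗ[ℝ] ℝ, c a = c b) : a = b := by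
  rw [← sub_eq_zero, ← Module.forall_dual_apply_eq_zero_iff ℝ]
  intro c
  rw [map_sub, h c, sub_self]

theorem HasFibreDeriv.unique {x : S} {h : D.N.Fib x → D.Sym x} {y n : D.N.Fib x} {s s' : D.Sym x}
    (hs : D.HasFibreDeriv h y n s) (hs' : D.HasFibreDeriv h y n s') : s = s' :=
  eq_of_forall_functional fun c => (hs c).unique (hs' c)

theorem HasFibreDeriv.add {x : S} {h h' : D.N.Fib x → D.Sym x} {y n : D.N.Fib x} {s s' : D.Sym x}
    (hs : D.HasFibreDeriv h y n s) (hs' : D.HasFibreDeriv h' y n s') :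
    D.HasFibreDeriv (h + h') y n (s + s') := fun c => by
  simp only [Pi.add_apply, map_add]
  exact (hs c).add (hs' c)

theorem HasFibreDeriv.smul {x : S} {h : D.N.Fib x → D.Sym x} {y n : D.N.Fib x} {s : D.Sym x}
    (r : ℝ) (hs : D.HasFibreDeriv h y n s) : D.HasFibreDeriv (r • h) y n (r • s) := fun c => by
  simp only [Pi.smul_apply, map_smul, smul_eq_mul]
  exact (hs c).const_mul r

theorem HasFibreDeriv.zero {x : S} (y n : D.N.Fib x) :
    D.HasFibreDeriv 0 y n 0 := fun c => by
  simpa using hasDerivAt_const (0 : ℝ) (0 : ℝ)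

/-- Coefficientwise derivatives are unique because functionals separate points; this determines the
`epsilon` in `vertDeriv` as soon as a derivative exists. -/
theorem HasFibreDeriv.vertDeriv_eq {f : D.Amb} {x : S} {y n : D.N.Fib x} {s : D.Sym x}
    (hs : D.HasFibreDeriv (fun y => f ⟨x, y⟩) y n s) : D.vertDeriv f x y n = s := by
  have h : D.HasFibreDeriv (fun y => f ⟨x, y⟩) y n (D.vertDeriv f x y n) :=
    Classical.epsilon_spec (p := fun s : D.Sym x => ∀ c : D.Sym x →ₗ[ℝ] ℝ,
      HasDerivAt (fun t : ℝ => c (f ⟨x, y + t • n⟩)) (c s) 0) ⟨s, hs⟩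
  exact h.unique hs

/-- Linearity in the direction is part of the statement because it lets the sum over a basis in
`graphVF` be recognised as one directional derivative; membership of the derivative in `fibreSmooth`
allows iteration. -/
theorem exists_fibreDeriv {x : S} {h : D.N.Fib x → D.Sym x} (hh : h ∈ D.fibreSmooth x) :
    ∃ h' : D.N.Fib x →ₗ[ℝ] (D.N.Fib x → D.Sym x),
      ∀ n, h' n ∈ D.fibreSmooth x ∧ ∀ y, D.HasFibreDeriv h y n (h' n y) := by
  induction hh using Submodule.span_induction with
  | mem h hh =>
    obtain ⟨c, s, hc, rfl⟩ := hh
    let L := (Module.finBasis ℝ (D.N.Fib x)).equivFun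
    let c' := fun v => c (L.symm v)
    have hc' : ContDiff ℝ ∞ c' := hc
    refine ⟨{ toFun := fun n y => (fderiv ℝ c' (L y) (L n)) • s
              map_add' := ?_, map_smul' := ?_ }, fun n => ⟨?_, fun y a => ?_⟩⟩
    · intro n n'
      ext y
      simp [add_smul]
    · intro r n
      ext y
      simp [mul_smul]
    · refine Submodule.subset_span ⟨fun y => fderiv ℝ c' (L y) (L n), s, ?_, rfl⟩
      unfold SmoothVB.IsFibreSmooth
      have : ContDiff ℝ ∞ (fun v => fderiv ℝ c' v (L n)) :=
        (hc'.fderiv_right (m := ∞) (by simp)).clm_apply contDiff_const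
      have e : (fun v => fderiv ℝ c' (L (L.symm v)) (L n)) = fun v => fderiv ℝ c' v (L n) := by
        funext v
        rw [L.apply_symm_apply]
      rw [← e] at this
      exact this
    · have h1 : HasFDerivAt c' (fderiv ℝ c' (L y)) (L y + (0 : ℝ) • L n) := by
        rw [zero_smul, add_zero]
        exact (hc'.differentiable (by simp) (L y)).hasFDerivAt
      have h2 : HasDerivAt (fun t : ℝ => L y + t • L n) (L n) 0 := by
        simpa using ((hasDerivAt_id (0 : ℝ)).smul_const (L n)).const_add (L y)
      have h3 := (h1.comp_hasDerivAt (0 : ℝ) h2).mul_const (a s)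
      simp only [LinearMap.coe_mk, AddHom.coe_mk, map_smul, smul_eq_mul]
      refine h3.congr_of_eventuallyEq (Filter.Eventually.of_forall fun t => ?_)
      change c (y + t • n) * a s = c (L.symm (L y + t • L n)) * a s
      rw [← map_smul, ← map_add, L.symm_apply_apply]
  | zero => exact ⟨0, fun n => ⟨Submodule.zero_mem _, fun y => HasFibreDeriv.zero y n⟩⟩
  | add f g _ _ hf hg =>
    obtain ⟨f', hf'⟩ := hf
    obtain ⟨g', hg'⟩ := hg
    exact ⟨f' + g', fun n => ⟨Submodule.add_mem _ (hf' n).1 (hg' n).1,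
      fun y => ((hf' n).2 y).add ((hg' n).2 y)⟩⟩
  | smul r f _ hf =>
    obtain ⟨f', hf'⟩ := hf
    exact ⟨r • f', fun n => ⟨Submodule.smul_mem _ r (hf' n).1, fun y => ((hf' n).2 y).smul r⟩⟩

theorem phiDeriv_mem_fibreSmooth {x : S} (φ : D.A.Fib x →ₗ[ℝ] D.B.Fib x)
    {h : D.N.Fib x → D.Sym x} (hh : h ∈ D.fibreSmooth x) :
    (fun y => D.phiDeriv x φ (h y)) ∈ D.fibreSmooth x := by
  induction hh using Submodule.span_induction with
  | mem h hh =>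
    obtain ⟨c, s, hc, rfl⟩ := hh
    exact Submodule.subset_span ⟨c, D.phiDeriv x φ s, hc, by simp only [phiDeriv_smul]⟩
  | zero =>
    have : D.phiDeriv x φ 0 = 0 := by simpa using D.phiDeriv_smul x φ 0 0
    simp only [Pi.zero_apply, this]
    exact Submodule.zero_mem _
  | add f g _ _ hf hg =>
    simp only [Pi.add_apply, phiDeriv_add]
    exact Submodule.add_mem _ hf hg
  | smul r f _ hf =>
    simp only [Pi.smul_apply, phiDeriv_smul]
    exact Submodule.smul_mem _ r hf

/-! ## The vector field `σ^j ∂/∂y^j + φ^q ∂/∂η^q` -/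

section graphVF

variable (σ : D.N.Sec) (φ : BundleHom D.A D.B)

/-- The vector field `σ^j ∂/∂y^j + φ^q ∂/∂η^q`, acting on functions. -/
def graphVF (f : D.Amb) : D.Amb := fun p =>
  (∑ r, (Module.finBasis ℝ (D.N.Fib p.1)).coord r (σ p.1) •
      D.vertDeriv f p.1 p.2 (Module.finBasis ℝ (D.N.Fib p.1) r)) +
    D.phiDeriv p.1 (φ.val p.1) (f p)

/-- By linearity in the direction, `∑ σ^j ∂/∂y^j` is the derivative along `σ x`, whatever the basis.
-/
theorem exists_graphVF_eq {f : D.Amb} (hf : f ∈ D.vertSmooth) (x : S) :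
    ∃ h ∈ D.fibreSmooth x, ∀ y, D.HasFibreDeriv (fun y => f ⟨x, y⟩) y (σ x) (h y) ∧
      graphVF σ φ f ⟨x, y⟩ = h y + D.phiDeriv x (φ.val x) (f ⟨x, y⟩) := by
  obtain ⟨h', hh'⟩ := exists_fibreDeriv (hf x)
  refine ⟨h' (σ x), (hh' _).1, fun y => ⟨(hh' _).2 y, ?_⟩⟩
  unfold graphVF
  congr 1
  conv_rhs => rw [← (Module.finBasis ℝ (D.N.Fib x)).sum_repr (σ x), map_sum, Finset.sum_apply]
  refine Finset.sum_congr rfl fun r _ => ?_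
  rw [((hh' _).2 y).vertDeriv_eq, map_smul]
  rfl

variable {σ φ}

theorem graphVF_eq {f : D.Amb} (hf : f ∈ D.vertSmooth) {x : S} {y : D.N.Fib x} {s : D.Sym x}
    (hs : D.HasFibreDeriv (fun y => f ⟨x, y⟩) y (σ x) s) :
    graphVF σ φ f ⟨x, y⟩ = s + D.phiDeriv x (φ.val x) (f ⟨x, y⟩) := by
  obtain ⟨h, -, hh⟩ := exists_graphVF_eq σ φ hf x
  rw [(hh y).2, (hh y).1.unique hs]

theorem graphVF_mem {f : D.Amb} (hf : f ∈ D.vertSmooth) : graphVF σ φ f ∈ D.vertSmooth := by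
  intro x
  obtain ⟨h, hh, hh'⟩ := exists_graphVF_eq σ φ hf x
  simp only [(hh' _).2]
  exact Submodule.add_mem _ hh (phiDeriv_mem_fibreSmooth _ (hf x))

theorem graphVF_add {f g : D.Amb} (hf : f ∈ D.vertSmooth) (hg : g ∈ D.vertSmooth) :
    graphVF σ φ (f + g) = graphVF σ φ f + graphVF σ φ g := by
  funext ⟨x, y⟩
  obtain ⟨h, -, hh⟩ := exists_graphVF_eq σ φ hf x
  obtain ⟨h', -, hh'⟩ := exists_graphVF_eq σ φ hg x
  rw [graphVF_eq (D.vertSmooth.add_mem hf hg) ((hh y).1.add (hh' y).1), Pi.add_apply,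
    Pi.add_apply, (hh y).2, (hh' y).2, phiDeriv_add]
  abel

theorem graphVF_smul {f : D.Amb} (r : ℝ) (hf : f ∈ D.vertSmooth) :
    graphVF σ φ (r • f) = r • graphVF σ φ f := by
  funext ⟨x, y⟩
  obtain ⟨h, -, hh⟩ := exists_graphVF_eq σ φ hf x
  rw [graphVF_eq (D.vertSmooth.smul_mem r hf) ((hh y).1.smul r), Pi.smul_apply,
    Pi.smul_apply, (hh y).2, phiDeriv_smul, smul_add]

theorem graphVF_zero : graphVF σ φ 0 = 0 := by
  simpa using graphVF_smul (σ := σ) (φ := φ) 0 D.vertSmooth.zero_mem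

theorem graphVF_neg {f : D.Amb} (hf : f ∈ D.vertSmooth) :
    graphVF σ φ (-f) = -graphVF σ φ f := by
  simpa using graphVF_smul (σ := σ) (φ := φ) (-1) hf

/-- The restrictions of `f` to the graphs of the multiples `t (σ, φ)` have the restrictions of
`graphVF σ φ f` as derivative. -/
theorem hasDerivAt_rest_graphVF {f : D.Amb} (hf : f ∈ D.vertSmooth) (x : S)
    (c : D.SymA x →ₗ[ℝ] ℝ) (t : ℝ) :
    HasDerivAt (fun t : ℝ => c (D.rest x (φ.val x) t (f ⟨x, t • σ x⟩)))
      (c (D.rest x (φ.val x) t (graphVF σ φ f ⟨x, t • σ x⟩))) t := by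
  -- For `a(y) • s` the curve is the product of `a(t σ x)` and the restriction of `s` to the graph
  -- of `t φ`; the product rule yields the two summands of `graphVF`.
  have key : ∀ h ∈ D.fibreSmooth x, ∃ s, D.HasFibreDeriv h (t • σ x) (σ x) s ∧
      HasDerivAt (fun t : ℝ => c (D.rest x (φ.val x) t (h (t • σ x))))
        (c (D.rest x (φ.val x) t (s + D.phiDeriv x (φ.val x) (h (t • σ x))))) t := by
    intro h hh
    induction hh using Submodule.span_induction with
    | mem h hh =>
      obtain ⟨a, s, ha, rfl⟩ := hh
      have ha' : ContDiff ℝ ∞ (fun t : ℝ => a (t • σ x)) := ha.contDiff_line (σ x)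
      have h2 := (ha'.differentiable (by simp) t).hasDerivAt
      refine ⟨(deriv (fun t : ℝ => a (t • σ x)) t) • s, fun b => ?_, ?_⟩
      · have h3 : HasDerivAt (fun r : ℝ => a ((t + r) • σ x))
            (deriv (fun t : ℝ => a (t • σ x)) t) 0 := by
          have : HasDerivAt (fun t : ℝ => a (t • σ x)) (deriv (fun t : ℝ => a (t • σ x)) t)
            (t + 0) := by rwa [add_zero]
          exact this.comp_const_add t 0
        simp only [map_smul, smul_eq_mul]
        simp only [add_smul] at h3
        exact h3.mul_const (b s)
      · have h4 := h2.mul (D.hasDerivAt_rest x (φ.val x) c s t)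
        simp only [phiDeriv_smul, map_add, map_smul, smul_eq_mul]
        exact h4
    | zero =>
      refine ⟨0, HasFibreDeriv.zero _ _, ?_⟩
      have : D.phiDeriv x (φ.val x) 0 = 0 := by simpa using D.phiDeriv_smul x (φ.val x) 0 0
      simp only [Pi.zero_apply, this, map_zero, add_zero]
      exact hasDerivAt_const _ _
    | add f g _ _ hf hg =>
      obtain ⟨s, hs, hs'⟩ := hf
      obtain ⟨s₁, hs₁, hs₁'⟩ := hg
      refine ⟨s + s₁, hs.add hs₁, ?_⟩
      have h := hs'.add hs₁'
      simp only [Pi.add_apply, phiDeriv_add, map_add] at h ⊢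
      rw [add_add_add_comm]
      exact h
    | smul r f _ hf =>
      obtain ⟨s, hs, hs'⟩ := hf
      refine ⟨r • s, hs.smul r, ?_⟩
      have h := hs'.const_mul r
      simp only [Pi.smul_apply, phiDeriv_smul, ← smul_add, map_smul, smul_eq_mul]
      exact h
  obtain ⟨s, hs, hs'⟩ := key _ (hf x)
  rw [graphVF_eq hf hs]
  exact hs'

theorem contDiff_functional_line {x : S} {h : D.N.Fib x → D.Sym x} (hh : h ∈ D.fibreSmooth x)
    (c : D.Sym x →ₗ[ℝ] ℝ) (n : D.N.Fib x) : ContDiff ℝ ∞ (fun t : ℝ => c (h (t • n))) := by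
  induction hh using Submodule.span_induction with
  | mem h hh =>
    obtain ⟨a, s, ha, rfl⟩ := hh
    simp only [map_smul, smul_eq_mul]
    exact (ha.contDiff_line n).mul contDiff_const
  | zero => simpa using contDiff_const
  | add f g _ _ hf hg => simpa using hf.add hg
  | smul r f _ hf => simpa using contDiff_const.mul hf

/-- The values of `h` on the whole fibre lie in one finite-dimensional space, so the degree in `t`
is bounded uniformly and the expansion in powers of `t` is a finite sum of fixed length. -/
theorem exists_natDegree_restPoly_lt {x : S} (ψ : D.A.Fib x →ₗ[ℝ] D.B.Fib x)
    {h : D.N.Fib x → D.Sym x} (hh : h ∈ D.fibreSmooth x) :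
    ∃ n, ∀ y, (D.restPoly x ψ (h y)).natDegree < n := by
  induction hh using Submodule.span_induction with
  | mem h hh =>
    obtain ⟨a, s, ha, rfl⟩ := hh
    refine ⟨(D.restPoly x ψ s).natDegree + 1, fun y => ?_⟩
    rw [map_smul]
    exact Nat.lt_succ_of_le (Polynomial.natDegree_smul_le _ _)
  | zero => exact ⟨1, fun y => by simp⟩
  | add f g _ _ hf hg =>
    obtain ⟨a, ha⟩ := hf
    obtain ⟨b, hb⟩ := hg
    refine ⟨max a b, fun y => ?_⟩
    rw [Pi.add_apply, map_add]
    exact lt_of_le_of_lt (Polynomial.natDegree_add_le _ _) (max_lt_max (ha y) (hb y))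
  | smul r f _ hf =>
    obtain ⟨a, ha⟩ := hf
    refine ⟨a, fun y => ?_⟩
    rw [Pi.smul_apply, map_smul]
    exact lt_of_le_of_lt (Polynomial.natDegree_smul_le _ _) (ha y)

/-- The restrictions of a function that is analytic along `p^!NS` to the graphs of the multiples
`t (σ, φ)` are the sum of a power series in `t`. -/
theorem isEntire_rest {f : D.Amb} (hf : f ∈ D.vertSmooth) (ha : D.IsAnalyticFun f) (x : S)
    (n : D.N.Fib x) (ψ : D.A.Fib x →ₗ[ℝ] D.B.Fib x) (c : D.SymA x →ₗ[ℝ] ℝ) :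
    IsEntire (fun t => c (D.rest x ψ t (f ⟨x, t • n⟩))) := by
  obtain ⟨k, hk⟩ := exists_natDegree_restPoly_lt ψ (hf x)
  -- `μ i` reads off the coefficient of `t^i` in the restriction to the graph of `t ψ`. It is a
  -- functional on `S(ℰ*)_x`, so the analyticity of `f` applies to it.
  let μ : ℕ → D.Sym x →ₗ[ℝ] ℝ := fun i =>
    { toFun := fun s => c ((D.restPoly x ψ s).coeff i)
      map_add' := fun s t => by simp
      map_smul' := fun r s => by simp }
  have h1 : ∀ i, IsEntire (fun t => μ i (D.toE₀ x (f ⟨x, t • n⟩))) := by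
    intro i
    refine IsEntire.of_hasSum_comp_mul (fun t => ?_) ?_
    · have := ha x (t • n) (μ i)
      have e : (fun s : ℝ => μ i (D.toE₀ x (f ⟨x, (s * t) • n⟩))) =
          fun s : ℝ => μ i (D.toE₀ x (f ⟨x, s • t • n⟩)) := by
        funext s
        rw [mul_smul]
      rw [e]
      exact this
    · exact contDiff_functional_line (hf x) ((μ i).comp (D.toE₀ x).toLinearMap) n
  have h2 : (fun t => c (D.rest x ψ t (f ⟨x, t • n⟩))) =
      fun t => ∑ i ∈ Finset.range k, t ^ i * μ i (D.toE₀ x (f ⟨x, t • n⟩)) := by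
    funext t
    rw [rest, AlgHom.comp_apply, evalReal_eq_sum t _ (hk (t • n)), map_sum]
    refine Finset.sum_congr rfl fun i _ => ?_
    rw [map_smul, smul_eq_mul]
    congr 1
    change _ = c ((D.restPoly x ψ (D.toE₀ x (f ⟨x, t • n⟩))).coeff i)
    rw [restPoly_toE₀]
  rw [h2]
  exact IsEntire.sum fun i _ => (h1 i).pow_mul i

end graphVF

end GradedMfd

end Graded

/-! ### Rules for signs -/

theorem sgn_zero : sgn 0 = 1 := by simp [sgn]

theorem sgn_add (a b : ℤ) : sgn (a + b) = sgn a * sgn b := by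
  simp [sgn, Int.negOnePow_add]

theorem sgn_mul_self (a : ℤ) : sgn a * sgn a = 1 := by
  rw [← sgn_add, sgn, Int.negOnePow_even _ ⟨a, rfl⟩]
  simp

section Graded

variable {m : ℕ} {S : Type u} [TopologicalSpace S] [ChartedSpace (EuclideanSpace ℝ (Fin m)) S]

namespace GradedMfd

variable {D : GradedMfd.{u, v} m S}

/-! ## The vector field `I(-(σ, φ))` -/

theorem injAux_eq_zero (x : S) (y : D.N.Fib x) (L : List D.GFun) :
    ∀ c : List D.Lin → D.SymA x, (∀ L', c L' = 0) → D.injAux x y L c = 0 := by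
  induction L with
  | nil => intro c hc; simp [injAux, hc]
  | cons f L ih =>
    intro c hc
    simp only [injAux]
    refine Finset.sum_eq_zero fun j _ => ?_
    rw [ih _ fun L' => hc _, zero_mul, smul_zero]

section inj

variable (σ : D.N.Sec) (φ : BundleHom D.A D.B)

/-- `-(σ, φ)` is of multiplicity one, so its image under `I` is a vector field and is nonzero on
lists of length one at most. -/
theorem inj_neg_deform_nil : inj (-D.deform σ φ) [] = 0 := by
  funext p
  change D.fromA p.1 (-0) = 0
  simp

theorem inj_neg_deform_cons_cons (f g : D.GFun) (L : List D.GFun) :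
    inj (-D.deform σ φ) (f :: g :: L) = 0 := by
  funext p
  simp only [inj, injAux]
  refine Finset.sum_eq_zero fun j _ => ?_
  have : ∑ j', sgn ((g.1 - D.linDeg (D.coframe p.1 j')) * D.shSum L) •
      (D.injAux p.1 p.2 L (fun L' => (-D.deform σ φ).op
        (D.coframe p.1 j :: D.coframe p.1 j' :: L') p.1) *
          D.partialDeriv p.1 p.2 g.2 j') = 0 := by
    refine Finset.sum_eq_zero fun j' _ => ?_
    rw [injAux_eq_zero, zero_mul, smul_zero]
    intro L'
    change (-D.deformOp σ φ (D.coframe p.1 j :: D.coframe p.1 j' :: L')) p.1 = 0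
    simp [deformOp]
  rw [this, zero_mul, smul_zero]

/-- With a single argument no sign arises in `injAux`. Evaluating `-(σ, φ)` on the coframe at the
point gives minus the coefficients of `graphVF`. -/
theorem inj_neg_deform_singleton [T2Space S] [IsManifold (𝓡 m) ∞ S] (f : D.GFun) :
    inj (-D.deform σ φ) [f] = -graphVF σ φ f.2 := by
  funext p
  have h0 : D.shSum [] = 0 := rfl
  simp only [inj, injAux, h0, mul_zero, sgn_zero, one_smul, Fintype.sum_sum_type, Pi.neg_apply,
    graphVF, neg_add]
  congr 1
  · rw [← Finset.sum_neg_distrib]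
    refine Finset.sum_congr rfl fun r _ => ?_
    have h1 : (-D.deform σ φ).op [D.coframe p.1 (Sum.inl r)] p.1 =
        algebraMap ℝ (D.SymA p.1) (-((Module.finBasis ℝ (D.N.Fib p.1)).coord r (σ p.1))) := by
      rw [map_neg]
      change -(algebraMap ℝ (D.SymA p.1) ((DualSec.through D.N p.1 _).val p.1 (σ p.1))) = _
      rw [DualSec.through_val]
    rw [h1, AlgHom.commutes, ← Algebra.smul_def, neg_smul]
    rfl
  · rw [phiDeriv, ← Finset.sum_neg_distrib]
    refine Finset.sum_congr rfl fun r _ => ?_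
    have h1 : (-D.deform σ φ).op [D.coframe p.1 (Sum.inr r)] p.1 =
        -gen1 D.k _ (((Module.finBasis ℝ (D.B.Fib p.1)).coord r).comp (φ.val p.1)) := by
      change -(gen1 D.k _ (((DualSec.through D.B p.1 _).val p.1).comp (φ.val p.1))) = _
      rw [DualSec.through_val]
    rw [h1, map_neg, fromA_gen1, neg_mul]
    rfl

end inj

/-! ## Operations on functions that are at most affine along `(σ, φ)` -/

section Affine

variable (σ : D.N.Sec) (φ : BundleHom D.A D.B)

/-- Homogeneous smooth functions that are at most affine along `(σ, φ)`. -/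
def IsAffine (f : D.GFun) : Prop :=
  f.2 ∈ D.smoothFun f.1 ∧ graphVF σ φ f.2 ∈ D.smoothFun f.1 ∧ graphVF σ φ (graphVF σ φ f.2) = 0

variable {σ φ}

theorem IsAffine.mem_vertSmooth {f : D.GFun} (hf : IsAffine σ φ f) : f.2 ∈ D.vertSmooth :=
  D.smoothFun_le_vertSmooth _ hf.1

theorem IsAffine.zero (e : ℤ) : IsAffine σ φ ((e, 0) : D.GFun) := by
  refine ⟨Submodule.zero_mem _, ?_, ?_⟩ <;> simp [graphVF_zero]

theorem IsAffine.add {e : ℤ} {f g : D.Amb} (hf : IsAffine σ φ (e, f)) (hg : IsAffine σ φ (e, g)) :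
    IsAffine σ φ (e, f + g) := by
  have h := graphVF_add (σ := σ) (φ := φ) hf.mem_vertSmooth hg.mem_vertSmooth
  refine ⟨Submodule.add_mem _ hf.1 hg.1, ?_, ?_⟩
  · change graphVF σ φ (f + g) ∈ _
    rw [h]
    exact Submodule.add_mem _ hf.2.1 hg.2.1
  · change graphVF σ φ (graphVF σ φ (f + g)) = 0
    rw [h, graphVF_add (graphVF_mem hf.mem_vertSmooth) (graphVF_mem hg.mem_vertSmooth),
      hf.2.2, hg.2.2, add_zero]

theorem IsAffine.smul {e : ℤ} {f : D.Amb} (r : ℝ) (hf : IsAffine σ φ (e, f)) :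
    IsAffine σ φ (e, r • f) := by
  have h := graphVF_smul (σ := σ) (φ := φ) r hf.mem_vertSmooth
  refine ⟨Submodule.smul_mem _ r hf.1, ?_, ?_⟩
  · change graphVF σ φ (r • f) ∈ _
    rw [h]
    exact Submodule.smul_mem _ r hf.2.1
  · change graphVF σ φ (graphVF σ φ (r • f)) = 0
    rw [h, graphVF_smul r (graphVF_mem hf.mem_vertSmooth), hf.2.2, smul_zero]

/-- Brackets with `I(-(σ, φ))` replace an argument `f` by `-graphVF σ φ f`; stability keeps all
arguments in the class. -/
theorem IsAffine.neg_graphVF {f : D.GFun} (hf : IsAffine σ φ f) :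
    IsAffine σ φ (f.1, -graphVF σ φ f.2) := by
  have h := graphVF_neg (σ := σ) (φ := φ) (graphVF_mem (σ := σ) (φ := φ) hf.mem_vertSmooth)
  rw [hf.2.2, neg_zero] at h
  refine ⟨Submodule.neg_mem _ hf.2.1, ?_, ?_⟩
  · change graphVF σ φ (-graphVF σ φ f.2) ∈ _
    rw [h]
    exact Submodule.zero_mem _
  · change graphVF σ φ (graphVF σ φ (-graphVF σ φ f.2)) = 0
    rw [h, graphVF_zero]

variable (σ φ)

/-- Graded symmetric multilinear operations on affine functions, with values that are smooth along
the fibres of `NS`. -/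
structure IsAffineOp (Z : D.Op) : Prop where
  mem : ∀ L, (∀ f ∈ L, IsAffine σ φ f) → Z L ∈ D.vertSmooth
  add : ∀ L, (∀ f ∈ L, IsAffine σ φ f) → ∀ e f g, IsAffine σ φ (e, f) → IsAffine σ φ (e, g) →
    Z ((e, f + g) :: L) = Z ((e, f) :: L) + Z ((e, g) :: L)
  smul : ∀ L, (∀ f ∈ L, IsAffine σ φ f) → ∀ e f (r : ℝ), IsAffine σ φ (e, f) →
    Z ((e, r • f) :: L) = r • Z ((e, f) :: L)
  symm : ∀ L₁ L₂ f g, (∀ h ∈ L₁ ++ f :: g :: L₂, IsAffine σ φ h) →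
    Z (L₁ ++ f :: g :: L₂) = sgn ((f.1 - 1) * (g.1 - 1)) • Z (L₁ ++ g :: f :: L₂)

variable {σ φ}

theorem _root_.BlendedQ.MultiVF.isAffineOp {d : ℤ} (Z : MultiVF D d) : IsAffineOp σ φ Z.op where
  mem L hL := D.smoothFun_le_vertSmooth _ (Z.mem L fun f hf => (hL f hf).1)
  add L hL e f g hf hg := Z.add L (fun f hf => (hL f hf).1) e f hf.1 g hg.1
  smul L hL e f r hf := Z.smul L (fun f hf => (hL f hf).1) e f hf.1 r
  symm L₁ L₂ f g h := Z.symm L₁ L₂ f g fun f hf => (h f hf).1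

namespace IsAffineOp

variable {Z : D.Op}

theorem congr {Z' : D.Op} (hZ : IsAffineOp σ φ Z)
    (h : ∀ L, (∀ f ∈ L, IsAffine σ φ f) → Z' L = Z L) : IsAffineOp σ φ Z' where
  mem L hL := by rw [h L hL]; exact hZ.mem L hL
  add L hL e f g hf hg := by
    rw [h _ (List.forall_mem_cons.2 ⟨hf.add hg, hL⟩), h _ (List.forall_mem_cons.2 ⟨hf, hL⟩),
      h _ (List.forall_mem_cons.2 ⟨hg, hL⟩), hZ.add L hL e f g hf hg]
  smul L hL e f r hf := by
    rw [h _ (List.forall_mem_cons.2 ⟨hf.smul r, hL⟩), h _ (List.forall_mem_cons.2 ⟨hf, hL⟩),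
      hZ.smul L hL e f r hf]
  symm L₁ L₂ f g hL := by
    rw [h _ hL, h, hZ.symm L₁ L₂ f g hL]
    intro k hk
    refine hL k ?_
    simp only [List.mem_append, List.mem_cons] at hk ⊢
    tauto

/-- Fixing the first argument is what inductions over argument lists do. Linearity in the next slot
is obtained by swapping it to the front, since linearity is only required there. -/
theorem cons (hZ : IsAffineOp σ φ Z) {h : D.GFun} (hh : IsAffine σ φ h) :
    IsAffineOp σ φ (fun L => Z (h :: L)) where
  mem L hL := hZ.mem _ (List.forall_mem_cons.2 ⟨hh, hL⟩)
  add L hL e f g hf hg := by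
    have h1 : ∀ f, IsAffine σ φ (e, f) →
        Z (h :: (e, f) :: L) = sgn ((h.1 - 1) * (e - 1)) • Z ((e, f) :: h :: L) := fun f hf =>
      hZ.symm [] L h (e, f) (List.forall_mem_cons.2 ⟨hh, List.forall_mem_cons.2 ⟨hf, hL⟩⟩)
    simp only [h1 _ hf, h1 _ hg, h1 _ (hf.add hg)]
    rw [hZ.add _ (List.forall_mem_cons.2 ⟨hh, hL⟩) e f g hf hg, smul_add]
  smul L hL e f r hf := by
    have h1 : ∀ f, IsAffine σ φ (e, f) →
        Z (h :: (e, f) :: L) = sgn ((h.1 - 1) * (e - 1)) • Z ((e, f) :: h :: L) := fun f hf =>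
      hZ.symm [] L h (e, f) (List.forall_mem_cons.2 ⟨hh, List.forall_mem_cons.2 ⟨hf, hL⟩⟩)
    simp only [h1 _ hf, h1 _ (hf.smul r)]
    rw [hZ.smul _ (List.forall_mem_cons.2 ⟨hh, hL⟩) e f r hf, smul_comm]
  symm L₁ L₂ f g hL := hZ.symm (h :: L₁) L₂ f g (List.forall_mem_cons.2 ⟨hh, hL⟩)

theorem map_zero (hZ : IsAffineOp σ φ Z) {L : List D.GFun} (hL : ∀ f ∈ L, IsAffine σ φ f) (e : ℤ) :
    Z ((e, 0) :: L) = 0 := by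
  have := hZ.smul L hL e 0 0 (IsAffine.zero e)
  simpa using this

theorem append_singleton (L : List D.GFun) : ∀ {Z : D.Op}, IsAffineOp σ φ Z →
    (∀ f ∈ L, IsAffine σ φ f) → ∀ {h : D.GFun}, IsAffine σ φ h →
    Z (L ++ [h]) = sgn ((h.1 - 1) * D.shSum L) • Z (h :: L) := by
  induction L with
  | nil => intro Z _ _ h _; simp [shSum, sgn_zero]
  | cons g L ih =>
    intro Z hZ hL h hh
    obtain ⟨hg, hL⟩ := List.forall_mem_cons.1 hL
    have h1 := ih (hZ.cons hg) hL hh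
    have h2 := hZ.symm [] L g h
      (List.forall_mem_cons.2 ⟨hg, List.forall_mem_cons.2 ⟨hh, hL⟩⟩)
    simp only [List.nil_append] at h2
    rw [List.cons_append, h1, h2, smul_smul, ← sgn_add]
    congr 2
    simp only [shSum, List.map_cons, List.sum_cons]
    ring

end IsAffineOp

/-! ## The bracket with `I(-(σ, φ))` -/

variable (σ φ)

/-- The Lie derivative of an operation along `graphVF σ φ`. -/
def lieOp : List D.GFun → D.Op → D.Amb
  | [], Z => graphVF σ φ (Z [])
  | f :: L, Z => Z ((f.1, -graphVF σ φ f.2) :: L) + lieOp L (fun L' => Z (f :: L'))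

variable {σ φ}

theorem lieOp_congr (L : List D.GFun) : ∀ {Z Z' : D.Op}, (∀ f ∈ L, IsAffine σ φ f) →
    (∀ L, (∀ f ∈ L, IsAffine σ φ f) → Z L = Z' L) → lieOp σ φ L Z = lieOp σ φ L Z' := by
  induction L with
  | nil => intro Z Z' _ h; simp [lieOp, h [] (by simp)]
  | cons f L ih =>
    intro Z Z' hL h
    obtain ⟨hf, hL⟩ := List.forall_mem_cons.1 hL
    simp only [lieOp]
    rw [h _ (List.forall_mem_cons.2 ⟨hf.neg_graphVF, hL⟩),
      ih hL fun L' hL' => h _ (List.forall_mem_cons.2 ⟨hf, hL'⟩)]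

theorem lieOp_add (L : List D.GFun) : ∀ {Z Z' : D.Op}, (∀ f ∈ L, IsAffine σ φ f) →
    (∀ L, (∀ f ∈ L, IsAffine σ φ f) → Z L ∈ D.vertSmooth) →
    (∀ L, (∀ f ∈ L, IsAffine σ φ f) → Z' L ∈ D.vertSmooth) →
    lieOp σ φ L (fun L => Z L + Z' L) = lieOp σ φ L Z + lieOp σ φ L Z' := by
  induction L with
  | nil =>
    intro Z Z' _ h h'
    simp only [lieOp]
    exact graphVF_add (h [] (by simp)) (h' [] (by simp))
  | cons f L ih =>
    intro Z Z' hL h h'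
    obtain ⟨hf, hL⟩ := List.forall_mem_cons.1 hL
    simp only [lieOp]
    rw [ih hL (fun L' hL' => h _ (List.forall_mem_cons.2 ⟨hf, hL'⟩))
      (fun L' hL' => h' _ (List.forall_mem_cons.2 ⟨hf, hL'⟩))]
    abel

theorem lieOp_smul (L : List D.GFun) (r : ℝ) : ∀ {Z : D.Op}, (∀ f ∈ L, IsAffine σ φ f) →
    (∀ L, (∀ f ∈ L, IsAffine σ φ f) → Z L ∈ D.vertSmooth) →
    lieOp σ φ L (fun L => r • Z L) = r • lieOp σ φ L Z := by
  induction L with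
  | nil =>
    intro Z _ h
    simp only [lieOp]
    exact graphVF_smul r (h [] (by simp))
  | cons f L ih =>
    intro Z hL h
    obtain ⟨hf, hL⟩ := List.forall_mem_cons.1 hL
    simp only [lieOp]
    rw [ih hL (fun L' hL' => h _ (List.forall_mem_cons.2 ⟨hf, hL'⟩)), smul_add]

theorem lieOp_mem (L : List D.GFun) : ∀ {Z : D.Op}, (∀ f ∈ L, IsAffine σ φ f) →
    (∀ L, (∀ f ∈ L, IsAffine σ φ f) → Z L ∈ D.vertSmooth) →
    lieOp σ φ L Z ∈ D.vertSmooth := by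
  induction L with
  | nil =>
    intro Z _ h
    simp only [lieOp]
    exact graphVF_mem (h [] (by simp))
  | cons f L ih =>
    intro Z hL h
    obtain ⟨hf, hL⟩ := List.forall_mem_cons.1 hL
    simp only [lieOp]
    exact Submodule.add_mem _ (h _ (List.forall_mem_cons.2 ⟨hf.neg_graphVF, hL⟩))
      (ih hL (fun L' hL' => h _ (List.forall_mem_cons.2 ⟨hf, hL'⟩)))

/-- `-graphVF σ φ f` is inserted with the degree of `f`, so every term of the Lie derivative
acquires the same sign under the swap. -/
theorem lieOp_symm (L₁ L₂ : List D.GFun) (f g : D.GFun) : ∀ {Z : D.Op}, IsAffineOp σ φ Z →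
    (∀ h ∈ L₁ ++ f :: g :: L₂, IsAffine σ φ h) →
    lieOp σ φ (L₁ ++ f :: g :: L₂) Z =
      sgn ((f.1 - 1) * (g.1 - 1)) • lieOp σ φ (L₁ ++ g :: f :: L₂) Z := by
  induction L₁ with
  | nil =>
    intro Z hZ hL
    simp only [List.nil_append] at hL ⊢
    obtain ⟨hf, hL⟩ := List.forall_mem_cons.1 hL
    obtain ⟨hg, hL⟩ := List.forall_mem_cons.1 hL
    have h1 := hZ.symm [] L₂ (f.1, -graphVF σ φ f.2) g
      (List.forall_mem_cons.2 ⟨hf.neg_graphVF, List.forall_mem_cons.2 ⟨hg, hL⟩⟩)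
    have h2 := hZ.symm [] L₂ f (g.1, -graphVF σ φ g.2)
      (List.forall_mem_cons.2 ⟨hf, List.forall_mem_cons.2 ⟨hg.neg_graphVF, hL⟩⟩)
    have h3 : lieOp σ φ L₂ (fun L' => Z (f :: g :: L')) =
        sgn ((f.1 - 1) * (g.1 - 1)) • lieOp σ φ L₂ (fun L' => Z (g :: f :: L')) := by
      rw [← lieOp_smul L₂ _ hL ((hZ.cons hg).cons hf).mem]
      exact lieOp_congr L₂ hL fun L' hL' => hZ.symm [] L' f g
        (List.forall_mem_cons.2 ⟨hf, List.forall_mem_cons.2 ⟨hg, hL'⟩⟩)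
    simp only [List.nil_append] at h1 h2
    simp only [lieOp]
    rw [h1, h2, h3]
    simp only [smul_add]
    abel
  | cons k L ih =>
    intro Z hZ hL
    obtain ⟨hk, hL⟩ := List.forall_mem_cons.1 hL
    have h1 := hZ.symm ((k.1, -graphVF σ φ k.2) :: L) L₂ f g
      (List.forall_mem_cons.2 ⟨hk.neg_graphVF, hL⟩)
    simp only [List.cons_append] at h1 ⊢
    simp only [lieOp]
    rw [h1, ih (hZ.cons hk) hL, smul_add]

theorem IsAffineOp.lieOp {Z : D.Op} (hZ : IsAffineOp σ φ Z) :
    IsAffineOp σ φ (fun L => lieOp σ φ L Z) where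
  mem L hL := lieOp_mem L hL hZ.mem
  add L hL e f g hf hg := by
    simp only [GradedMfd.lieOp]
    rw [graphVF_add hf.mem_vertSmooth hg.mem_vertSmooth, neg_add,
      hZ.add L hL e _ _ hf.neg_graphVF hg.neg_graphVF,
      lieOp_congr L hL (Z' := fun L' => Z ((e, f) :: L') + Z ((e, g) :: L'))
        (fun L' hL' => hZ.add L' hL' e f g hf hg),
      lieOp_add L hL (hZ.cons hf).mem (hZ.cons hg).mem]
    abel
  smul L hL e f r hf := by
    simp only [GradedMfd.lieOp]
    rw [graphVF_smul r hf.mem_vertSmooth, ← smul_neg,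
      hZ.smul L hL e _ r hf.neg_graphVF,
      lieOp_congr L hL (Z' := fun L' => r • Z ((e, f) :: L'))
        (fun L' hL' => hZ.smul L' hL' e f r hf),
      lieOp_smul L r hL (hZ.cons hf).mem, smul_add]
  symm L₁ L₂ f g hL := lieOp_symm L₁ L₂ f g hZ hL

theorem snAux_zero_right (L : List D.GFun) : ∀ {Z V : D.Op} (d e : ℤ), IsAffineOp σ φ Z →
    (∀ f ∈ L, IsAffine σ φ f) → (∀ L, V L = 0) → snAux D L d e Z V = 0 := by
  induction L with
  | nil =>
    intro Z V d e hZ _ hV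
    simp only [snAux, hV]
    rw [hZ.map_zero (by simp), smul_zero, sub_zero]
  | cons f L ih =>
    intro Z V d e hZ hL hV
    obtain ⟨hf, hL⟩ := List.forall_mem_cons.1 hL
    simp only [snAux]
    rw [ih _ _ hZ hL fun _ => hV _, ih _ _ (hZ.cons hf) hL hV, smul_zero, add_zero]

/-- The bracket of an operation with a function. -/
theorem snAux_function (L : List D.GFun) : ∀ {Z V : D.Op} (d : ℤ) {e : ℤ} {h : D.GFun},
    IsAffineOp σ φ Z → (∀ f ∈ L, IsAffine σ φ f) → e + 1 = h.1 → V [] = h.2 →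
    (∀ f L, V (f :: L) = 0) → snAux D L d e Z V = sgn (e * D.shSum L) • Z (L ++ [h]) := by
  induction L with
  | nil =>
    intro Z V d e h hZ _ he h0 hV
    simp only [snAux, hV, h0, he]
    simp [shSum, sgn_zero]
  | cons f L ih =>
    intro Z V d e h hZ hL he h0 hV
    obtain ⟨hf, hL⟩ := List.forall_mem_cons.1 hL
    simp only [snAux]
    rw [snAux_zero_right L _ _ hZ hL fun _ => hV _ _, ih _ (hZ.cons hf) hL he h0 hV, zero_add,
      smul_smul, ← sgn_add]
    congr 2
    simp only [shSum, List.map_cons, List.sum_cons]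
    ring

/-- For `X` of shifted degree `0` one has `[Z, -X] = [X, Z]`; this is where the minus sign of the
theorem is absorbed. In the recursion `[-X, f]` is the function `-X f`. The sign of bracketing with
it and the sign of moving it from the last place to the first coincide, so they cancel. -/
theorem snAux_inj_neg_deform [T2Space S] [IsManifold (𝓡 m) ∞ S] (L : List D.GFun) :
    ∀ {Z : D.Op} (d : ℤ), IsAffineOp σ φ Z → (∀ f ∈ L, IsAffine σ φ f) →
    snAux D L d 0 Z (inj (-D.deform σ φ)) = lieOp σ φ L Z := by
  induction L with
  | nil =>
    intro Z d hZ _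
    simp only [snAux, lieOp]
    rw [inj_neg_deform_nil, inj_neg_deform_singleton, hZ.map_zero (by simp), mul_zero, sgn_zero]
    simp
  | cons f L ih =>
    intro Z d hZ hL
    obtain ⟨hf, hL⟩ := List.forall_mem_cons.1 hL
    simp only [snAux, lieOp]
    rw [ih _ (hZ.cons hf) hL, zero_mul, sgn_zero, one_smul,
      snAux_function L d (h := (f.1, -graphVF σ φ f.2)) hZ hL (by simp)
        (inj_neg_deform_singleton σ φ f) (fun g L => inj_neg_deform_cons_cons σ φ f g L),
      hZ.append_singleton L hL hf.neg_graphVF, smul_smul]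
    simp only [zero_add]
    rw [sgn_mul_self, one_smul]

/-- `iterBracket` recurses on the first bracket, while Lie derivatives accumulate at the last one.
The degree `d'` need not be known, because `snAux_inj_neg_deform` holds for every degree. -/
theorem iterBracket_append_singleton (l : List (Σ e : ℤ, MultiSec D e))
    (a : Σ e : ℤ, MultiSec D e) :
    ∀ (d : ℤ) (Z : D.Op), ∃ d', D.iterBracket d Z (l ++ [a]) =
      sn D d' a.1 (D.iterBracket d Z l) (inj a.2) := by
  induction l with
  | nil => intro d Z; exact ⟨d, rfl⟩
  | cons b l ih => intro d Z; exact ih _ _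

theorem iterBracket_succ_eq_lieOp [T2Space S] [IsManifold (𝓡 m) ∞ S] {Z : D.Op} (d : ℤ) (k : ℕ)
    (hZ : IsAffineOp σ φ (D.iterBracket d Z (List.replicate k ⟨0, -D.deform σ φ⟩)))
    {L : List D.GFun} (hL : ∀ f ∈ L, IsAffine σ φ f) :
    D.iterBracket d Z (List.replicate (k + 1) ⟨0, -D.deform σ φ⟩) L =
      lieOp σ φ L (D.iterBracket d Z (List.replicate k ⟨0, -D.deform σ φ⟩)) := by
  rw [List.replicate_succ']
  obtain ⟨d', h⟩ := iterBracket_append_singleton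
    (List.replicate k (⟨0, -D.deform σ φ⟩ : Σ e : ℤ, MultiSec D e)) ⟨0, -D.deform σ φ⟩ d Z
  rw [h]
  exact snAux_inj_neg_deform L d' hZ hL

theorem IsAffineOp.iterBracket [T2Space S] [IsManifold (𝓡 m) ∞ S] {Z : D.Op}
    (hZ : IsAffineOp σ φ Z) (d : ℤ) (k : ℕ) :
    IsAffineOp σ φ (D.iterBracket d Z (List.replicate k ⟨0, -D.deform σ φ⟩)) := by
  induction k with
  | zero => exact hZ
  | succ k ih => exact ih.lieOp.congr fun L hL => iterBracket_succ_eq_lieOp d k ih hL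

/-! ## The Maurer-Cartan series as a Taylor series -/

variable (σ φ)

/-- The pull-back of a list of affine functions along the flow of `-graphVF σ φ`. -/
def shift (t : ℝ) (L : List D.GFun) : List D.GFun :=
  L.map fun f => (f.1, f.2 + t • -graphVF σ φ f.2)

variable {σ φ}

theorem IsAffine.shift {L : List D.GFun} (hL : ∀ f ∈ L, IsAffine σ φ f) (t : ℝ) :
    ∀ f ∈ shift σ φ t L, IsAffine σ φ f := by
  intro f hf
  obtain ⟨g, hg, rfl⟩ := List.mem_map.1 hf
  exact IsAffine.add (hL g hg) ((hL g hg).neg_graphVF.smul t)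

/-- This is the rule that the pull-back of `Z` along the flow of `X` has the pull-back of the Lie
derivative as its derivative. The point of evaluation moves along `X` and the arguments move as `f -
t X f`; the product rule over these motions reproduces the terms of `lieOp`. -/
theorem hasDerivAt_rest_shift (L : List D.GFun) (x : S) (c : D.SymA x →ₗ[ℝ] ℝ) (t : ℝ) :
    ∀ {Z : D.Op}, IsAffineOp σ φ Z → (∀ f ∈ L, IsAffine σ φ f) →
    HasDerivAt (fun t : ℝ => c (D.rest x (φ.val x) t (Z (shift σ φ t L) ⟨x, t • σ x⟩)))
      (c (D.rest x (φ.val x) t (lieOp σ φ (shift σ φ t L) Z ⟨x, t • σ x⟩))) t := by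
  induction L with
  | nil =>
    intro Z hZ _
    exact hasDerivAt_rest_graphVF (hZ.mem [] (by simp)) x c t
  | cons f L ih =>
    intro Z hZ hL
    obtain ⟨hf, hL⟩ := List.forall_mem_cons.1 hL
    have h1 := ih (hZ.cons hf) hL
    have h2 := ih (hZ.cons hf.neg_graphVF) hL
    have h3 := h1.add ((hasDerivAt_id t).mul h2)
    have e1 : ∀ t L', (∀ f ∈ L', IsAffine σ φ f) →
        Z ((f.1, f.2 + t • -graphVF σ φ f.2) :: L') =
          Z (f :: L') + t • Z ((f.1, -graphVF σ φ f.2) :: L') := fun t L' hL' => by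
      rw [hZ.add L' hL' f.1 _ _ hf (hf.neg_graphVF.smul t),
        hZ.smul L' hL' f.1 _ t hf.neg_graphVF]
    have e2 : (fun t : ℝ => c (D.rest x (φ.val x) t (Z (shift σ φ t (f :: L)) ⟨x, t • σ x⟩))) =
        fun t : ℝ => c (D.rest x (φ.val x) t (Z (f :: shift σ φ t L) ⟨x, t • σ x⟩)) +
          t * c (D.rest x (φ.val x) t
            (Z ((f.1, -graphVF σ φ f.2) :: shift σ φ t L) ⟨x, t • σ x⟩)) := by
      funext t
      change c (D.rest x (φ.val x) t
        (Z ((f.1, f.2 + t • -graphVF σ φ f.2) :: shift σ φ t L) ⟨x, t • σ x⟩)) = _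
      rw [e1 t _ (IsAffine.shift hL t), Pi.add_apply, Pi.smul_apply, map_add, map_add, map_smul,
        map_smul, smul_eq_mul]
    -- Since `X (X f) = 0`, the velocity `-X f` of the moving argument is also minus `X` of that
    -- argument, as `lieOp` requires.
    have e3 : graphVF σ φ (f.2 + t • -graphVF σ φ f.2) = graphVF σ φ f.2 := by
      rw [graphVF_add hf.mem_vertSmooth (hf.neg_graphVF.smul t).mem_vertSmooth,
        graphVF_smul t hf.neg_graphVF.mem_vertSmooth,
        graphVF_neg (graphVF_mem hf.mem_vertSmooth), hf.2.2]
      simp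
    have hsL := IsAffine.shift hL t
    have e4 : lieOp σ φ (shift σ φ t (f :: L)) Z =
        Z ((f.1, -graphVF σ φ f.2) :: shift σ φ t L) +
          (lieOp σ φ (shift σ φ t L) (fun L' => Z (f :: L')) +
            t • lieOp σ φ (shift σ φ t L) (fun L' => Z ((f.1, -graphVF σ φ f.2) :: L'))) := by
      change Z ((f.1, -graphVF σ φ (f.2 + t • -graphVF σ φ f.2)) :: shift σ φ t L) +
        lieOp σ φ (shift σ φ t L) (fun L' => Z ((f.1, f.2 + t • -graphVF σ φ f.2) :: L')) = _
      rw [e3, lieOp_congr _ hsL (e1 t),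
        lieOp_add _ hsL (hZ.cons hf).mem
          (fun L' hL' => Submodule.smul_mem _ _ ((hZ.cons hf.neg_graphVF).mem L' hL')),
        lieOp_smul _ t hsL (hZ.cons hf.neg_graphVF).mem]
    rw [e2, e4]
    refine h3.congr_deriv ?_
    simp only [Pi.add_apply, Pi.smul_apply, map_add, map_smul, smul_eq_mul, id, one_mul]
    ring

end Affine

end GradedMfd

end Graded

section Graded

variable {m : ℕ} {S : Type u} [TopologicalSpace S] [ChartedSpace (EuclideanSpace ℝ (Fin m)) S]

namespace GradedMfd

variable {D : GradedMfd.{u, v} m S}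

/-! ## Spaces of functions -/

theorem funSpan_mono {coef coef' : Set (D.Base → ℝ)} {lab lab' : Set (Idx D.ι)}
    (hc : coef ⊆ coef') (hl : lab ⊆ lab') (d : ℤ) :
    D.funSpan coef lab d ≤ D.funSpan coef' lab' d := by
  refine Submodule.span_mono ?_
  rintro f ⟨c, hc', L, hL, hd, rfl⟩
  exact ⟨c, hc hc', L, fun s hs => hl (hL s hs), hd, rfl⟩

theorem smoothFun₀_le_smoothFun (d : ℤ) : D.smoothFun₀ d ≤ D.smoothFun d :=
  funSpan_mono subset_rfl (Set.subset_univ _) d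

theorem polyFun₀_le_smoothFun₀ (d : ℤ) : D.polyFun₀ d ≤ D.smoothFun₀ d := by
  refine funSpan_mono ?_ subset_rfl d
  rintro c ⟨g, hg, M, rfl⟩
  change D.N.IsSmoothFun _
  have h1 := D.N.isSmoothFun_comp_proj hg
  have h2 : D.N.IsSmoothFun (fun p => (M.map (fun l => l.val p.1 p.2)).prod) := by
    induction M with
    | nil => exact contMDiff_const
    | cons l M ih =>
      have h3 := l.smooth
      simp only [List.map_cons, List.prod_cons]
      unfold SmoothVB.IsSmoothFun at *
      exact h3.mul ih
  unfold SmoothVB.IsSmoothFun at *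
  exact h1.mul h2

theorem mul_mem_smoothFun {d e : ℤ} {f g : D.Amb} (hf : f ∈ D.smoothFun d)
    (hg : g ∈ D.smoothFun e) : f * g ∈ D.smoothFun (d + e) := by
  refine Submodule.span_induction₂ (p := fun f g _ _ => f * g ∈ D.smoothFun (d + e))
    ?_ ?_ ?_ ?_ ?_ ?_ ?_ hf hg
  · rintro _ _ ⟨c, hc, L, -, rfl, rfl⟩ ⟨c', hc', L', -, rfl, rfl⟩
    refine Submodule.subset_span ⟨fun p => c p * c' p, ?_, L ++ L', fun _ _ => trivial, by simp,
      ?_⟩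
    · change D.N.IsSmoothFun _ at hc hc' ⊢
      unfold SmoothVB.IsSmoothFun at *
      exact hc.mul hc'
    · funext p
      simp only [Pi.mul_apply, List.map_append, List.prod_append]
      rw [smul_mul_smul_comm]
  · intro g _
    rw [zero_mul]
    exact Submodule.zero_mem _
  · intro g _
    rw [mul_zero]
    exact Submodule.zero_mem _
  · intro f f' g _ _ _ h h'
    rw [add_mul]
    exact Submodule.add_mem _ h h'
  · intro f g g' _ _ _ h h'
    rw [mul_add]
    exact Submodule.add_mem _ h h'
  · intro r f g _ _ h
    rw [smul_mul_assoc]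
    exact Submodule.smul_mem _ r h
  · intro r f g _ _ h
    rw [mul_smul_comm]
    exact Submodule.smul_mem _ r h

/-- A function on the base as a function on `ℰ`. -/
def baseFun (c : D.Base → ℝ) : D.Amb := fun p => algebraMap ℝ _ (c p)

theorem baseFun_mem {c : D.Base → ℝ} (hc : D.N.IsSmoothFun c) : baseFun c ∈ D.smoothFun 0 :=
  Submodule.subset_span ⟨c, hc, [], fun _ _ => trivial, rfl, by
    funext p
    simp [baseFun, Algebra.algebraMap_eq_smul_one]⟩

theorem baseFun_mul (c c' : D.Base → ℝ) :
    (baseFun (fun p => c p * c' p) : D.Amb) = baseFun c * baseFun c' := by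
  funext p
  simp [baseFun]

/-- A section of `𝒜*` as a function on `ℰ`. -/
def xiFun (α : DualSec D.A) : D.Amb := fun p => D.xi p.1 (α.val p.1)

/-- A section of `ℬ*` as a function on `ℰ`. -/
def etaFun (β : DualSec D.B) : D.Amb := fun p => D.eta p.1 (β.val p.1)

theorem smooth_one_base : D.N.IsSmoothFun (fun _ => (1 : ℝ)) := contMDiff_const

theorem poly_one_base : ∃ g : S → ℝ, ContMDiff (𝓡 m) 𝓘(ℝ, ℝ) ∞ g ∧ ∃ M : List (DualSec D.N),
    (fun _ : D.Base => (1 : ℝ)) = fun p => g p.1 * (M.map (fun l => l.val p.1 p.2)).prod :=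
  ⟨fun _ => 1, contMDiff_const, [], by simp⟩

theorem xiFun_mem (α : DualSec D.A) : xiFun α ∈ D.polyFun₀ D.k :=
  Submodule.subset_span ⟨fun _ => 1, poly_one_base, [⟨Idx.A, α⟩], by simp,
    by simp [wt], by
      funext p
      simp only [List.map_cons, List.map_nil, List.prod_singleton, one_smul]
      rfl⟩

theorem etaFun_mem (β : DualSec D.B) : etaFun β ∈ D.polyFun₀ D.k :=
  Submodule.subset_span ⟨fun _ => 1, poly_one_base, [⟨Idx.B, β⟩], by simp,
    by simp [wt], by
      funext p
      simp only [List.map_cons, List.map_nil, List.prod_singleton, one_smul]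
      rfl⟩

theorem baseFun_linear_mem (l : DualSec D.N) :
    baseFun (fun p => l.val p.1 p.2) ∈ D.polyFun₀ 0 :=
  Submodule.subset_span ⟨_, ⟨fun _ => 1, contMDiff_const, [l], rfl⟩, [], by simp, rfl, by
    funext p
    simp [baseFun, Algebra.algebraMap_eq_smul_one]⟩

theorem baseFun_comp_proj_mem {g : S → ℝ} (hg : ContMDiff (𝓡 m) 𝓘(ℝ, ℝ) ∞ g) :
    baseFun (fun p => g p.1) ∈ D.polyFun₀ 0 :=
  Submodule.subset_span ⟨_, ⟨g, hg, [], rfl⟩, [], by simp, rfl, by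
    funext p
    simp [baseFun, Algebra.algebraMap_eq_smul_one]⟩

theorem polyFun₀_le_vertSmooth (d : ℤ) : D.polyFun₀ d ≤ D.vertSmooth :=
  ((polyFun₀_le_smoothFun₀ d).trans (smoothFun₀_le_smoothFun d)).trans (D.smoothFun_le_vertSmooth d)

/-! ## The fibrewise linear functions -/

section linFun

variable {σ : D.N.Sec} {φ : BundleHom D.A D.B}

theorem hasFibreDeriv_const {x : S} (s : D.Sym x) (y n : D.N.Fib x) :
    D.HasFibreDeriv (fun _ => s) y n 0 := fun c => by
  rw [map_zero]
  exact hasDerivAt_const _ _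

theorem graphVF_xiFun (α : DualSec D.A) : graphVF σ φ (xiFun α) = 0 := by
  funext ⟨x, y⟩
  have h : D.HasFibreDeriv (fun y => xiFun α ⟨x, y⟩) y (σ x) 0 :=
    hasFibreDeriv_const (D.xi x (α.val x)) y (σ x)
  rw [graphVF_eq (polyFun₀_le_vertSmooth _ (xiFun_mem α)) h, zero_add]
  exact D.phiDeriv_xi x _ _

theorem graphVF_etaFun (β : DualSec D.B) : graphVF σ φ (etaFun β) = xiFun (φ.pull β) := by
  funext ⟨x, y⟩
  have h : D.HasFibreDeriv (fun y => etaFun β ⟨x, y⟩) y (σ x) 0 :=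
    hasFibreDeriv_const (D.eta x (β.val x)) y (σ x)
  rw [graphVF_eq (polyFun₀_le_vertSmooth _ (etaFun_mem β)) h, zero_add]
  exact D.phiDeriv_eta x _ _

theorem graphVF_baseFun_comp_proj {g : S → ℝ} (hg : ContMDiff (𝓡 m) 𝓘(ℝ, ℝ) ∞ g) :
    graphVF σ φ (baseFun (D := D) fun p => g p.1) = 0 := by
  funext ⟨x, y⟩
  have h : D.HasFibreDeriv (fun y => baseFun (D := D) (fun p => g p.1) ⟨x, y⟩) y (σ x) 0 :=
    hasFibreDeriv_const (algebraMap ℝ _ (g x)) y (σ x)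
  rw [graphVF_eq (polyFun₀_le_vertSmooth _ (baseFun_comp_proj_mem hg)) h, zero_add]
  exact D.phiDeriv_algebraMap x _ _

theorem graphVF_baseFun_linear (l : DualSec D.N) :
    graphVF σ φ (baseFun fun p => l.val p.1 p.2) = baseFun fun p => l.val p.1 (σ p.1) := by
  funext ⟨x, y⟩
  have h : D.HasFibreDeriv (fun y => baseFun (D := D) (fun p => l.val p.1 p.2) ⟨x, y⟩) y (σ x)
      (algebraMap ℝ _ (l.val x (σ x))) := fun c => by
    have h1 : ∀ r : ℝ, c (algebraMap ℝ _ r) = r * c 1 := fun r => by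
      rw [Algebra.algebraMap_eq_smul_one, map_smul, smul_eq_mul]
    simp only [baseFun, h1, map_add, map_smul, smul_eq_mul]
    have h2 := (((hasDerivAt_id (0 : ℝ)).mul_const (l.val x (σ x))).const_add
      (l.val x y)).mul_const (c 1)
    simp only [← add_mul]
    simpa using h2
  rw [graphVF_eq (polyFun₀_le_vertSmooth _ (baseFun_linear_mem l)) h]
  have h2 : D.phiDeriv x (φ.val x) (baseFun (D := D) (fun p => l.val p.1 p.2) ⟨x, y⟩) = 0 :=
    D.phiDeriv_algebraMap x _ _
  rw [h2, add_zero]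
  rfl

theorem linFun_inl (l : DualSec D.N) :
    D.linFun (.inl l) = (0, baseFun fun p => l.val p.1 p.2) := rfl

theorem linFun_inr (β : DualSec D.B) : D.linFun (.inr β) = ((D.k : ℤ), etaFun β) := rfl

variable (σ φ)

/-- Affine functions that are polynomial along `p^!NS`. -/
def IsPolyAffine (f : D.GFun) : Prop :=
  IsAffine σ φ f ∧ f.2 ∈ D.polyFun₀ f.1 ∧ graphVF σ φ f.2 ∈ D.polyFun₀ f.1

/-- `X` sends the coordinates `y` to components of `σ`, which depend on the point of `S` only, and
`η` to `φ*η`, which is linear in `ξ`. It kills both, so its square vanishes on coordinates. -/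
theorem isPolyAffine_linFun (l : D.Lin) : IsPolyAffine σ φ (D.linFun l) := by
  have hle : ∀ d, D.polyFun₀ d ≤ D.smoothFun d := fun d =>
    (polyFun₀_le_smoothFun₀ d).trans (smoothFun₀_le_smoothFun d)
  suffices h : (D.linFun l).2 ∈ D.polyFun₀ (D.linFun l).1 ∧
      graphVF σ φ (D.linFun l).2 ∈ D.polyFun₀ (D.linFun l).1 ∧
      graphVF σ φ (graphVF σ φ (D.linFun l).2) = 0 from
    ⟨⟨hle _ h.1, hle _ h.2.1, h.2.2⟩, h.1, h.2.1⟩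
  rcases l with l | β
  · have hg : ContMDiff (𝓡 m) 𝓘(ℝ, ℝ) ∞ (fun x => l.val x (σ x)) :=
      D.N.isSmoothFun_comp_sec l.smooth σ
    rw [linFun_inl]
    refine ⟨baseFun_linear_mem l, ?_, ?_⟩
    · simp only [graphVF_baseFun_linear]
      exact baseFun_comp_proj_mem (g := fun x => l.val x (σ x)) hg
    · simp only [graphVF_baseFun_linear]
      exact graphVF_baseFun_comp_proj (g := fun x => l.val x (σ x)) hg
  · rw [linFun_inr]
    refine ⟨etaFun_mem β, ?_, ?_⟩
    · simp only [graphVF_etaFun]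
      exact xiFun_mem _
    · simp only [graphVF_etaFun]
      exact graphVF_xiFun _

variable {σ φ}

theorem IsPolyAffine.neg_graphVF {f : D.GFun} (hf : IsPolyAffine σ φ f) :
    IsPolyAffine σ φ (f.1, -graphVF σ φ f.2) := by
  refine ⟨hf.1.neg_graphVF, Submodule.neg_mem _ hf.2.2, ?_⟩
  change graphVF σ φ (-graphVF σ φ f.2) ∈ _
  rw [graphVF_neg (graphVF_mem hf.1.mem_vertSmooth), hf.1.2.2, neg_zero]
  exact Submodule.zero_mem _

/-- Expanding in the arguments gives a polynomial in `t` whose coefficients are restrictions of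
values of `Z` on polynomial functions that do not depend on `t`; each of these is entire by
analyticity. -/
theorem isEntire_rest_shift (L : List D.GFun) (x : S) (c : D.SymA x →ₗ[ℝ] ℝ) :
    ∀ {Z : D.Op}, IsAffineOp σ φ Z →
    (∀ L, (∀ f ∈ L, IsPolyAffine σ φ f) → D.IsAnalyticFun (Z L)) →
    (∀ f ∈ L, IsPolyAffine σ φ f) →
    IsEntire (fun t : ℝ => c (D.rest x (φ.val x) t (Z (shift σ φ t L) ⟨x, t • σ x⟩))) := by
  induction L with
  | nil =>
    intro Z hZ hA _
    exact isEntire_rest (hZ.mem [] (by simp)) (hA [] (by simp)) x (σ x) (φ.val x) c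
  | cons f L ih =>
    intro Z hZ hA hL
    obtain ⟨hf, hL⟩ := List.forall_mem_cons.1 hL
    have h1 := ih (hZ.cons hf.1) (fun L' hL' => hA _ (List.forall_mem_cons.2 ⟨hf, hL'⟩)) hL
    have h2 := ih (hZ.cons hf.1.neg_graphVF)
      (fun L' hL' => hA _ (List.forall_mem_cons.2 ⟨hf.neg_graphVF, hL'⟩)) hL
    have e2 : (fun t : ℝ => c (D.rest x (φ.val x) t (Z (shift σ φ t (f :: L)) ⟨x, t • σ x⟩))) =
        fun t : ℝ => c (D.rest x (φ.val x) t (Z (f :: shift σ φ t L) ⟨x, t • σ x⟩)) +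
          t * c (D.rest x (φ.val x) t
            (Z ((f.1, -graphVF σ φ f.2) :: shift σ φ t L) ⟨x, t • σ x⟩)) := by
      funext t
      have hL' := IsAffine.shift (fun f hf => (hL f hf).1) t
      change c (D.rest x (φ.val x) t
        (Z ((f.1, f.2 + t • -graphVF σ φ f.2) :: shift σ φ t L) ⟨x, t • σ x⟩)) = _
      rw [hZ.add _ hL' f.1 _ _ hf.1 (hf.1.neg_graphVF.smul t),
        hZ.smul _ hL' f.1 _ t hf.1.neg_graphVF, Pi.add_apply, Pi.smul_apply, map_add, map_add,
        map_smul, map_smul, smul_eq_mul]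
    rw [e2]
    exact h1.add h2.id_mul

theorem _root_.BlendedQ.BlendedHVF.isAffineOp (Q : BlendedHVF D) : IsAffineOp σ φ Q.op := by
  have h1 := Q.pos.isAffineOp (σ := σ) (φ := φ)
  have h2 := Q.neg.isAffineOp (σ := σ) (φ := φ)
  refine ⟨fun L hL => Submodule.add_mem _ (h1.mem L hL) (h2.mem L hL), ?_, ?_, ?_⟩
  · intro L hL e f g hf hg
    simp only [BlendedHVF.op, h1.add L hL e f g hf hg, h2.add L hL e f g hf hg]
    abel
  · intro L hL e f r hf
    simp only [BlendedHVF.op, h1.smul L hL e f r hf, h2.smul L hL e f r hf, smul_add]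
  · intro L₁ L₂ f g hL
    simp only [BlendedHVF.op, smul_add]
    rw [h1.symm L₁ L₂ f g hL, h2.symm L₁ L₂ f g hL]

theorem shift_zero (L : List D.GFun) : shift σ φ 0 L = L := by
  simp [shift]

/-- The Maurer-Cartan series of `-(σ, φ)` converges, its sum being the restriction to the graph of
`(σ, φ)` of the values of `Q` on functions that vanish on the graph. -/
theorem hasSum_maurerCartan [T2Space S] [IsManifold (𝓡 m) ∞ S] (Q : BlendedHVF D)
    (hQ : D.IsAnalytic Q.op) (L : List D.Lin) (x : S) (c : D.SymA x →ₗ[ℝ] ℝ) :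
    HasSum (fun k : ℕ => c (Q.mPos (List.replicate k ⟨0, -D.deform σ φ⟩) L x +
        Q.mNeg (List.replicate k ⟨0, -D.deform σ φ⟩) L x) / (k.factorial : ℝ))
      (c (D.rest x (φ.val x) 1 (Q.op (shift σ φ 1 (L.map D.linFun)) ⟨x, σ x⟩))) := by
  have hL : ∀ f ∈ L.map D.linFun, IsPolyAffine σ φ f := by
    intro f hf
    obtain ⟨l, -, rfl⟩ := List.mem_map.1 hf
    exact isPolyAffine_linFun σ φ l
  have hL' : ∀ f ∈ L.map D.linFun, IsAffine σ φ f := fun f hf => (hL f hf).1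
  let Z : ℕ → D.Op := fun k => D.iterBracket 1 Q.pos.op (List.replicate k ⟨0, -D.deform σ φ⟩)
  let Z' : ℕ → D.Op := fun k => D.iterBracket (-1) Q.neg.op (List.replicate k ⟨0, -D.deform σ φ⟩)
  -- `G Z k` follows the `k`-fold bracket along the graphs of `t(σ, φ)`; its derivative is `G Z (k +
  -- 1)`.
  let G : (ℕ → D.Op) → ℕ → ℝ → ℝ := fun Z k t =>
    c (D.rest x (φ.val x) t (Z k (shift σ φ t (L.map D.linFun)) ⟨x, t • σ x⟩))
  have hZ : ∀ k, IsAffineOp σ φ (Z k) := fun k => Q.pos.isAffineOp.iterBracket 1 k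
  have hZ' : ∀ k, IsAffineOp σ φ (Z' k) := fun k => Q.neg.isAffineOp.iterBracket (-1) k
  have hG : ∀ k t, HasDerivAt (G Z k) (G Z (k + 1) t) t := fun k t => by
    have h := hasDerivAt_rest_shift (L.map D.linFun) x c t (hZ k) hL'
    rwa [← iterBracket_succ_eq_lieOp 1 k (hZ k) (IsAffine.shift hL' t)] at h
  have hG' : ∀ k t, HasDerivAt (G Z' k) (G Z' (k + 1) t) t := fun k t => by
    have h := hasDerivAt_rest_shift (L.map D.linFun) x c t (hZ' k) hL'
    rwa [← iterBracket_succ_eq_lieOp (-1) k (hZ' k) (IsAffine.shift hL' t)] at h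
  -- The contributions of `Q⁺` and `Q⁻` are added before summing the series, since analyticity is
  -- assumed of `Q` and not of its two parts.
  have h1 := iteratedDeriv_eq_of_hasDerivAt (g := fun k t => G Z k t + G Z' k t)
    (fun k t => (hG k t).add (hG' k t))
  have h2 := isEntire_rest_shift (L.map D.linFun) x c (Q.isAffineOp (σ := σ) (φ := φ))
    (fun L hL => hQ L fun f hf => (hL f hf).2.1) hL
  have h3 : (fun t : ℝ => c (D.rest x (φ.val x) t
      (Q.op (shift σ φ t (L.map D.linFun)) ⟨x, t • σ x⟩))) = fun t => G Z 0 t + G Z' 0 t := by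
    funext t
    simp only [BlendedHVF.op, Pi.add_apply, map_add]
    rfl
  have h4 := h2.hasSum_iteratedDeriv 1
  rw [h3] at h4
  simp only [h1, one_pow, mul_one] at h4
  -- At `t = 0` the arguments are unshifted and the restriction is the one to `𝒜`, so the Taylor
  -- coefficients are values of `P`.
  have h6 : ∀ (Z : ℕ → D.Op) k, G Z k 0 = c (D.P (Z k) L x) := by
    intro Z k
    simp only [G, shift_zero, rest_zero]
    rw [zero_smul]
    rfl
  rw [one_smul] at h4
  simp only [h6, ← map_add] at h4
  exact h4

theorem isMaurerCartan_iff [T2Space S] [IsManifold (𝓡 m) ∞ S] (Q : BlendedHVF D)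
    (hQ : D.IsAnalytic Q.op) : Q.IsMaurerCartan (-D.deform σ φ) ↔
      ∀ (L : List D.Lin) (x : S),
        D.rest x (φ.val x) 1 (Q.op (shift σ φ 1 (L.map D.linFun)) ⟨x, σ x⟩) = 0 := by
  constructor
  · intro h L x
    refine eq_of_forall_functional fun c => ?_
    rw [map_zero]
    exact (hasSum_maurerCartan Q hQ L x c).unique (h L x c)
  · intro h L x c
    have := hasSum_maurerCartan (σ := σ) (φ := φ) Q hQ L x c
    rwa [h L x, map_zero] at this

end linFun

end GradedMfd

end Graded

section Graded

variable {m : ℕ} {S : Type u} [TopologicalSpace S] [ChartedSpace (EuclideanSpace ℝ (Fin m)) S]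

namespace GradedMfd

variable {D : GradedMfd.{u, v} m S} (σ : D.N.Sec) (φ : BundleHom D.A D.B)

/-! ## Derivations along the graph -/

/-- The restriction of a function to the graph of `(σ, φ)`. -/
def graphRest (x : S) (f : D.Amb) : D.SymA x := D.rest x (φ.val x) 1 (f ⟨x, σ x⟩)

theorem vanishes_graph_iff (f : D.Amb) :
    (D.graph σ φ).Vanishes f ↔ ∀ x, graphRest σ φ x f = 0 := by
  constructor
  · intro h x
    exact (D.toSub_graph_eq_zero_iff x (φ.val x) _).1 (h ⟨x, σ x⟩ ⟨x, rfl⟩)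
  · rintro h _ ⟨x, rfl⟩
    exact (D.toSub_graph_eq_zero_iff x (φ.val x) _).2 (h x)

/-- The pull-back of a function along the retraction of `ℰ` onto the graph of `(σ, φ)`. -/
def retract (f : D.Amb) : D.Amb := fun p => D.fromA p.1 (graphRest σ φ p.1 f)

theorem retract_add (f g : D.Amb) : retract σ φ (f + g) = retract σ φ f + retract σ φ g := by
  funext p
  simp [retract, graphRest]

theorem retract_smul (r : ℝ) (f : D.Amb) : retract σ φ (r • f) = r • retract σ φ f := by
  funext p
  simp [retract, graphRest]

theorem retract_zero : retract σ φ (0 : D.Amb) = 0 := by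
  funext p
  simp [retract, graphRest]

theorem retract_mul (f g : D.Amb) : retract σ φ (f * g) = retract σ φ f * retract σ φ g := by
  funext p
  simp [retract, graphRest]

theorem retract_baseFun (c : D.Base → ℝ) :
    retract σ φ (baseFun c) = baseFun fun p => c ⟨p.1, σ p.1⟩ := by
  funext p
  simp [retract, graphRest, baseFun]

theorem retract_xiFun (α : DualSec D.A) : retract σ φ (xiFun α) = xiFun α := by
  funext p
  change D.fromA p.1 (D.rest p.1 (φ.val p.1) 1 (D.xi p.1 (α.val p.1))) = D.xi p.1 (α.val p.1)
  rw [rest_xi, fromA_gen1]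

theorem retract_etaFun (β : DualSec D.B) : retract σ φ (etaFun β) = xiFun (φ.pull β) := by
  funext p
  change D.fromA p.1 (D.rest p.1 (φ.val p.1) 1 (D.eta p.1 (β.val p.1))) = _
  rw [rest_eta, one_smul, fromA_gen1]
  rfl

theorem rest_fromA (x : S) (ψ : D.A.Fib x →ₗ[ℝ] D.B.Fib x) (t : ℝ) (s : D.SymA x) :
    D.rest x ψ t (D.fromA x s) = s := by
  have : (D.rest x ψ t).comp (D.fromA x) = AlgHom.id ℝ _ := by
    refine GSym.algHom_ext _ fun j v => ?_
    change D.rest x ψ t (D.fromA x (gen1 D.k _ v)) = gen1 D.k _ v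
    rw [fromA_gen1, rest_xi]
  exact DFunLike.congr_fun this s

theorem graphRest_retract (x : S) (f : D.Amb) :
    graphRest σ φ x (retract σ φ f) = graphRest σ φ x f :=
  rest_fromA x _ _ _

theorem graphRest_baseFun (x : S) (c : D.Base → ℝ) :
    graphRest σ φ x (baseFun c) = algebraMap ℝ _ (c ⟨x, σ x⟩) := by
  simp [graphRest, baseFun]

/-- Graded derivations of `C^∞(ℰ)` along the restriction to the graph of `(σ, φ)` at a point, up
to signs that depend on the degrees only. -/
structure IsGraphDerivation (x : S) (Θ : ℤ → D.Amb → D.SymA x) : Prop where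
  add : ∀ e, ∀ f ∈ D.smoothFun e, ∀ g ∈ D.smoothFun e, Θ e (f + g) = Θ e f + Θ e g
  smul : ∀ e, ∀ f ∈ D.smoothFun e, ∀ r : ℝ, Θ e (r • f) = r • Θ e f
  leibniz : ∀ e e', ∃ ε ε' : ℝ, ε' ≠ 0 ∧ ∀ f ∈ D.smoothFun e, ∀ g ∈ D.smoothFun e',
    Θ (e + e') (f * g) = ε • (Θ e f * graphRest σ φ x g) + ε' • (graphRest σ φ x f * Θ e' g)

namespace IsGraphDerivation

variable {σ φ} {x : S} {Θ : ℤ → D.Amb → D.SymA x}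

theorem map_zero (hΘ : IsGraphDerivation σ φ x Θ) (e : ℤ) : Θ e 0 = 0 := by
  simpa using hΘ.smul e 0 (Submodule.zero_mem _) 0

theorem map_sum (hΘ : IsGraphDerivation σ φ x Θ) (e : ℤ) {ι : Type*} (s : Finset ι)
    {f : ι → D.Amb} (hf : ∀ i ∈ s, f i ∈ D.smoothFun e) :
    Θ e (∑ i ∈ s, f i) = ∑ i ∈ s, Θ e (f i) := by
  classical
  induction s using Finset.induction_on with
  | empty => simpa using hΘ.map_zero e
  | insert i s hi ih =>
    have h1 : ∀ j ∈ s, f j ∈ D.smoothFun e := fun j hj => hf j (by simp [hj])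
    rw [Finset.sum_insert hi, Finset.sum_insert hi,
      hΘ.add e _ (hf i (by simp)) _ (Submodule.sum_mem _ h1), ih h1]

theorem sub (hΘ : IsGraphDerivation σ φ x Θ) {e : ℤ} {f g : D.Amb} (hf : f ∈ D.smoothFun e)
    (hg : g ∈ D.smoothFun e) : Θ e (f - g) = Θ e f - Θ e g := by
  have h := hΘ.smul e g hg (-1)
  rw [neg_one_smul, neg_one_smul] at h
  rw [sub_eq_add_neg, hΘ.add e f hf (-g) (Submodule.neg_mem _ hg), h, sub_eq_add_neg]

/-- The retraction is multiplicative and does not change restrictions to the graph, so both sides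
have the same Leibniz expansion. -/
theorem retract_mul_eq (hΘ : IsGraphDerivation σ φ x Θ) {e e' : ℤ} {f g : D.Amb}
    (hf : f ∈ D.smoothFun e) (hg : g ∈ D.smoothFun e')
    (hf' : retract σ φ f ∈ D.smoothFun e) (hg' : retract σ φ g ∈ D.smoothFun e')
    (hfe : Θ e (retract σ φ f) = Θ e f) (hge : Θ e' (retract σ φ g) = Θ e' g) :
    Θ (e + e') (retract σ φ (f * g)) = Θ (e + e') (f * g) := by
  obtain ⟨ε, ε', -, h⟩ := hΘ.leibniz e e'
  rw [retract_mul, h _ hf' _ hg', h _ hf _ hg, graphRest_retract, graphRest_retract, hfe, hge]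

/-- A derivation along the graph that kills the fibrewise affine functions on `NS` that vanish on
the graph of `σ` kills all functions on `NS` that do. -/
theorem baseFun_retract [T2Space S] [IsManifold (𝓡 m) ∞ S] (hΘ : IsGraphDerivation σ φ x Θ)
    (hl : ∀ l : DualSec D.N, Θ 0 (baseFun fun p => l.val p.1 p.2 - l.val p.1 (σ p.1)) = 0)
    {c : D.Base → ℝ} (hc : D.N.IsSmoothFun c) :
    Θ 0 (retract σ φ (baseFun c)) = Θ 0 (baseFun c) := by
  obtain ⟨χ, hχ, h1, n, g, l, hg, hgl⟩ := D.N.exists_hadamard hc σ x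
  have hcσ : D.N.IsSmoothFun (fun p => c ⟨p.1, σ p.1⟩) :=
    D.N.isSmoothFun_comp_proj (D.N.isSmoothFun_comp_sec hc σ)
  have hχ' := D.N.isSmoothFun_comp_proj hχ
  have hz : ∀ l : DualSec D.N,
      D.N.IsSmoothFun (fun p => l.val p.1 p.2 - l.val p.1 (σ p.1)) := fun l => by
    have h2 := l.smooth
    have h3 : D.N.IsSmoothFun (fun p => l.val p.1 (σ p.1)) :=
      D.N.isSmoothFun_comp_proj (g := fun x => l.val x (σ x)) (D.N.isSmoothFun_comp_sec h2 σ)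
    unfold SmoothVB.IsSmoothFun at *
    exact h2.sub h3
  have hu : D.N.IsSmoothFun (fun p => c p - c ⟨p.1, σ p.1⟩) := by
    unfold SmoothVB.IsSmoothFun at *
    exact hc.sub hcσ
  obtain ⟨ε, ε', hε', hL⟩ := hΘ.leibniz 0 0
  rw [add_zero] at hL
  -- By Hadamard's lemma this product is `∑ g_j z_j`, where the `z_j` vanish on the graph and are
  -- killed by `Θ`; hence both Leibniz terms vanish.
  have h2 : Θ 0 (baseFun (fun p => χ p.1) * baseFun fun p => c p - c ⟨p.1, σ p.1⟩) = 0 := by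
    have e : (baseFun (fun p => χ p.1) * baseFun fun p => c p - c ⟨p.1, σ p.1⟩ : D.Amb) =
        ∑ j, baseFun (g j) * baseFun fun p => (l j).val p.1 p.2 - (l j).val p.1 (σ p.1) := by
      rw [← baseFun_mul]
      funext p
      simp only [Finset.sum_apply, ← baseFun_mul]
      simp only [baseFun, hgl, _root_.map_sum]
    rw [e, hΘ.map_sum 0 Finset.univ]
    · refine Finset.sum_eq_zero fun j _ => ?_
      rw [hL _ (baseFun_mem (hg j)) _ (baseFun_mem (hz (l j))), hl, graphRest_baseFun]
      simp
    · intro j _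
      simpa using mul_mem_smoothFun (baseFun_mem (hg j)) (baseFun_mem (hz (l j)))
  -- Expanding the same product the other way, `c - c ∘ σ` vanishes on the graph and `χ x = 1`, so
  -- `ε'` times `Θ` of `c - c ∘ σ` remains. As `ε' ≠ 0`, the cut-off has been removed.
  rw [hL _ (baseFun_mem hχ') _ (baseFun_mem hu), graphRest_baseFun, graphRest_baseFun] at h2
  simp only [sub_self, _root_.map_zero, mul_zero, smul_zero, zero_add, h1, map_one, one_mul,
    smul_eq_zero, hε', false_or] at h2
  have e : (baseFun (fun p => c p - c ⟨p.1, σ p.1⟩) : D.Amb) =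
      baseFun c - baseFun fun p => c ⟨p.1, σ p.1⟩ := by
    funext p
    simp [baseFun]
  rw [e, hΘ.sub (baseFun_mem hc) (baseFun_mem hcσ), sub_eq_zero] at h2
  rw [retract_baseFun, h2]

/-- The memberships are carried along in the induction because the Leibniz rule for `Θ` is available
only on smooth functions. The hypothesis `h1` is the case of the empty product. -/
theorem prod_retract (hΘ : IsGraphDerivation σ φ x Θ)
    (hη : ∀ β : DualSec D.B, Θ D.k (etaFun β - xiFun (φ.pull β)) = 0)
    (h1 : Θ 0 (retract σ φ (baseFun fun _ => 1)) = Θ 0 (baseFun fun _ => 1))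
    (L : List (Σ j : Idx D.ι, DualSec (D.bdl j))) (hL : ∀ s ∈ L, s.1 ∈ ({.A, .B} : Set (Idx D.ι))) :
    (fun p => (L.map (fun s => GSym.gen D.wt s.1 (s.2.val p.1))).prod : D.Amb) ∈
        D.smoothFun (L.map (fun s => (D.wt s.1 : ℤ))).sum ∧
      retract σ φ (fun p => (L.map (fun s => GSym.gen D.wt s.1 (s.2.val p.1))).prod) ∈
        D.smoothFun (L.map (fun s => (D.wt s.1 : ℤ))).sum ∧
      Θ (L.map (fun s => (D.wt s.1 : ℤ))).sum
          (retract σ φ (fun p => (L.map (fun s => GSym.gen D.wt s.1 (s.2.val p.1))).prod)) =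
        Θ (L.map (fun s => (D.wt s.1 : ℤ))).sum
          (fun p => (L.map (fun s => GSym.gen D.wt s.1 (s.2.val p.1))).prod) := by
  have hle : ∀ d, D.polyFun₀ d ≤ D.smoothFun d := fun d =>
    (polyFun₀_le_smoothFun₀ d).trans (smoothFun₀_le_smoothFun d)
  have hA : ∀ α : DualSec D.A, xiFun α ∈ D.smoothFun D.k ∧
      retract σ φ (xiFun α) ∈ D.smoothFun D.k ∧
      Θ D.k (retract σ φ (xiFun α)) = Θ D.k (xiFun α) := fun α => by
    rw [retract_xiFun]
    exact ⟨hle _ (xiFun_mem _), hle _ (xiFun_mem _), rfl⟩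
  have hB : ∀ β : DualSec D.B, etaFun β ∈ D.smoothFun D.k ∧
      retract σ φ (etaFun β) ∈ D.smoothFun D.k ∧
      Θ D.k (retract σ φ (etaFun β)) = Θ D.k (etaFun β) := fun β => by
    rw [retract_etaFun]
    refine ⟨hle _ (etaFun_mem _), hle _ (xiFun_mem _), ?_⟩
    have := hη β
    rw [hΘ.sub (hle _ (etaFun_mem _)) (hle _ (xiFun_mem _)), sub_eq_zero] at this
    exact this.symm
  induction L with
  | nil =>
    have e : (fun p => ([].map (fun s : Σ j : Idx D.ι, DualSec (D.bdl j) =>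
        GSym.gen D.wt s.1 (s.2.val p.1))).prod : D.Amb) = baseFun fun _ => 1 := by
      funext p
      simp [baseFun]
    rw [e]
    refine ⟨baseFun_mem smooth_one_base, ?_, h1⟩
    rw [retract_baseFun]
    exact baseFun_mem smooth_one_base
  | cons s L ih =>
    obtain ⟨hs, hL⟩ := List.forall_mem_cons.1 hL
    obtain ⟨ih1, ih2, ih3⟩ := ih hL
    have hgen : (fun p => GSym.gen D.wt s.1 (s.2.val p.1) : D.Amb) ∈ D.smoothFun (D.wt s.1) ∧
        retract σ φ (fun p => GSym.gen D.wt s.1 (s.2.val p.1)) ∈ D.smoothFun (D.wt s.1) ∧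
        Θ (D.wt s.1) (retract σ φ (fun p => GSym.gen D.wt s.1 (s.2.val p.1))) =
          Θ (D.wt s.1) (fun p => GSym.gen D.wt s.1 (s.2.val p.1)) := by
      obtain ⟨j, α⟩ := s
      cases j with
      | A => exact hA α
      | B => exact hB α
      | C i => simp at hs
    have e : (fun p => ((s :: L).map (fun s => GSym.gen D.wt s.1 (s.2.val p.1))).prod : D.Amb) =
        (fun p => GSym.gen D.wt s.1 (s.2.val p.1)) *
          fun p => (L.map (fun s => GSym.gen D.wt s.1 (s.2.val p.1))).prod := by
      funext p
      simp
    rw [e, List.map_cons, List.sum_cons]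
    refine ⟨mul_mem_smoothFun hgen.1 ih1, ?_,
      hΘ.retract_mul_eq hgen.1 ih1 hgen.2.1 ih2 hgen.2.2 ih3⟩
    rw [retract_mul]
    exact mul_mem_smoothFun hgen.2.1 ih2

/-- A derivation along the graph that kills the coordinates that vanish on the graph factors
through the retraction onto the graph. -/
theorem retract_eq [T2Space S] [IsManifold (𝓡 m) ∞ S] (hΘ : IsGraphDerivation σ φ x Θ)
    (hl : ∀ l : DualSec D.N, Θ 0 (baseFun fun p => l.val p.1 p.2 - l.val p.1 (σ p.1)) = 0)
    (hη : ∀ β : DualSec D.B, Θ D.k (etaFun β - xiFun (φ.pull β)) = 0)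
    {e : ℤ} {f : D.Amb} (hf : f ∈ D.smoothFun₀ e) :
    retract σ φ f ∈ D.smoothFun e ∧ Θ e (retract σ φ f) = Θ e f := by
  induction hf using Submodule.span_induction with
  | mem f hf =>
    obtain ⟨c, hc, L, hL, rfl, rfl⟩ := hf
    have hc' : D.N.IsSmoothFun c := hc
    have hcσ : D.N.IsSmoothFun (fun p => c ⟨p.1, σ p.1⟩) :=
      D.N.isSmoothFun_comp_proj (D.N.isSmoothFun_comp_sec hc' σ)
    obtain ⟨h1, h2, h3⟩ := hΘ.prod_retract hη (hΘ.baseFun_retract hl smooth_one_base) L hL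
    have e : (fun p => c p • (L.map (fun s => GSym.gen D.wt s.1 (s.2.val p.1))).prod : D.Amb) =
        baseFun c * fun p => (L.map (fun s => GSym.gen D.wt s.1 (s.2.val p.1))).prod := by
      funext p
      simp [baseFun, Algebra.smul_def]
    have hr : retract σ φ (baseFun c) ∈ D.smoothFun 0 := by
      rw [retract_baseFun]
      exact baseFun_mem hcσ
    rw [e]
    constructor
    · rw [retract_mul]
      simpa using mul_mem_smoothFun hr h2
    · simpa using hΘ.retract_mul_eq (baseFun_mem hc') h1 hr h2 (hΘ.baseFun_retract hl hc') h3
  | zero =>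
    rw [retract_zero]
    exact ⟨Submodule.zero_mem _, rfl⟩
  | add f g hf hg ihf ihg =>
    have hf' : f ∈ D.smoothFun e := smoothFun₀_le_smoothFun e hf
    have hg' : g ∈ D.smoothFun e := smoothFun₀_le_smoothFun e hg
    rw [retract_add]
    refine ⟨Submodule.add_mem _ ihf.1 ihg.1, ?_⟩
    rw [hΘ.add e _ ihf.1 _ ihg.1, hΘ.add e _ hf' _ hg', ihf.2, ihg.2]
  | smul r f hf ihf =>
    have hf' : f ∈ D.smoothFun e := smoothFun₀_le_smoothFun e hf
    rw [retract_smul]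
    refine ⟨Submodule.smul_mem _ r ihf.1, ?_⟩
    rw [hΘ.smul e _ ihf.1, hΘ.smul e _ hf', ihf.2]

end IsGraphDerivation

/-! ## The derivations given by `Q` -/

theorem sgn_ne_zero (a : ℤ) : sgn a ≠ 0 := left_ne_zero_of_mul_eq_one (sgn_mul_self a)

/-- The Leibniz rule is stated in the last slot and linearity in the first; this passes between
them. The prefix `K` is there for the induction. -/
theorem _root_.BlendedQ.MultiVF.op_append_cons {d : ℤ} (Z : MultiVF D d) (f : D.GFun)
    (M : List D.GFun) : ∀ K : List D.GFun, D.SmoothList (K ++ f :: M) →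
    Z.op (K ++ f :: M) = sgn ((f.1 - 1) * D.shSum M) • Z.op (K ++ (M ++ [f])) := by
  induction M with
  | nil => intro K _; simp [shSum, sgn_zero]
  | cons g M ih =>
    intro K hK
    have h1 := Z.symm K M f g hK
    have h2 := ih (K ++ [g]) (fun k hk => hK k (by
      simp only [List.mem_append, List.mem_cons, List.not_mem_nil] at hk ⊢; tauto))
    simp only [List.append_assoc, List.cons_append, List.nil_append] at h2
    rw [h1, h2, smul_smul, ← sgn_add, List.cons_append]
    congr 2
    simp only [shSum, List.map_cons, List.sum_cons]
    ring

theorem _root_.BlendedQ.BlendedHVF.op_cons (Q : BlendedHVF D) (f : D.GFun) (M : List D.GFun)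
    (hM : D.SmoothList (f :: M)) :
    Q.op (f :: M) = sgn ((f.1 - 1) * D.shSum M) • Q.op (M ++ [f]) := by
  have h1 := Q.pos.op_append_cons f M [] hM
  have h2 := Q.neg.op_append_cons f M [] hM
  simp only [List.nil_append] at h1 h2
  rw [BlendedHVF.op, h1, h2, ← smul_add]
  rfl

/-- The degrees `1` and `-1` have the same parity, so `Q⁺` and `Q⁻` obey the Leibniz rule with the
same signs and their sum does too. -/
theorem _root_.BlendedQ.BlendedHVF.op_leibniz (Q : BlendedHVF D) {L : List D.GFun}
    (hL : D.SmoothList L) (e e' : ℤ) {f g : D.Amb} (hf : f ∈ D.smoothFun e)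
    (hg : g ∈ D.smoothFun e') :
    Q.op (L ++ [(e + e', f * g)]) = Q.op (L ++ [(e, f)]) * g +
      sgn ((1 + D.shSum L) * e) • (f * Q.op (L ++ [(e', g)])) := by
  have h1 := Q.pos.leibniz L hL e e' f hf g hg
  have h2 := Q.neg.leibniz L hL e e' f hf g hg
  have h3 : sgn ((-1 + D.shSum L) * e) = sgn ((1 + D.shSum L) * e) := by
    have h4 : (1 + D.shSum L) * e = (-1 + D.shSum L) * e + (e + e) := by ring
    rw [h4, sgn_add, sgn_add e e, sgn_mul_self, mul_one]
  rw [h3] at h2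
  simp only [BlendedHVF.op, h1, h2, mul_add, add_mul, smul_add]
  abel

/-- Moving the first argument to the last place and back costs signs that depend on degrees only;
they make up `ε` and `ε'`. Restriction to the graph is multiplicative. -/
theorem _root_.BlendedQ.BlendedHVF.isGraphDerivation (Q : BlendedHVF D) (x : S) {M : List D.GFun}
    (hM : D.SmoothList M) :
    IsGraphDerivation σ φ x (fun e f => graphRest σ φ x (Q.op ((e, f) :: M))) where
  add e f hf g hg := by
    have h : Q.op ((e, f + g) :: M) = Q.op ((e, f) :: M) + Q.op ((e, g) :: M) := by
      simp only [BlendedHVF.op, Q.pos.add M hM e f hf g hg, Q.neg.add M hM e f hf g hg]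
      abel
    simp only [h, graphRest, Pi.add_apply, map_add]
  smul e f hf r := by
    have h : Q.op ((e, r • f) :: M) = r • Q.op ((e, f) :: M) := by
      simp only [BlendedHVF.op, Q.pos.smul M hM e f hf r, Q.neg.smul M hM e f hf r, smul_add]
    simp only [h, graphRest, Pi.smul_apply, map_smul]
  leibniz e e' := by
    have hmove : ∀ e f, f ∈ D.smoothFun e →
        Q.op (M ++ [(e, f)]) = sgn ((e - 1) * D.shSum M) • Q.op ((e, f) :: M) := by
      intro e f hf
      rw [Q.op_cons (e, f) M (List.forall_mem_cons.2 ⟨hf, hM⟩), smul_smul, sgn_mul_self, one_smul]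
    refine ⟨sgn ((e + e' - 1) * D.shSum M) * sgn ((e - 1) * D.shSum M),
      sgn ((e + e' - 1) * D.shSum M) * (sgn ((1 + D.shSum M) * e) * sgn ((e' - 1) * D.shSum M)),
      mul_ne_zero (sgn_ne_zero _) (mul_ne_zero (sgn_ne_zero _) (sgn_ne_zero _)), ?_⟩
    intro f hf g hg
    have h : Q.op ((e + e', f * g) :: M) =
        (sgn ((e + e' - 1) * D.shSum M) * sgn ((e - 1) * D.shSum M)) • (Q.op ((e, f) :: M) * g) +
        (sgn ((e + e' - 1) * D.shSum M) *
          (sgn ((1 + D.shSum M) * e) * sgn ((e' - 1) * D.shSum M))) •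
          (f * Q.op ((e', g) :: M)) := by
      rw [Q.op_cons (e + e', f * g) M
        (List.forall_mem_cons.2 ⟨mul_mem_smoothFun hf hg, hM⟩), Q.op_leibniz hM e e' hf hg,
        hmove e f hf, hmove e' g hg]
      simp only [smul_add, smul_mul_assoc, mul_smul_comm, smul_smul]
    rw [h]
    simp [graphRest]

/-! ## The main theorem -/

theorem shift_one_inl (l : DualSec D.N) : shift σ φ 1 [D.linFun (.inl l)] =
    [(0, baseFun fun p => l.val p.1 p.2 - l.val p.1 (σ p.1))] := by
  simp only [shift, List.map_cons, List.map_nil, linFun_inl, graphVF_baseFun_linear]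
  congr 2
  funext p
  simp [baseFun, sub_eq_add_neg]

theorem shift_one_inr (β : DualSec D.B) : shift σ φ 1 [D.linFun (.inr β)] =
    [((D.k : ℤ), etaFun β - xiFun (φ.pull β))] := by
  simp [shift, linFun_inr, graphVF_etaFun, sub_eq_add_neg]

theorem shift_one_linFun_mem (L : List D.Lin) : ∀ f ∈ shift σ φ 1 (L.map D.linFun),
    f.2 ∈ D.smoothFun₀ f.1 ∧ (D.graph σ φ).Vanishes f.2 := by
  intro f hf
  simp only [shift, List.map_map, List.mem_map, Function.comp_apply] at hf
  obtain ⟨l, -, rfl⟩ := hf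
  have hl := isPolyAffine_linFun σ φ l
  refine ⟨polyFun₀_le_smoothFun₀ _ (Submodule.add_mem _ hl.2.1
    (Submodule.smul_mem _ _ (Submodule.neg_mem _ hl.2.2))), ?_⟩
  rw [vanishes_graph_iff]
  intro x
  rcases l with l | β
  · simp only [linFun_inl, graphVF_baseFun_linear, graphRest, Pi.add_apply, Pi.smul_apply,
      Pi.neg_apply, baseFun]
    simp
  · simp only [linFun_inr, graphVF_etaFun, graphRest, Pi.add_apply, Pi.smul_apply,
      Pi.neg_apply, map_add, map_smul, map_neg]
    change D.rest x (φ.val x) 1 (D.eta x (β.val x)) +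
      (1 : ℝ) • -D.rest x (φ.val x) 1 (D.xi x ((β.val x).comp (φ.val x))) = 0
    rw [rest_eta, rest_xi]
    simp

theorem shift_append (t : ℝ) (L L' : List D.GFun) :
    shift σ φ t (L ++ L') = shift σ φ t L ++ shift σ φ t L' := by
  simp [shift]

/-- Induction on the number of arbitrary functions, with any number of shifted coordinates behind
them. For the first function `f`, with the others fixed, `Q` is a derivation along the graph. By the
induction hypothesis it kills the shifted coordinates, so it factors through the retraction, and the
retraction of `f` is zero. -/
theorem graphRest_op_eq_zero [T2Space S] [IsManifold (𝓡 m) ∞ S] (Q : BlendedHVF D) (x : S)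
    (h : ∀ L : List D.Lin, graphRest σ φ x (Q.op (shift σ φ 1 (L.map D.linFun))) = 0)
    (L : List D.GFun) (hL : ∀ f ∈ L, f.2 ∈ D.smoothFun₀ f.1 ∧ (D.graph σ φ).Vanishes f.2) :
    ∀ L' : List D.Lin, graphRest σ φ x (Q.op (L ++ shift σ φ 1 (L'.map D.linFun))) = 0 := by
  induction L with
  | nil => exact h
  | cons f L ih =>
    intro L'
    obtain ⟨hf, hL⟩ := List.forall_mem_cons.1 hL
    have hM : D.SmoothList (L ++ shift σ φ 1 (L'.map D.linFun)) := by
      intro k hk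
      rcases List.mem_append.1 hk with hk | hk
      · exact smoothFun₀_le_smoothFun _ (hL k hk).1
      · exact smoothFun₀_le_smoothFun _ (shift_one_linFun_mem σ φ L' k hk).1
    have hΘ := Q.isGraphDerivation σ φ x hM
    have hz : ∀ (l : D.Lin) (z : D.GFun), shift σ φ 1 [D.linFun l] = [z] →
        graphRest σ φ x (Q.op (z :: (L ++ shift σ φ 1 (L'.map D.linFun)))) = 0 := by
      intro l z hlz
      -- A coordinate in the first slot is moved to the end, where it counts as one more element of
      -- `L'`.
      have h1 := ih hL (L' ++ [l])
      rw [List.map_append, List.map_singleton, shift_append, hlz, ← List.append_assoc] at h1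
      have hzm : z.2 ∈ D.smoothFun z.1 := by
        have := shift_one_linFun_mem σ φ [l] z (by
          rw [List.map_singleton, hlz]; exact List.mem_singleton_self z)
        exact smoothFun₀_le_smoothFun _ this.1
      rw [Q.op_cons z _ (List.forall_mem_cons.2 ⟨hzm, hM⟩)]
      unfold graphRest at h1 ⊢
      rw [Pi.smul_apply, map_smul, h1, smul_zero]
    have h2 := (hΘ.retract_eq (fun l => hz (.inl l) _ (shift_one_inl σ φ l))
      (fun β => hz (.inr β) _ (shift_one_inr σ φ β)) hf.1).2
    have h3 : retract σ φ f.2 = 0 := by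
      funext p
      have := (vanishes_graph_iff σ φ f.2).1 hf.2 p.1
      simp [retract, this]
    rw [h3, hΘ.map_zero] at h2
    exact h2.symm

theorem isCoisotropicType_graph_iff [T2Space S] [IsManifold (𝓡 m) ∞ S] (Q : BlendedHVF D) :
    (D.graph σ φ).IsCoisotropicType Q ↔ ∀ (L : List D.Lin) (x : S),
      graphRest σ φ x (Q.op (shift σ φ 1 (L.map D.linFun))) = 0 := by
  constructor
  · intro h L x
    exact (vanishes_graph_iff σ φ _).1 (h _ (shift_one_linFun_mem σ φ L)) x
  · intro h L hL
    rw [vanishes_graph_iff]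
    intro x
    have := graphRest_op_eq_zero σ φ Q x (fun L => h L x) L hL []
    simpa [shift] using this

end GradedMfd

end Graded

end BlendedQ

end

/-! ### The theorem -/

theorem mainTheorem2 {m : ℕ} {S : Type*} [TopologicalSpace S] [T2Space S] [SigmaCompactSpace S]
    [ChartedSpace (EuclideanSpace ℝ (Fin m)) S] [IsManifold (𝓡 m) ∞ S]
    (D : BlendedQ.GradedMfd m S) (Q : BlendedQ.BlendedHVF D) (hQ : D.IsAnalytic Q.op)
    (σ : D.N.Sec) (φ : BlendedQ.BundleHom D.A D.B) :
    (D.graph σ φ).IsCoisotropicType Q ↔ Q.IsMaurerCartan (-(D.deform σ φ)) := by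
  rw [BlendedQ.GradedMfd.isCoisotropicType_graph_iff, BlendedQ.GradedMfd.isMaurerCartan_iff Q hQ]
  rfl
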